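/- Let $d\ge 1$. A particle starts at the origin of $\mathbb R^d$ and performs a $d$-dimensional Wiener process for one unit of time; then it dies at the place it has reached and is replaced there by $Y$ offspring, where $P(Y=\ell)=p_\ell$ $(\ell=0,1,2,\dots)$, $m=\sum_\ell \ell p_\ell\in(1,\infty)$ and $\sum_\ell(\ell-m)^2p_\ell<\infty$. Each offspring, from its birthplace, independently repeats this procedure, and so on; all Wiener processes and offspring numbers are independent. For integers $t\ge 0$ let $\lambda(x,t)$ be the number of particles at the point $x$ at time $t$, and $\psi(A,t)=\sum_{x\in A}\lambda(x,t)$ the number of particles in $A\subset\mathbb R^d$ at time $t$. The particles may be counted in either of two ways: (a) just before the branching at time $t$ (with the single particle at the origin at $t=0$), in which case $\lambda(\cdot,t)$ is taken to be the $\{0,1\}$-valued indicator that $x$ is occupied (almost surely no two particles are then at the same place); or (b) just after the branching at time $t$ (again with the single particle at the origin at $t=0$), with multiplicity. The assertion below holds for each of the two ways (with a family $(N_\alpha)$ that depends on the way). For multi-indices $\alpha,\beta\in\mathbb Z_+^d$ write $|\alpha|=\sum_i\alpha_i$, $\alpha!=\prod_i\alpha_i!$, $x^\alpha=\prod_i x_i^{\alpha_i}$,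 $\beta\preceq\alpha$ if $\beta_i\le\alpha_i$ for all $i$, $\binom{\alpha}{\beta}=\prod_i\binom{\alpha_i}{\beta_i}$, and $$M_\beta(A)=\int_A x^\beta\,dx,\qquad H_\alpha(x,t)=\prod_{i=1}^d H_{\alpha_i}(x_i,t),\qquad H_n(x,t)=\sum_{j=0}^{\lfloor n/2\rfloor}\frac{n!}{j!\,(n-2j)!}\Big(\frac{-t}{2}\Big)^j x^{n-2j}.$$ **Theorem.** There are real-valued random variables $(N_\alpha)_{\alpha\in\mathbb Z_+^d}$ such that: 1. for every $\alpha$, the process $m^{-t}\sum_y H_\alpha(y,t)\lambda(y,t)$ (with $t\ge1$ in case (a), $t\ge0$ in case (b)) is a martingale with respect to the history of the branching process (the paths and offspring numbers up to the moment of counting at time $t$), and it converges almost surely to $N_\alpha$ as $t\to\infty$; 2. for every integer $k\ge1$ and every bounded Borel set $A\subset\mathbb R^d$, almost surely, as $T\to\infty$ through the integers, $$(2\pi T)^{d/2}\,\frac{\psi(A,T)}{m^T}=\sum_{n=0}^k\frac{(-T)^{-n}}{2^n}\sum_{|\alpha|=n}\frac1{\alpha!}\sum_{\beta\preceq2\alpha}\binom{2\alpha}{\beta}(-1)^{|\beta|}M_\beta(A)\,N_{2\alpha-\beta}+o(T^{-k}).$$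 -/

import Mathlib

open MeasureTheory ProbabilityTheory Filter Topology Asymptotics
open scoped NNReal

/-! Points of `ℝ^d` are functions `Fin d → ℝ`; bounded sets, Borel sets and Lebesgue measure on
this space are the usual ones. Multi-indices are functions `Fin d → ℕ`. -/

namespace BranchingWiener

noncomputable section

/-- `W` is a Wiener process in `ℝ^d` started at the origin: its coordinates are independent
standard real Brownian motions. -/
structure IsWienerProcess {Ω : Type*} [MeasurableSpace Ω] {d : ℕ}
    (W : ℝ≥0 → Ω → (Fin d → ℝ)) (P : Measure Ω) : Prop where
  measurable : ∀ s, Measurable (W s)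
  brownian : ∀ i, IsBrownianReal (fun s ω => W s ω i) P
  indep : iIndep (fun i => ⨆ s : ℝ≥0, MeasurableSpace.comap (fun ω => W s ω i) inferInstance) P

/-- Particles are labelled by finite words (the most recent letter first): the ancestor is `[]`,
and the children of `u` are `0 :: u, 1 :: u, …`. The data of the model are, for every label `u`,
the Wiener process `W u` (the displacement of `u` since its birth) and the number `Y u` of
offspring by which `u` is replaced at its death; all of them are independent, and the `Y u` have
law `p`. -/
structure IsModel {Ω : Type*} [MeasurableSpace Ω] {d : ℕ} (P : Measure Ω)
    (W : List ℕ → ℝ≥0 → Ω → (Fin d → ℝ)) (Y : List ℕ → Ω → ℕ) (p : ℕ → ℝ) : Prop where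
  wiener : ∀ u, IsWienerProcess (W u) P
  measurable_offspring : ∀ u, Measurable (Y u)
  offspring_law : ∀ u l, P.real {ω | Y u ω = l} = p l
  indep : iIndep (Sum.elim
    (fun u : List ℕ => ⨆ s : ℝ≥0, MeasurableSpace.comap (W u s) inferInstance)
    (fun u : List ℕ => MeasurableSpace.comap (Y u) inferInstance)) P

section Trees

variable {Ω : Type*} {d : ℕ}

/-- The particles of generation `n`, which live during the time interval `[n, n + 1]`. -/
def generation (Y : List ℕ → Ω → ℕ) (ω : Ω) : ℕ → Finset (List ℕ)
  | 0 => {[]}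
  | n + 1 => (generation Y ω n).biUnion fun u => (Finset.range (Y u ω)).image fun i => i :: u

/-- The place where the particle `u` is born: the place where its parent died. -/
def birthPlace (W : List ℕ → ℝ≥0 → Ω → (Fin d → ℝ)) (ω : Ω) : List ℕ → (Fin d → ℝ)
  | [] => 0
  | _ :: u => birthPlace W ω u + W u 1 ω

/-- The place that the particle `u` has reached when it dies, one unit of time after its birth. -/
def deathPlace (W : List ℕ → ℝ≥0 → Ω → (Fin d → ℝ)) (ω : Ω) (u : List ℕ) : Fin d → ℝ :=
  birthPlace W ω u + W u 1 ω

/-- `x` is occupied by a particle at time `t`. The particles that are present at time `t + 1` have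
just covered their last unit of path and are about to branch. -/
def IsOccupied (W : List ℕ → ℝ≥0 → Ω → (Fin d → ℝ)) (Y : List ℕ → Ω → ℕ) (x : Fin d → ℝ) (ω : Ω) :
    ℕ → Prop
  | 0 => x = 0
  | t + 1 => ∃ u ∈ generation Y ω t, deathPlace W ω u = x

open Classical in
/-- `λ(x, t)`, observed just before the branching at time `t`: the indicator that `x` is
occupied. -/
def occBefore (W : List ℕ → ℝ≥0 → Ω → (Fin d → ℝ)) (Y : List ℕ → Ω → ℕ) (t : ℕ) (ω : Ω)
    (x : Fin d → ℝ) : ℝ :=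
  if IsOccupied W Y x ω t then 1 else 0

open Classical in
/-- `λ(x, t)`, observed just after the branching at time `t`: the number of particles at `x`
(siblings are born at the same place, so that an indicator would not count them). -/
def occAfter (W : List ℕ → ℝ≥0 → Ω → (Fin d → ℝ)) (Y : List ℕ → Ω → ℕ) (t : ℕ) (ω : Ω)
    (x : Fin d → ℝ) : ℝ :=
  ((generation Y ω t).filter fun u => birthPlace W ω u = x).card

end Trees

/-- `ψ(A) = ∑_{x ∈ A} λ(x)` for an occupation function `λ` (which has finite support). -/
def particleCount {d : ℕ} (occ : (Fin d → ℝ) → ℝ) (A : Set (Fin d → ℝ)) : ℝ :=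
  ∑ᶠ x ∈ A, occ x

/-- `H_n(x, t) = ∑_{j ≤ n/2} n! / (j! (n - 2j)!) (-t/2)^j x^(n - 2j)`. -/
def hermite (n : ℕ) (x t : ℝ) : ℝ :=
  ∑ j ∈ Finset.range (n / 2 + 1),
    (n.factorial : ℝ) / (j.factorial * (n - 2 * j).factorial) * (-t / 2) ^ j * x ^ (n - 2 * j)

/-- `H_α(x, t) = ∏_i H_{α_i}(x_i, t)`. -/
def hermiteMulti {d : ℕ} (α : Fin d → ℕ) (x : Fin d → ℝ) (t : ℝ) : ℝ :=
  ∏ i, hermite (α i) (x i) t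

/-- `m^{-t} V_α(t)`, where `V_α(t) = ∑_y H_α(y, t) λ(y, t)`. -/
def normalizedSum {d : ℕ} (m : ℝ) (α : Fin d → ℕ) (t : ℕ) (occ : (Fin d → ℝ) → ℝ) : ℝ :=
  (∑ᶠ y, hermiteMulti α y t * occ y) / m ^ t

/-- `M_β(A) = ∫_A x^β dx`. -/
def moment {d : ℕ} (β : Fin d → ℕ) (A : Set (Fin d → ℝ)) : ℝ :=
  ∫ x in A, ∏ i, x i ^ β i

/-- `∑_{n=0}^k (-T)^{-n} 2^{-n} ∑_{|α|=n} (1/α!) ∑_{β ≤ 2α} C(2α, β) (-1)^{|β|} M_β(A) N_{2α-β}`. -/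
def expansion {d : ℕ} (N : (Fin d → ℕ) → ℝ) (A : Set (Fin d → ℝ)) (k : ℕ) (T : ℝ) : ℝ :=
  ∑ n ∈ Finset.range (k + 1), ((-T) ^ n)⁻¹ / 2 ^ n *
    ∑ α ∈ Finset.piAntidiag (Finset.univ : Finset (Fin d)) n,
      (1 / ∏ i, ((α i).factorial : ℝ)) *
        ∑ β ∈ Finset.Iic (2 • α),
          ((∏ i, ((2 * α i).choose (β i) : ℝ)) * (-1) ^ (∑ i, β i) * moment β A * N (2 • α - β))

section Histories

variable {Ω : Type*} {d : ℕ}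

/-- The information generated by the paths of the particles of generations `< a` and by the
offspring numbers of the particles of generations `< b`. -/
abbrev history (W : List ℕ → ℝ≥0 → Ω → (Fin d → ℝ)) (Y : List ℕ → Ω → ℕ) (a b : ℕ) :
    MeasurableSpace Ω :=
  (⨆ (u : List ℕ) (_ : u.length < a) (s : ℝ≥0) (_ : s ≤ 1),
      MeasurableSpace.comap (W u s) inferInstance) ⊔
    ⨆ (u : List ℕ) (_ : u.length < b), MeasurableSpace.comap (Y u) inferInstance

theorem history_mono (W : List ℕ → ℝ≥0 → Ω → (Fin d → ℝ)) (Y : List ℕ → Ω → ℕ) {a b a' b' : ℕ}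
    (ha : a ≤ a') (hb : b ≤ b') : history W Y a b ≤ history W Y a' b' := by
  refine sup_le_sup ?_ ?_
  · exact iSup_mono fun u => iSup_mono' fun h => ⟨h.trans_le ha, le_rfl⟩
  · exact iSup_mono fun u => iSup_mono' fun h => ⟨h.trans_le hb, le_rfl⟩

theorem history_le [mΩ : MeasurableSpace Ω] {P : Measure Ω} {W : List ℕ → ℝ≥0 → Ω → (Fin d → ℝ)} {Y : List ℕ → Ω → ℕ}
    {p : ℕ → ℝ} (h : IsModel P W Y p) (a b : ℕ) : history W Y a b ≤ mΩ := by
  refine sup_le ?_ ?_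
  · exact iSup_le fun u => iSup_le fun _ => iSup_le fun s => iSup_le fun _ =>
      ((h.wiener u).measurable s).comap_le
  · exact iSup_le fun u => iSup_le fun _ => (h.measurable_offspring u).comap_le

/-- The information about the process just before the branching at time `t + 1`, indexed by
`t = 0, 1, 2, …`. -/
def historyBefore [mΩ : MeasurableSpace Ω] {P : Measure Ω}
    {W : List ℕ → ℝ≥0 → Ω → (Fin d → ℝ)} {Y : List ℕ → Ω → ℕ} {p : ℕ → ℝ} (h : IsModel P W Y p) : Filtration ℕ mΩ where
  seq t := history W Y (t + 1) t
  mono' _ _ hst := history_mono W Y (Nat.succ_le_succ hst) hst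
  le' t := history_le h (t + 1) t

/-- The information about the process just after the branching at time `t`, indexed by
`t = 0, 1, 2, …`. -/
def historyAfter [mΩ : MeasurableSpace Ω] {P : Measure Ω}
    {W : List ℕ → ℝ≥0 → Ω → (Fin d → ℝ)} {Y : List ℕ → Ω → ℕ} {p : ℕ → ℝ} (h : IsModel P W Y p) : Filtration ℕ mΩ where
  seq t := history W Y t t
  mono' _ _ hst := history_mono W Y hst hst
  le' t := history_le h t t

end Histories

end

end BranchingWiener

/-! Put T = s + n with s = `Nat.sqrt T`, and let P be the one-step heat operator. The proof compares
the count at time T with its conditional expectation given the first s generations, then expands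
that conditional expectation.

Noise. A unit of time adds to a sum of f over the particles two families of errors: displacements,
which replace f by Pf, and offspring numbers, which replace Y by m. Within a generation the errors
of distinct particles are orthogonal, because each has mean zero given all other sources of
randomness. With the many-to-one formula (`IsModel.lintegral_sum_birthPlace`), the L² norm of the
sum is at most a constant times m^(t/2) times the Gaussian L² norm of f. After division by m^t the
step costs r^t with r = m^(-1/2) (`IsModel.hasStepBound`). For f = P^j 1_A the steps telescope, so
the normalized count at T differs from the sum of P^n 1_A over generation s by O(r^s) in L¹. This
beats every power of T. For f = H_α(·, t), which satisfies P H_α(·, t+1) = H_α(·, t), the same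
estimate shows that the martingale increments are summable with any polynomial weight. Hence the
limits exist, and the value at time s is within o(T^(-k)) of the limit.

Heat kernel. Completing the square gives (2πT)^(d/2) p_n(x, y) = E exp(-Σ_i (x_i - y_i + i√s
G_i)²/(2T)) with G standard Gaussian. Since E (z + i√s G)^α = H_α(z, s), the Taylor polynomial of
the exponential produces the Hermite polynomials H_{2α}(x - y, s). The binomial formula and
integration over A then give exactly `expansion` with H_α(x, s) in place of N_α
(`exists_heatIndicator_sub_expansion_le`). The remainder is at most C (s/T)^(K+1) exp(|x|²/(4s)),
and at a typical position x = √s G the last factor has finite mean. As s² ≤ T, the choice K = 2k + 3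
makes the error O(T^(-k-2)).

Every error, multiplied by T^k, thus has L¹ norms summable in T or is a tail of a convergent series,
so it vanishes almost surely. Just before branching, almost surely no two particles share a site,
which lets the indicator count particles. -/

namespace BranchingWiener

noncomputable section

/-! ### Hermite polynomials and their addition theorem -/

section HermiteAlgebra

/-- The exponential generating series of `n ↦ H_n(x, t)`. -/
def hermiteSeries (x t : ℝ) : PowerSeries ℝ :=
  PowerSeries.mk fun n => hermite n x t / n.factorial

/-- This is the generating function exp(-tX²/2) exp(xX). The first factor is a series in X², so only
the indices 2j contribute to the Cauchy product. -/
theorem hermiteSeries_eq (x t : ℝ) : hermiteSeries x t =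
    PowerSeries.expand 2 two_ne_zero (PowerSeries.rescale (-t / 2) (PowerSeries.exp ℝ)) *
      PowerSeries.rescale x (PowerSeries.exp ℝ) := by
  ext n
  have hn : (n.factorial : ℝ) ≠ 0 := by positivity
  rw [hermiteSeries, PowerSeries.coeff_mk, PowerSeries.coeff_mul,
    Finset.Nat.sum_antidiagonal_eq_sum_range_succ_mk, hermite, Finset.sum_div]
  have hsub : (Finset.range (n / 2 + 1)).image (fun j => 2 * j) ⊆ Finset.range n.succ := by
    intro k hk
    simp only [Finset.mem_image, Finset.mem_range] at hk ⊢
    omega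
  rw [← Finset.sum_subset hsub, Finset.sum_image (by intro a _ b _; simp)]
  · refine Finset.sum_congr rfl fun j hj => ?_
    rw [PowerSeries.coeff_expand_mul]
    simp only [PowerSeries.coeff_rescale, PowerSeries.coeff_exp]
    have : ((n - 2 * j).factorial : ℝ) ≠ 0 := by positivity
    have : (j.factorial : ℝ) ≠ 0 := by positivity
    simp
    field_simp
  · intro k hk hk'
    rw [PowerSeries.coeff_expand_of_not_dvd, zero_mul]
    rintro ⟨j, rfl⟩
    apply hk'
    simp only [Finset.mem_image, Finset.mem_range] at hk ⊢
    exact ⟨j, by omega, rfl⟩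

theorem hermiteSeries_add (x y t s : ℝ) :
    hermiteSeries (x + y) (t + s) = hermiteSeries x t * hermiteSeries y s := by
  rw [hermiteSeries_eq, hermiteSeries_eq, hermiteSeries_eq, ← PowerSeries.exp_mul_exp_eq_exp_add,
    show -(t + s) / 2 = -t / 2 + -s / 2 by ring, ← PowerSeries.exp_mul_exp_eq_exp_add, map_mul]
  ring

/-- Compare coefficients in the multiplicativity of the generating series. Negative times are
allowed, and this matters: time -1 encodes the Gaussian moments. -/
theorem hermite_add_add (n : ℕ) (x y t s : ℝ) : hermite n (x + y) (t + s) =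
    ∑ k ∈ Finset.range (n + 1), (n.choose k : ℝ) * (hermite k x t * hermite (n - k) y s) := by
  have h := congrArg (PowerSeries.coeff n) (hermiteSeries_add x y t s)
  rw [PowerSeries.coeff_mul, Finset.Nat.sum_antidiagonal_eq_sum_range_succ_mk] at h
  simp only [hermiteSeries, PowerSeries.coeff_mk] at h
  have hn : (n.factorial : ℝ) ≠ 0 := by positivity
  rw [div_eq_iff hn, Finset.sum_mul] at h
  rw [h]
  refine Finset.sum_congr rfl fun k hk => ?_
  rw [Nat.cast_choose ℝ (by simpa [Nat.lt_succ_iff] using hk : k ≤ n)]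
  field_simp

theorem hermite_zero_right (n : ℕ) (x : ℝ) : hermite n x 0 = x ^ n := by
  rw [hermite, Finset.sum_eq_single 0]
  · have hn : (n.factorial : ℝ) ≠ 0 := by positivity
    simp [hn]
  · intro j _ hj
    simp [hj]
  · simp

/-- Parabolic homogeneity: each monomial has degree n when t counts twice. -/
theorem hermite_mul_sq (n : ℕ) (c x t : ℝ) :
    hermite n (c * x) (c ^ 2 * t) = c ^ n * hermite n x t := by
  rw [hermite, hermite, Finset.mul_sum]
  refine Finset.sum_congr rfl fun j hj => ?_
  have : 2 * j + (n - 2 * j) = n := by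
    have := Finset.mem_range.1 hj
    omega
  rw [mul_pow, show -(c ^ 2 * t) / 2 = c ^ 2 * (-t / 2) by ring, mul_pow, ← pow_mul]
  calc _ = (c ^ (2 * j) * c ^ (n - 2 * j)) * ((n.factorial : ℝ) / (j.factorial * (n - 2 * j).factorial) *
      (-t / 2) ^ j * x ^ (n - 2 * j)) := by ring
    _ = _ := by rw [← pow_add, this]

theorem hermite_sub_eq (n : ℕ) (x y s : ℝ) : hermite n (x - y) s =
    ∑ k ∈ Finset.range (n + 1), (n.choose k : ℝ) * (-1) ^ k * y ^ k * hermite (n - k) x s := by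
  have := hermite_add_add n (-y) x 0 s
  rw [zero_add, show -y + x = x - y by ring] at this
  rw [this]
  refine Finset.sum_congr rfl fun k _ => ?_
  rw [hermite_zero_right, neg_pow]
  ring

theorem hermite_zero_left_even (j : ℕ) (t : ℝ) :
    hermite (2 * j) 0 t = ((2 * j).factorial : ℝ) / j.factorial * (-t / 2) ^ j := by
  rw [hermite, Finset.sum_eq_single j]
  · simp
  · intro i hi hij
    have := Finset.mem_range.1 hi
    rw [zero_pow (by omega), mul_zero]
  · intro h
    exact absurd (Finset.mem_range.2 (by omega)) h

theorem hermite_zero_left_odd (j : ℕ) (t : ℝ) : hermite (2 * j + 1) 0 t = 0 := by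
  rw [hermite]
  refine Finset.sum_eq_zero fun i hi => ?_
  have := Finset.mem_range.1 hi
  rw [zero_pow (by omega), mul_zero]

/-- The recursion of the Gaussian moments, used to identify the two sequences. -/
theorem hermite_zero_left_neg_one (n : ℕ) :
    hermite (n + 2) 0 (-1) = (n + 1) * hermite n 0 (-1) := by
  obtain ⟨j, rfl | rfl⟩ := Nat.even_or_odd' n
  · rw [show 2 * j + 2 = 2 * (j + 1) by ring, hermite_zero_left_even, hermite_zero_left_even,
      show 2 * (j + 1) = (2 * j + 1) + 1 by ring, Nat.factorial_succ, Nat.factorial_succ,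
      Nat.factorial_succ j]
    have : (j.factorial : ℝ) ≠ 0 := by positivity
    push_cast
    field_simp
    ring
  · rw [show 2 * j + 1 + 2 = 2 * (j + 1) + 1 by ring, hermite_zero_left_odd, hermite_zero_left_odd,
      mul_zero]

theorem continuous_hermite (n : ℕ) (t : ℝ) : Continuous fun x => hermite n x t := by
  unfold hermite
  fun_prop

end HermiteAlgebra

/-! ### Gaussian moments, real and complex -/

section GaussianMoments

theorem integrable_pow_gaussianReal (n : ℕ) :
    Integrable (fun x : ℝ => x ^ n) (gaussianReal 0 1) := by
  rcases Nat.eq_zero_or_pos n with rfl | hn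
  · simp
  · have h := (memLp_id_gaussianReal (μ := 0) (v := 1) (n : ℝ≥0)).integrable_norm_pow hn.ne'
    refine (integrable_norm_iff (by fun_prop)).1 ?_
    simpa using h

theorem integrable_gaussianReal_iff {f : ℝ → ℝ} : Integrable f (gaussianReal 0 1) ↔
    Integrable fun x => gaussianPDFReal 0 1 x * f x := by
  rw [gaussianReal_of_var_ne_zero 0 one_ne_zero, integrable_withDensity_iff_integrable_smul₀'
    (measurable_gaussianPDF 0 1).aemeasurable (Eventually.of_forall fun _ => gaussianPDF_lt_top)]
  simp only [toReal_gaussianPDF, smul_eq_mul]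

theorem hasDerivAt_gaussianPDFReal (x : ℝ) :
    HasDerivAt (gaussianPDFReal 0 1) (-x * gaussianPDFReal 0 1 x) x := by
  have h : HasDerivAt (fun x : ℝ => (√(2 * Real.pi * 1))⁻¹ * Real.exp (-(x - 0) ^ 2 / (2 * 1)))
      ((√(2 * Real.pi * 1))⁻¹ * (Real.exp (-(x - 0) ^ 2 / (2 * 1)) *
        (-(2 * (x - 0)) / (2 * 1)))) x := by
    refine HasDerivAt.const_mul _ (HasDerivAt.exp (HasDerivAt.div_const ?_ _))
    have := (((hasDerivAt_id' x).sub_const 0).fun_pow 2).fun_neg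
    simpa using this
  refine h.congr_deriv ?_
  simp only [gaussianPDFReal, NNReal.coe_one]
  ring

/-- Integration by parts against φ' = -xφ for the density φ. -/
theorem integral_pow_add_two_gaussianReal (n : ℕ) :
    ∫ x, x ^ (n + 2) ∂gaussianReal 0 1 = (n + 1) * ∫ x, x ^ n ∂gaussianReal 0 1 := by
  have key := integral_mul_deriv_eq_deriv_mul_of_integrable (u := fun x : ℝ => x ^ (n + 1))
    (v := gaussianPDFReal 0 1) (u' := fun x => (n + 1) * x ^ n)
    (v' := fun x => -x * gaussianPDFReal 0 1 x)
    (fun x _ => by simpa using hasDerivAt_pow (n + 1) x)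
    (fun x _ => hasDerivAt_gaussianPDFReal x)
    ((integrable_gaussianReal_iff.1 (integrable_pow_gaussianReal (n + 2))).neg.congr
      (Eventually.of_forall fun x => by simp only [Pi.mul_apply, Pi.neg_apply]; ring))
    (((integrable_gaussianReal_iff.1 (integrable_pow_gaussianReal n)).const_mul (n + 1 : ℝ)).congr
      (Eventually.of_forall fun x => by simp only [Pi.mul_apply]; ring))
    ((integrable_gaussianReal_iff.1 (integrable_pow_gaussianReal (n + 1))).congr
      (Eventually.of_forall fun x => by simp only [Pi.mul_apply]; ring))
  rw [integral_gaussianReal_eq_integral_smul one_ne_zero,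
    integral_gaussianReal_eq_integral_smul one_ne_zero, ← integral_const_mul]
  calc _ = -∫ x : ℝ, x ^ (n + 1) * (-x * gaussianPDFReal 0 1 x) := by
        rw [← integral_neg]
        congr 1 with x
        rw [smul_eq_mul]
        ring
    _ = _ := by
        rw [key, neg_neg]
        congr 1 with x
        rw [smul_eq_mul]
        ring

theorem integral_pow_gaussianReal (n : ℕ) : ∫ x, x ^ n ∂gaussianReal 0 1 = hermite n 0 (-1) := by
  induction n using Nat.twoStepInduction with
  | zero => simp [hermite]
  | one => simp [hermite, integral_id_gaussianReal]
  | more n ih _ => rw [integral_pow_add_two_gaussianReal, hermite_zero_left_neg_one, ih]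

/-- Averaging replaces w^k by H_k(0, -1), and the addition theorem then lowers the time from t + 1
to t. This is the source of the martingale property. -/
theorem integral_hermite_add (n : ℕ) (x t : ℝ) :
    ∫ w, hermite n (x + w) (t + 1) ∂gaussianReal 0 1 = hermite n x t := by
  have h1 : ∀ w, hermite n (x + w) (t + 1) = ∑ k ∈ Finset.range (n + 1),
      (n.choose k : ℝ) * (hermite k x (t + 1) * w ^ (n - k)) := by
    intro w
    have := hermite_add_add n x w (t + 1) 0
    rw [add_zero] at this
    simp only [this, hermite_zero_right]
  simp only [h1]
  rw [integral_finsetSum]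
  · simp only [integral_const_mul, integral_pow_gaussianReal]
    rw [← hermite_add_add n x 0 (t + 1) (-1)]
    congr 1 <;> ring
  · exact fun k _ => ((integrable_pow_gaussianReal (n - k)).const_mul _).const_mul _

/-- Formally the scaling of `hermite_mul_sq` with factor ic: it carries time -1 to time c². -/
theorem hermite_zero_left_eq (n : ℕ) (c : ℝ) : ((hermite n 0 (c ^ 2) : ℝ) : ℂ) =
    (Complex.I * c) ^ n * (hermite n 0 (-1) : ℝ) := by
  obtain ⟨j, rfl | rfl⟩ := Nat.even_or_odd' n
  · rw [hermite_zero_left_even, hermite_zero_left_even, pow_mul (Complex.I * c), mul_pow,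
      Complex.I_sq]
    push_cast
    rw [show -(c : ℂ) ^ 2 / 2 = (-1 * c ^ 2) * (- -1 / 2) by ring, mul_pow (-1 * (c : ℂ) ^ 2)]
    ring
  · simp [hermite_zero_left_odd]

/-- Expand the power; the moments of icG are the values H_j(0, c²), and the addition theorem
recombines them. Through this formula Hermite polynomials enter the heat kernel expansion. -/
theorem integral_add_I_mul_pow (n : ℕ) (z c : ℝ) :
    ∫ g, ((z : ℂ) + Complex.I * c * (g : ℝ)) ^ n ∂gaussianReal 0 1 = hermite n z (c ^ 2) := by
  have h0 := hermite_add_add n z 0 0 (c ^ 2)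
  rw [add_zero, zero_add] at h0
  rw [h0]
  simp only [add_pow]
  rw [integral_finsetSum]
  · push_cast
    refine Finset.sum_congr rfl fun k _ => ?_
    rw [hermite_zero_left_eq, hermite_zero_right, integral_mul_const, integral_const_mul]
    simp only [mul_pow _ (_ : ℂ) (n - k)]
    rw [integral_const_mul, ← integral_pow_gaussianReal, ← integral_complex_ofReal]
    push_cast
    ring
  · intro k _
    refine Integrable.mul_const (Integrable.const_mul ?_ _) _
    simp only [mul_pow _ (_ : ℂ) (n - k)]
    refine Integrable.const_mul ?_ _
    simpa using (integrable_pow_gaussianReal (n - k)).ofReal (𝕜 := ℂ)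

end GaussianMoments

/-! ### The standard Gaussian measure on ℝ^d and its convolutions -/

section StandardGaussian

variable {d : ℕ}

/-- The standard Gaussian measure on `ℝ^d`. -/
def stdGauss (d : ℕ) : Measure (Fin d → ℝ) := Measure.pi fun _ => gaussianReal 0 1

instance : IsProbabilityMeasure (stdGauss d) := by
  unfold stdGauss
  infer_instance

theorem gaussianReal_map_prod (a b : ℝ) (ha : 0 ≤ a) (hb : 0 ≤ b) :
    ((gaussianReal 0 1).prod (gaussianReal 0 1)).map (fun p => √a * p.1 + √b * p.2) =
      (gaussianReal 0 1).map (fun x => √(a + b) * x) := by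
  have h1 : (fun p : ℝ × ℝ => √a * p.1 + √b * p.2) =
      (fun p : ℝ × ℝ => p.1 + p.2) ∘ Prod.map (fun x => √a * x) (fun x => √b * x) := rfl
  rw [h1, ← Measure.map_map (by fun_prop) (by fun_prop),
    ← Measure.map_prod_map _ _ (by fun_prop) (by fun_prop), gaussianReal_map_const_mul,
    gaussianReal_map_const_mul, gaussianReal_map_const_mul]
  have := gaussianReal_conv_gaussianReal (m₁ := √a * 0) (m₂ := √b * 0)
    (v₁ := NNReal.mk (√a ^ 2) (sq_nonneg _) * 1) (v₂ := NNReal.mk (√b ^ 2) (sq_nonneg _) * 1)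
  rw [Measure.conv] at this
  rw [this]
  congr 1
  · simp
  · ext
    simp [Real.sq_sqrt ha, Real.sq_sqrt hb, Real.sq_sqrt (add_nonneg ha hb)]

theorem stdGauss_map_prod (a b : ℝ) (ha : 0 ≤ a) (hb : 0 ≤ b) :
    ((stdGauss d).prod (stdGauss d)).map (fun p => √a • p.1 + √b • p.2) =
      (stdGauss d).map (fun x => √(a + b) • x) := by
  have hpres := measurePreserving_arrowProdEquivProdArrow ℝ ℝ (Fin d)
    (fun _ => gaussianReal 0 1) (fun _ => gaussianReal 0 1)
  rw [stdGauss, ← hpres.map_eq, Measure.map_map (by fun_prop) hpres.measurable]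
  have h1 : (fun p : (Fin d → ℝ) × (Fin d → ℝ) => √a • p.1 + √b • p.2) ∘
      (MeasurableEquiv.arrowProdEquivProdArrow ℝ ℝ (Fin d)) =
      fun (q : Fin d → ℝ × ℝ) i => (fun p : ℝ × ℝ => √a * p.1 + √b * p.2) (q i) := rfl
  rw [h1]
  have h2 : (fun x : Fin d → ℝ => √(a + b) • x) =
      fun (q : Fin d → ℝ) i => (fun x : ℝ => √(a + b) * x) (q i) := rfl
  -- The product formula `Measure.pi_map_pi` needs σ-finite image measures; here they are Gaussian
  -- laws.
  have inst : ∀ _i : Fin d, SigmaFinite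
      (((gaussianReal 0 1).prod (gaussianReal 0 1)).map fun p => √a * p.1 + √b * p.2) := fun _ => by
    rw [gaussianReal_map_prod a b ha hb, gaussianReal_map_const_mul]
    infer_instance
  have inst' : ∀ _i : Fin d, SigmaFinite
      ((gaussianReal 0 1).map fun x => √(a + b) * x) := fun _ => by
    rw [gaussianReal_map_const_mul]
    infer_instance
  rw [h2, Measure.pi_map_pi (f := fun _ (p : ℝ × ℝ) => √a * p.1 + √b * p.2)
      (fun i => by fun_prop),
    Measure.pi_map_pi (f := fun _ (x : ℝ) => √(a + b) * x) (fun i => by fun_prop)]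
  simp only [gaussianReal_map_prod a b ha hb]

theorem lintegral_stdGauss_add {a b : ℝ} (ha : 0 ≤ a) (hb : 0 ≤ b) {f : (Fin d → ℝ) → ENNReal}
    (hf : Measurable f) :
    ∫⁻ x, ∫⁻ y, f (√a • x + √b • y) ∂stdGauss d ∂stdGauss d =
      ∫⁻ x, f (√(a + b) • x) ∂stdGauss d := by
  have h := congrArg (fun μ => ∫⁻ x, f x ∂μ) (stdGauss_map_prod (d := d) a b ha hb)
  rw [lintegral_map hf (by fun_prop), lintegral_map hf (by fun_prop)] at h
  rw [← h, lintegral_prod _ (by fun_prop)]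

theorem integral_stdGauss_add {a b : ℝ} (ha : 0 ≤ a) (hb : 0 ≤ b) {f : (Fin d → ℝ) → ℝ}
    (hf : Measurable f) {C : ℝ} (hC : ∀ x, |f x| ≤ C) :
    ∫ x, ∫ y, f (√a • x + √b • y) ∂stdGauss d ∂stdGauss d =
      ∫ x, f (√(a + b) • x) ∂stdGauss d := by
  have h := congrArg (fun μ => ∫ x, f x ∂μ) (stdGauss_map_prod (d := d) a b ha hb)
  rw [integral_map (by fun_prop) hf.aestronglyMeasurable,
    integral_map (by fun_prop) hf.aestronglyMeasurable] at h
  rw [← h, integral_prod]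
  refine Integrable.of_bound (C := C) ?_ (Eventually.of_forall fun x => hC _)
  exact (hf.comp (by fun_prop)).aestronglyMeasurable

theorem continuous_hermiteMulti (α : Fin d → ℕ) (t : ℝ) :
    Continuous fun x => hermiteMulti α x t := by
  unfold hermiteMulti
  exact continuous_finsetProd _ fun i _ => (continuous_hermite (α i) t).comp (continuous_apply i)

theorem integral_hermiteMulti_add (α : Fin d → ℕ) (x : Fin d → ℝ) (t : ℝ) :
    ∫ w, hermiteMulti α (x + w) (t + 1) ∂stdGauss d = hermiteMulti α x t := by
  simp only [hermiteMulti, stdGauss, Pi.add_apply]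
  rw [integral_fintype_prod_eq_prod (f := fun i w => hermite (α i) (x i + w) (t + 1))]
  simp only [integral_hermite_add]

theorem hermiteMulti_smul_sqrt (α : Fin d → ℕ) {t : ℝ} (ht : 0 ≤ t) (x : Fin d → ℝ) :
    hermiteMulti α (√t • x) t = √t ^ (∑ i, α i) * hermiteMulti α x 1 := by
  simp only [hermiteMulti, ← Finset.prod_pow_eq_pow_sum, ← Finset.prod_mul_distrib]
  refine Finset.prod_congr rfl fun i _ => ?_
  rw [← hermite_mul_sq, Real.sq_sqrt ht, mul_one]
  rfl

theorem integrable_hermite_sq (n : ℕ) :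
    Integrable (fun x => hermite n x 1 ^ 2) (gaussianReal 0 1) := by
  have h : ∀ x, hermite n x 1 ^ 2 = ∑ k ∈ Finset.range (n + 1), ∑ l ∈ Finset.range (n + 1),
      (n.choose k : ℝ) * hermite k 0 1 * ((n.choose l : ℝ) * hermite l 0 1) *
        x ^ ((n - k) + (n - l)) := by
    intro x
    have := hermite_add_add n 0 x 1 0
    rw [add_zero, zero_add] at this
    rw [this, sq, Finset.sum_mul_sum]
    refine Finset.sum_congr rfl fun k _ => Finset.sum_congr rfl fun l _ => ?_
    rw [hermite_zero_right, hermite_zero_right, pow_add]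
    ring
  simp only [h]
  exact integrable_finsetSum _ fun k _ => integrable_finsetSum _ fun l _ =>
    (integrable_pow_gaussianReal _).const_mul _

/-- By parabolic scaling the second moment at time t is t^|α| times the one at time 1. Growth that
is only polynomial in t will be beaten by the geometric factor of the branching. -/
theorem exists_lintegral_hermiteMulti_sq_le (α : Fin d → ℕ) : ∃ C : ℝ≥0, ∀ t : ℕ,
    ∫⁻ w, ‖hermiteMulti α (√(t : ℝ) • w) t‖ₑ ^ 2 ∂stdGauss d ≤ C * (t : ENNReal) ^ (∑ i, α i) := by
  have hint : Integrable (fun x : Fin d → ℝ => hermiteMulti α x 1 ^ 2) (stdGauss d) := by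
    simp only [hermiteMulti, ← Finset.prod_pow]
    exact Integrable.fintype_prod fun i => integrable_hermite_sq (α i)
  have hfin : ∫⁻ w, ‖hermiteMulti α w 1‖ₑ ^ 2 ∂stdGauss d ≠ ⊤ := by
    have := hint.2
    rw [HasFiniteIntegral] at this
    simpa [enorm_pow] using this.ne
  refine ⟨(∫⁻ w, ‖hermiteMulti α w 1‖ₑ ^ 2 ∂stdGauss d).toNNReal, fun t => ?_⟩
  rw [ENNReal.coe_toNNReal hfin]
  have h2 : ∀ w, ‖hermiteMulti α (√(t : ℝ) • w) t‖ₑ ^ 2 =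
      ‖hermiteMulti α w 1‖ₑ ^ 2 * (t : ENNReal) ^ (∑ i, α i) := by
    intro w
    rw [hermiteMulti_smul_sqrt α (Nat.cast_nonneg t), ← enorm_pow, mul_pow, ← pow_mul,
      mul_comm (∑ i, α i), pow_mul, Real.sq_sqrt (Nat.cast_nonneg t), mul_comm, enorm_mul, enorm_pow,
      enorm_pow]
    simp
  simp only [h2]
  rw [lintegral_mul_const _ (by have := (continuous_hermiteMulti α 1).measurable; fun_prop)]

theorem piFinset_range_eq_Iic (α : Fin d → ℕ) :
    Fintype.piFinset (fun i => Finset.range (α i + 1)) = Finset.Iic α := by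
  ext β
  simp [Fintype.mem_piFinset, Pi.le_def]

theorem hermiteMulti_sub_eq (α : Fin d → ℕ) (x y : Fin d → ℝ) (s : ℝ) : hermiteMulti α (x - y) s =
    ∑ β ∈ Finset.Iic α, ((∏ i, ((α i).choose (β i) : ℝ)) * (-1) ^ (∑ i, β i) *
      (∏ i, y i ^ β i) * hermiteMulti (α - β) x s) := by
  simp only [hermiteMulti, Pi.sub_apply, hermite_sub_eq]
  rw [Finset.prod_univ_sum, piFinset_range_eq_Iic]
  simp only [Finset.prod_mul_distrib, Finset.prod_pow_eq_pow_sum]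

/-- The coordinates are independent, so the one-dimensional formula multiplies. -/
theorem integral_prod_add_I_mul_pow (α : Fin d → ℕ) (z : Fin d → ℝ) (c : ℝ) :
    ∫ g, ∏ i, ((z i : ℂ) + Complex.I * c * (g i : ℝ)) ^ α i ∂stdGauss d =
      hermiteMulti α z (c ^ 2) := by
  rw [stdGauss, integral_fintype_prod_eq_prod
    (f := fun i (g : ℝ) => ((z i : ℂ) + Complex.I * c * (g : ℝ)) ^ α i)]
  simp only [integral_add_I_mul_pow, hermiteMulti, Complex.ofReal_prod]

/-- The weight uses half of the exponent x²/2 of the density. It serves as majorant twice: for the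
auxiliary Gaussian in the kernel formula and for the rescaled particle positions. -/
theorem integrable_exp_sq_div_four :
    Integrable (fun x : ℝ => Real.exp (x ^ 2 / 4)) (gaussianReal 0 1) := by
  rw [integrable_gaussianReal_iff]
  have := (integrable_exp_neg_mul_sq (b := 1 / 4) (by norm_num)).const_mul (√(2 * Real.pi * 1))⁻¹
  refine this.congr (Eventually.of_forall fun x => ?_)
  simp only [gaussianPDFReal, NNReal.coe_one, sub_zero]
  rw [mul_assoc (√(2 * Real.pi * 1))⁻¹, ← Real.exp_add]
  congr 2
  ring

theorem integrable_exp_sum_sq_div_four :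
    Integrable (fun x : Fin d → ℝ => Real.exp ((∑ i, x i ^ 2) / 4)) (stdGauss d) := by
  simp only [Finset.sum_div, Real.exp_sum]
  exact Integrable.fintype_prod fun _ => integrable_exp_sq_div_four

theorem pi_gaussianReal_eq_withDensity (x : Fin d → ℝ) {v : ℝ≥0} (hv : v ≠ 0) :
    Measure.pi (fun i => gaussianReal (x i) v) =
      volume.withDensity fun y => ENNReal.ofReal (∏ i, gaussianPDFReal (x i) v (y i)) := by
  refine Measure.pi_eq fun s hs => ?_
  rw [withDensity_apply _ (MeasurableSet.univ_pi hs), volume_pi, Measure.restrict_pi_pi,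
    ← ofReal_integral_eq_lintegral_ofReal, integral_fintype_prod_eq_prod, ENNReal.ofReal_prod_of_nonneg]
  · simp only [gaussianReal_apply_eq_integral _ hv]
  · exact fun i _ => integral_nonneg fun _ => gaussianPDFReal_nonneg _ _ _
  · exact Integrable.fintype_prod_dep fun i => (integrable_gaussianPDFReal (x i) v).restrict
  · exact Eventually.of_forall fun y => Finset.prod_nonneg fun i _ => gaussianPDFReal_nonneg _ _ _

theorem integral_indicator_stdGauss (x : Fin d → ℝ) {n : ℕ} (hn : n ≠ 0) {A : Set (Fin d → ℝ)}
    (hA : MeasurableSet A) :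
    ∫ w, A.indicator (fun _ => (1 : ℝ)) (x + √(n : ℝ) • w) ∂stdGauss d =
      ∫ y in A, ∏ i, gaussianPDFReal (x i) n (y i) := by
  have hmap : (stdGauss d).map (fun w => x + √(n : ℝ) • w) =
      Measure.pi (fun i => gaussianReal (x i) n) := by
    have h1 : ∀ i, (gaussianReal 0 1).map (fun w => x i + √(n : ℝ) * w) = gaussianReal (x i) n := by
      intro i
      have : (fun w => x i + √(n : ℝ) * w) = (fun w => x i + w) ∘ fun w => √(n : ℝ) * w := rfl
      rw [this, ← Measure.map_map (by fun_prop) (by fun_prop), gaussianReal_map_const_mul,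
        gaussianReal_map_const_add]
      congr 1
      · simp
      · ext
        simp
    have inst : ∀ i, SigmaFinite ((gaussianReal 0 1).map (fun w => x i + √(n : ℝ) * w)) := by
      intro i
      rw [h1]
      infer_instance
    have := Measure.pi_map_pi (μ := fun _ : Fin d => gaussianReal 0 1)
      (f := fun i w => x i + √(n : ℝ) * w) (fun i => by fun_prop)
    simp only [h1] at this
    exact this
  have hn' : (n : ℝ≥0) ≠ 0 := by exact_mod_cast hn
  have h2 := integral_map (μ := stdGauss d) (φ := fun w => x + √(n : ℝ) • w) (by fun_prop)
    (f := A.indicator (fun _ => (1 : ℝ))) (by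
      exact (measurable_const.indicator hA).aestronglyMeasurable)
  rw [← h2, hmap, integral_indicator_const _ hA, smul_eq_mul, mul_one, Measure.real,
    pi_gaussianReal_eq_withDensity x hn', withDensity_apply _ hA,
    ← integral_eq_lintegral_of_nonneg_ae]
  · exact Eventually.of_forall fun y => Finset.prod_nonneg fun i _ => gaussianPDFReal_nonneg _ _ _
  · refine Measurable.aestronglyMeasurable ?_
    exact Finset.measurable_prod _ fun i _ =>
      (measurable_gaussianPDFReal _ _).comp (measurable_pi_apply i)

end StandardGaussian

/-! ### Complex representation and Taylor expansion of the heat kernel -/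

section KernelExpansion

variable {d : ℕ}

theorem integrable_add_I_mul_pow (n : ℕ) (z c : ℝ) :
    Integrable (fun g : ℝ => ((z : ℂ) + Complex.I * c * g) ^ n) (gaussianReal 0 1) := by
  simp only [add_pow]
  refine integrable_finsetSum _ fun k _ => ?_
  refine Integrable.mul_const (Integrable.const_mul ?_ _) _
  simp only [mul_pow _ (_ : ℂ) (n - k)]
  refine Integrable.const_mul ?_ _
  simpa using (integrable_pow_gaussianReal (n - k)).ofReal (𝕜 := ℂ)

/-- Together with the Gaussian density the exponent is quadratic in g with leading coefficient
-n/(2(s+n)), negative because n > 0. Completing the square leaves exactly -(y-x)²/(2n), and the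
prefactor is √((s+n)/n). -/
theorem integral_cexp_gaussianReal (x y : ℝ) (s n : ℕ) (hn : n ≠ 0) :
    ∫ g : ℝ, Complex.exp (-(((x - y : ℝ) : ℂ) + Complex.I * (√(s : ℝ) : ℝ) * g) ^ 2 /
        (2 * ((s + n : ℕ) : ℂ))) ∂gaussianReal 0 1 =
      ((√(2 * Real.pi * (s + n : ℕ)) * gaussianPDFReal x n y : ℝ) : ℂ) := by
  have hn0 : (0 : ℝ) < n := by exact_mod_cast Nat.pos_of_ne_zero hn
  have hT0 : (0 : ℝ) < (s : ℝ) + n := by positivity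
  have hnC : (n : ℂ) ≠ 0 := by exact_mod_cast hn
  have hTC : (s : ℂ) + n ≠ 0 := by exact_mod_cast hT0.ne'
  have hs : ((√(s : ℝ) : ℝ) : ℂ) ^ 2 = s := by
    rw [← Complex.ofReal_pow, Real.sq_sqrt (Nat.cast_nonneg s)]
    simp
  set z : ℝ := x - y with hz
  rw [integral_gaussianReal_eq_integral_smul one_ne_zero]
  set b : ℂ := ((-(n / (2 * (s + n))) : ℝ) : ℂ) with hb
  have hre : b.re < 0 := by
    rw [hb, Complex.ofReal_re]
    exact neg_neg_of_pos (by positivity)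
  have h1 : ∀ g : ℝ, gaussianPDFReal 0 1 g • Complex.exp (-((z : ℂ) + Complex.I * (√(s : ℝ) : ℝ) * g) ^ 2 /
        (2 * ((s + n : ℕ) : ℂ))) = ((√(2 * Real.pi))⁻¹ : ℝ) * Complex.exp (b * g ^ 2 +
        (-Complex.I * (√(s : ℝ) : ℝ) * z / (s + n)) * g + -(z : ℂ) ^ 2 / (2 * (s + n))) := by
    intro g
    rw [gaussianPDFReal, Complex.real_smul]
    push_cast
    rw [mul_assoc, ← Complex.exp_add, hb]
    simp only [mul_one, sub_zero]
    congr 2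
    rw [add_sq, mul_pow, mul_pow, hs, Complex.I_sq]
    push_cast
    field_simp
    ring
  simp only [h1]
  rw [integral_const_mul, integral_cexp_quadratic hre]
  have h2 : -(z : ℂ) ^ 2 / (2 * (s + n)) - (-Complex.I * (√(s : ℝ) : ℝ) * z / (s + n)) ^ 2 / (4 * b) =
      ((-(y - x) ^ 2 / (2 * n) : ℝ) : ℂ) := by
    rw [hb, div_pow, mul_pow, mul_pow, hs, neg_sq, Complex.I_sq, hz]
    push_cast
    field_simp
    ring
  rw [h2, ← Complex.ofReal_exp, hb, ← Complex.ofReal_neg, ← Complex.ofReal_div,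
    show (1 / 2 : ℂ) = ((1 / 2 : ℝ) : ℂ) by simp, ← Complex.ofReal_cpow (by rw [neg_neg]; positivity),
    ← Real.sqrt_eq_rpow, gaussianPDFReal]
  rw [← Complex.ofReal_mul, ← Complex.ofReal_mul, Complex.ofReal_inj, ← mul_assoc, ← mul_assoc]
  push_cast
  congr 1
  rw [← Real.sqrt_inv, ← Real.sqrt_inv, ← Real.sqrt_mul (by positivity), ← Real.sqrt_mul (by positivity)]
  congr 1
  field_simp

/-- The exponent of the complex Gaussian representation of the heat kernel. -/
def kernelExponent (z : Fin d → ℝ) (s : ℝ) (T : ℝ) (g : Fin d → ℝ) : ℂ :=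
  ∑ i, -((z i : ℂ) + Complex.I * (√s : ℝ) * g i) ^ 2 / (2 * T)

/-- For real z and g, |z + i√s g|² = z² + s g². -/
theorem norm_kernelExponent_le (z : Fin d → ℝ) {s T : ℝ} (hs : 0 ≤ s) (hT : 0 < T) (g : Fin d → ℝ) :
    ‖kernelExponent z s T g‖ ≤ (∑ i, z i ^ 2 + s * ∑ i, g i ^ 2) / (2 * T) := by
  refine (norm_sum_le _ _).trans ?_
  rw [Finset.mul_sum, ← Finset.sum_add_distrib, Finset.sum_div]
  refine Finset.sum_le_sum fun i _ => ?_
  rw [norm_div, norm_neg, norm_pow, Complex.sq_norm, Complex.normSq_apply]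
  have : ‖(2 * T : ℂ)‖ = 2 * T := by
    rw [norm_mul, Complex.norm_real, Real.norm_of_nonneg hT.le]
    simp
  rw [this]
  refine le_of_eq ?_
  congr 1
  simp only [Complex.add_re, Complex.add_im, Complex.mul_re, Complex.mul_im, Complex.I_re,
    Complex.I_im, Complex.ofReal_re, Complex.ofReal_im]
  have := Real.mul_self_sqrt hs
  linear_combination (g i ^ 2) * this

theorem continuous_kernelExponent (z : Fin d → ℝ) (s T : ℝ) :
    Continuous (kernelExponent z s T) := by
  unfold kernelExponent
  fun_prop

theorem integral_cexp_kernelExponent (x y : Fin d → ℝ) (s n : ℕ) (hn : n ≠ 0) :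
    ∫ g, Complex.exp (kernelExponent (x - y) s (s + n : ℕ) g) ∂stdGauss d =
      ((∏ i, (√(2 * Real.pi * (s + n : ℕ)) * gaussianPDFReal (x i) n (y i)) : ℝ) : ℂ) := by
  simp only [kernelExponent, Complex.exp_sum, stdGauss]
  rw [integral_fintype_prod_eq_prod (f := fun i (g : ℝ) =>
    Complex.exp (-((((x - y) i : ℝ) : ℂ) + Complex.I * (√(s : ℝ) : ℝ) * g) ^ 2 /
      (2 * ((s + n : ℕ) : ℝ))))]
  rw [Complex.ofReal_prod]
  refine Finset.prod_congr rfl fun i _ => ?_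
  rw [← integral_cexp_gaussianReal _ _ _ _ hn]
  simp

/-- Multinomial theorem; its coefficient divided by k! leaves 1/α!. -/
theorem kernelExponent_pow (z : Fin d → ℝ) (s T : ℝ) (g : Fin d → ℝ) (k : ℕ) :
    kernelExponent z s T g ^ k / k.factorial = ∑ α ∈ Finset.piAntidiag (Finset.univ : Finset (Fin d)) k,
      (((((-T) ^ k)⁻¹ / 2 ^ k * (1 / ∏ i, ((α i).factorial : ℝ)) : ℝ) : ℂ) *
        ∏ i, ((z i : ℂ) + Complex.I * (√s : ℝ) * g i) ^ (2 • α) i) := by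
  have h1 : kernelExponent z s T g =
      (-(T : ℂ))⁻¹ / 2 * ∑ i, ((z i : ℂ) + Complex.I * (√s : ℝ) * g i) ^ 2 := by
    rw [kernelExponent, Finset.mul_sum]
    refine Finset.sum_congr rfl fun i _ => ?_
    rw [inv_neg]
    field_simp
  rw [h1, mul_pow, Finset.sum_pow_eq_sum_piAntidiag, Finset.mul_sum, Finset.sum_div]
  refine Finset.sum_congr rfl fun α hα => ?_
  have hsum : ∑ i, α i = k := by simpa using (Finset.mem_piAntidiag.1 hα).1
  have hk : (k.factorial : ℂ) ≠ 0 := by exact_mod_cast k.factorial_ne_zero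
  have hm := Nat.multinomial_spec Finset.univ α
  rw [hsum] at hm
  have hm' : (∏ i, ((α i).factorial : ℂ)) * (Nat.multinomial Finset.univ α : ℂ) = k.factorial := by
    exact_mod_cast hm
  have hp : (∏ i, ((α i).factorial : ℂ)) ≠ 0 :=
    Finset.prod_ne_zero_iff.2 fun i _ => by exact_mod_cast (α i).factorial_ne_zero
  simp only [Pi.smul_apply, smul_eq_mul, pow_mul]
  push_cast
  rw [← hm'] at hk ⊢
  have hmul : (Nat.multinomial Finset.univ α : ℂ) ≠ 0 := right_ne_zero_of_mul hk
  rw [div_pow, inv_pow]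
  field_simp

theorem integrable_prod_add_I_mul_pow (α : Fin d → ℕ) (z : Fin d → ℝ) (c : ℝ) :
    Integrable (fun g : Fin d → ℝ => ∏ i, ((z i : ℂ) + Complex.I * c * (g i : ℝ)) ^ α i)
      (stdGauss d) :=
  Integrable.fintype_prod (f := fun i (g : ℝ) => ((z i : ℂ) + Complex.I * c * (g : ℝ)) ^ α i)
    fun i => integrable_add_I_mul_pow (α i) (z i) c

theorem integrable_kernelExponent_pow (z : Fin d → ℝ) (s T : ℝ) (k : ℕ) :
    Integrable (fun g => kernelExponent z s T g ^ k / k.factorial) (stdGauss d) := by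
  simp only [kernelExponent_pow]
  exact integrable_finsetSum _ fun α _ => (integrable_prod_add_I_mul_pow _ _ _).const_mul _

/-- The Taylor polynomial of the normalized heat kernel in the inverse time. -/
def kernelTaylor (K : ℕ) (T : ℝ) (z : Fin d → ℝ) (s : ℝ) : ℝ :=
  ∑ n ∈ Finset.range (K + 1), ((-T) ^ n)⁻¹ / 2 ^ n *
    ∑ α ∈ Finset.piAntidiag (Finset.univ : Finset (Fin d)) n,
      (1 / ∏ i, ((α i).factorial : ℝ)) * hermiteMulti (2 • α) z s

theorem integral_sum_kernelExponent_pow (K : ℕ) (z : Fin d → ℝ) {s : ℝ} (hs : 0 ≤ s) (T : ℝ) :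
    ∫ g, ∑ k ∈ Finset.range (K + 1), kernelExponent z s T g ^ k / k.factorial ∂stdGauss d =
      kernelTaylor K T z s := by
  rw [integral_finsetSum _ fun k _ => integrable_kernelExponent_pow z s T k, kernelTaylor,
    Complex.ofReal_sum]
  refine Finset.sum_congr rfl fun k _ => ?_
  simp only [kernelExponent_pow]
  rw [integral_finsetSum _ fun α _ => (integrable_prod_add_I_mul_pow _ _ _).const_mul _,
    Finset.mul_sum, Complex.ofReal_sum]
  refine Finset.sum_congr rfl fun α _ => ?_
  rw [integral_const_mul, integral_prod_add_I_mul_pow, Real.sq_sqrt hs]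
  push_cast
  ring

/-- The allowance exp(q/4) is split in two halves: one absorbs (q/8)^N by the exponential series,
the other absorbs exp w, since w ≤ q/8. -/
theorem pow_mul_exp_le {ε q w : ℝ} (N : ℕ) (hw : 0 ≤ w) (hwq : w ≤ ε * q) (hq : 0 ≤ q) (hε : 0 ≤ ε)
    (hε' : ε ≤ 1 / 8) : w ^ N * Real.exp w ≤ 8 ^ N * N.factorial * ε ^ N * Real.exp (q / 4) := by
  have h1 : (q / 8) ^ N ≤ N.factorial * Real.exp (q / 8) := by
    have := Real.pow_div_factorial_le_exp (q / 8) (by positivity) N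
    rwa [div_le_iff₀' (by positivity)] at this
  have h2 : Real.exp w ≤ Real.exp (q / 8) := Real.exp_le_exp.2 (by nlinarith)
  calc w ^ N * Real.exp w ≤ (ε * q) ^ N * Real.exp (q / 8) := by gcongr
    _ = 8 ^ N * ε ^ N * (q / 8) ^ N * Real.exp (q / 8) := by
        rw [div_pow, mul_pow]
        field_simp
    _ ≤ 8 ^ N * ε ^ N * (N.factorial * Real.exp (q / 8)) * Real.exp (q / 8) := by gcongr
    _ = 8 ^ N * N.factorial * ε ^ N * (Real.exp (q / 8) * Real.exp (q / 8)) := by ring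
    _ = _ := by
        rw [← Real.exp_add]
        ring_nf

/-- The Taylor remainder of exp at w is at most |w|^(K+1) e^|w|. Here |w| ≤ (s/T) q, and the
condition 8s ≤ s + n makes s/T ≤ 1/8, so that exp(q/4) dominates. This majorant factors into a
function of x, a constant and an integrable function of g. -/
theorem exists_kernel_sub_taylor_le (d K : ℕ) (ρ : ℝ) : ∃ C : ℝ, 0 ≤ C ∧ ∀ s n : ℕ, 1 ≤ s →
    8 * s ≤ s + n → ∀ x y : Fin d → ℝ, ∑ i, y i ^ 2 ≤ ρ →
    |∏ i, (√(2 * Real.pi * (s + n : ℕ)) * gaussianPDFReal (x i) n (y i)) -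
        kernelTaylor K (s + n : ℕ) (x - y) s| ≤
      C * ((s : ℝ) / (s + n : ℕ)) ^ (K + 1) * Real.exp ((∑ i, x i ^ 2) / (4 * s)) := by
  refine ⟨8 ^ (K + 1) * (K + 1).factorial * Real.exp (ρ / 4) *
    ∫ g, Real.exp ((∑ i, g i ^ 2) / 4) ∂stdGauss d, ?_, ?_⟩
  · have : 0 ≤ ∫ g : Fin d → ℝ, Real.exp ((∑ i, g i ^ 2) / 4) ∂stdGauss d :=
      integral_nonneg fun g => (Real.exp_pos _).le
    positivity
  intro s n hs hsn x y hy
  have hn : n ≠ 0 := by omega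
  have hs0 : (0 : ℝ) < s := by exact_mod_cast hs
  have hT0 : (0 : ℝ) < (s + n : ℕ) := by exact_mod_cast (by omega : 0 < s + n)
  set T : ℝ := ((s + n : ℕ) : ℝ) with hT
  have hε : (s : ℝ) / T ≤ 1 / 8 := by
    rw [div_le_div_iff₀ hT0 (by norm_num)]
    have : ((8 * s : ℕ) : ℝ) ≤ ((s + n : ℕ) : ℝ) := by exact_mod_cast hsn
    push_cast at this ⊢
    rw [hT]
    push_cast
    linarith
  -- From |x-y|² ≤ 2|x|² + 2ρ, the exponent is at most (|x|² + ρ + s|g|²/2)/T. This q bounds it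
  -- after s/T is factored out, where ρ ≤ sρ because s ≥ 1.
  set q : (Fin d → ℝ) → ℝ := fun g => (∑ i, x i ^ 2) / s + ρ + ∑ i, g i ^ 2 with hq
  have hρ : 0 ≤ ρ := (Finset.sum_nonneg fun i _ => sq_nonneg (y i)).trans hy
  have hX : 0 ≤ ∑ i, x i ^ 2 := Finset.sum_nonneg fun i _ => sq_nonneg (x i)
  have hG : ∀ g : Fin d → ℝ, 0 ≤ ∑ i, g i ^ 2 := fun g => Finset.sum_nonneg fun i _ => sq_nonneg (g i)
  have hq0 : ∀ g, 0 ≤ q g := fun g => by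
    have := hG g
    positivity
  have hw : ∀ g, ‖kernelExponent (x - y) s T g‖ ≤ (s : ℝ) / T * q g := by
    intro g
    refine (norm_kernelExponent_le (x - y) hs0.le hT0 g).trans ?_
    have hz : ∑ i, (x - y) i ^ 2 ≤ 2 * ∑ i, x i ^ 2 + 2 * ∑ i, y i ^ 2 := by
      rw [Finset.mul_sum, Finset.mul_sum, ← Finset.sum_add_distrib]
      refine Finset.sum_le_sum fun i _ => ?_
      rw [Pi.sub_apply]
      nlinarith [sq_nonneg (x i + y i)]
    rw [div_mul_eq_mul_div, div_le_div_iff₀ (by positivity) hT0]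
    have h3 : (s : ℝ) * q g = ∑ i, x i ^ 2 + s * ρ + s * ∑ i, g i ^ 2 := by
      simp only [hq]
      field_simp
    have h4 : ρ ≤ s * ρ := le_mul_of_one_le_left hρ (by exact_mod_cast hs)
    have h5 : 0 ≤ s * ∑ i, g i ^ 2 := mul_nonneg hs0.le (hG g)
    rw [h3]
    nlinarith
  have hbound : ∀ N : ℕ, ∀ g,
      ‖kernelExponent (x - y) s T g‖ ^ N * Real.exp ‖kernelExponent (x - y) s T g‖ ≤
      8 ^ N * N.factorial * ((s : ℝ) / T) ^ N * Real.exp (q g / 4) := fun N g =>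
    pow_mul_exp_le N (norm_nonneg _) (hw g) (hq0 g) (by positivity) hε
  have hexpq : ∀ g, Real.exp (q g / 4) = Real.exp ((∑ i, x i ^ 2) / (4 * s)) * Real.exp (ρ / 4) *
      Real.exp ((∑ i, g i ^ 2) / 4) := by
    intro g
    rw [← Real.exp_add, ← Real.exp_add]
    congr 1
    simp only [hq]
    field_simp
  have hintq : Integrable (fun g => Real.exp (q g / 4)) (stdGauss d) := by
    simp only [hexpq]
    exact integrable_exp_sum_sq_div_four.const_mul _
  have hintexp : Integrable (fun g => Complex.exp (kernelExponent (x - y) s T g)) (stdGauss d) := by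
    refine hintq.mono' ?_ (Eventually.of_forall fun g => ?_)
    · exact (Complex.continuous_exp.comp (continuous_kernelExponent _ _ _)).aestronglyMeasurable
    -- The case N = 0 of the bound is already an integrable majorant of the exponential.
    · have := hbound 0 g
      simp only [pow_zero, Nat.factorial_zero, Nat.cast_one, one_mul] at this
      refine le_trans ?_ this
      rw [Complex.norm_exp]
      exact Real.exp_le_exp.2 (Complex.re_le_norm _)
  have hint2 : Integrable (fun g => ∑ k ∈ Finset.range (K + 1),
      kernelExponent (x - y) s T g ^ k / k.factorial) (stdGauss d) :=
    integrable_finsetSum _ fun k _ => integrable_kernelExponent_pow _ _ _ k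
  have hmain : ((∏ i, (√(2 * Real.pi * (s + n : ℕ)) * gaussianPDFReal (x i) n (y i)) -
        kernelTaylor K T (x - y) s : ℝ) : ℂ) =
      ∫ g, (Complex.exp (kernelExponent (x - y) s T g) - ∑ k ∈ Finset.range (K + 1),
        kernelExponent (x - y) s T g ^ k / k.factorial) ∂stdGauss d := by
    rw [integral_sub hintexp hint2, integral_sum_kernelExponent_pow K _ hs0.le,
      integral_cexp_kernelExponent x y s n hn, Complex.ofReal_sub]
  rw [← Real.norm_eq_abs, ← Complex.norm_real, hmain]
  calc _ ≤ ∫ g, 8 ^ (K + 1) * (K + 1).factorial * ((s : ℝ) / T) ^ (K + 1) * Real.exp (q g / 4)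
        ∂stdGauss d := norm_integral_le_of_norm_le (hintq.const_mul _) (Eventually.of_forall fun g =>
          (Complex.norm_exp_sub_sum_le_norm_mul_exp _ _).trans (hbound (K + 1) g))
    _ = _ := by
        simp only [hexpq]
        rw [integral_const_mul, integral_const_mul]
        ring

end KernelExpansion

/-! ### Expansion of the heat flow of an indicator -/

section HeatExpansion

variable {d : ℕ}

theorem integrableOn_of_continuous_of_isBounded {f : (Fin d → ℝ) → ℝ} (hf : Continuous f)
    {A : Set (Fin d → ℝ)} (hb : Bornology.IsBounded A) : IntegrableOn f A := by
  obtain ⟨R, hR⟩ := hb.subset_closedBall 0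
  exact (hf.continuousOn.integrableOn_compact (isCompact_closedBall 0 R)).mono_set hR

theorem setIntegral_hermiteMulti_sub (α : Fin d → ℕ) (x : Fin d → ℝ) (s : ℝ) {A : Set (Fin d → ℝ)}
    (hb : Bornology.IsBounded A) : ∫ y in A, hermiteMulti α (x - y) s =
      ∑ β ∈ Finset.Iic α, ((∏ i, ((α i).choose (β i) : ℝ)) * (-1) ^ (∑ i, β i) * moment β A *
        hermiteMulti (α - β) x s) := by
  simp only [hermiteMulti_sub_eq]
  rw [integral_finsetSum]
  · refine Finset.sum_congr rfl fun β _ => ?_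
    rw [integral_mul_const, integral_const_mul, moment]
  · intro β _
    refine ((integrableOn_of_continuous_of_isBounded ?_ hb).const_mul _).mul_const _
    fun_prop

theorem continuous_kernelTaylor_sub (K : ℕ) (T : ℝ) (x : Fin d → ℝ) (s : ℝ) :
    Continuous fun y => kernelTaylor K T (x - y) s := by
  unfold kernelTaylor
  refine continuous_finsetSum _ fun n _ => continuous_const.mul <| continuous_finsetSum _
    fun α _ => continuous_const.mul ?_
  exact (continuous_hermiteMulti (2 • α) s).comp (continuous_const.sub continuous_id)

/-- Expanding H_{2α}(x - y, s) binomially in y turns integration over A into the moments M_β(A). The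
outcome is linear in the family α ↦ H_α(x, s), which allows summation over particles later. -/
theorem setIntegral_kernelTaylor_sub (K : ℕ) (T : ℝ) (x : Fin d → ℝ) (s : ℝ) {A : Set (Fin d → ℝ)}
    (hb : Bornology.IsBounded A) : ∫ y in A, kernelTaylor K T (x - y) s =
      expansion (fun α => hermiteMulti α x s) A K T := by
  have hH : ∀ α : Fin d → ℕ, IntegrableOn (fun y => hermiteMulti α (x - y) s) A := fun α =>
    integrableOn_of_continuous_of_isBounded
      ((continuous_hermiteMulti α s).comp (continuous_const.sub continuous_id)) hb
  simp only [kernelTaylor, expansion]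
  rw [integral_finsetSum _ fun n _ => Integrable.const_mul (integrable_finsetSum _ fun α _ =>
    (hH (2 • α)).const_mul _) _]
  refine Finset.sum_congr rfl fun n _ => ?_
  rw [integral_const_mul, integral_finsetSum _ fun α _ => (hH (2 • α)).const_mul _]
  congr 1
  refine Finset.sum_congr rfl fun α _ => ?_
  rw [integral_const_mul, setIntegral_hermiteMulti_sub _ _ _ hb]
  rfl

theorem prod_sqrt_mul (a : ℝ) (ha : 0 ≤ a) (f : Fin d → ℝ) :
    ∏ i, (√a * f i) = a ^ ((d : ℝ) / 2) * ∏ i, f i := by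
  rw [Finset.prod_mul_distrib, Finset.prod_const, Finset.card_univ, Fintype.card_fin,
    Real.sqrt_eq_rpow, ← Real.rpow_natCast, ← Real.rpow_mul ha]
  congr 2
  ring

/-- `P^n 1_A(x)`: the probability that a Gaussian vector with mean `x` and covariance `n` times the
identity is in `A`. -/
def heatIndicator (A : Set (Fin d → ℝ)) (n : ℕ) (x : Fin d → ℝ) : ℝ :=
  ∫ w, A.indicator (fun _ => (1 : ℝ)) (x + √(n : ℝ) • w) ∂stdGauss d

theorem exists_heatIndicator_sub_expansion_le {A : Set (Fin d → ℝ)} (hA : MeasurableSet A)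
    (hb : Bornology.IsBounded A) (K : ℕ) : ∃ C : ℝ, 0 ≤ C ∧ ∀ s n : ℕ, 1 ≤ s → 8 * s ≤ s + n →
    ∀ x : Fin d → ℝ, |(2 * Real.pi * (s + n : ℕ)) ^ ((d : ℝ) / 2) * heatIndicator A n x -
        expansion (fun α => hermiteMulti α x s) A K (s + n : ℕ)| ≤
      C * ((s : ℝ) / (s + n : ℕ)) ^ (K + 1) * Real.exp ((∑ i, x i ^ 2) / (4 * s)) := by
  obtain ⟨R, hR⟩ := hb.subset_closedBall 0
  -- For y in A every coordinate is at most R in absolute value, hence |y|² ≤ d R².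
  obtain ⟨C, hC, hbound⟩ := exists_kernel_sub_taylor_le d K (d * R ^ 2)
  refine ⟨C * volume.real A, by positivity, fun s n hs hsn x => ?_⟩
  have hn : n ≠ 0 := by omega
  have hvol : volume A ≠ ⊤ := hb.measure_lt_top.ne
  have hint : IntegrableOn (fun y => ∏ i, (√(2 * Real.pi * (s + n : ℕ)) *
      gaussianPDFReal (x i) n (y i))) A := by
    refine integrableOn_of_continuous_of_isBounded ?_ hb
    refine continuous_finsetProd _ fun i _ => continuous_const.mul ?_
    simp only [gaussianPDFReal_def]
    fun_prop
  have h1 : (2 * Real.pi * (s + n : ℕ)) ^ ((d : ℝ) / 2) * heatIndicator A n x =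
      ∫ y in A, ∏ i, (√(2 * Real.pi * (s + n : ℕ)) * gaussianPDFReal (x i) n (y i)) := by
    rw [heatIndicator, integral_indicator_stdGauss x hn hA, ← integral_const_mul]
    congr 1 with y
    rw [prod_sqrt_mul _ (by positivity)]
  rw [h1, ← setIntegral_kernelTaylor_sub K _ x s hb, ← integral_sub hint
    (integrableOn_of_continuous_of_isBounded (continuous_kernelTaylor_sub K _ x s) hb),
    ← Real.norm_eq_abs]
  refine (norm_setIntegral_le_of_norm_le_const hvol.lt_top
    (C := C * ((s : ℝ) / (s + n : ℕ)) ^ (K + 1) * Real.exp ((∑ i, x i ^ 2) / (4 * s))) ?_).trans ?_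
  · intro y hy
    refine hbound s n hs hsn x y ?_
    calc ∑ i, y i ^ 2 ≤ ∑ _i : Fin d, R ^ 2 := by
          refine Finset.sum_le_sum fun i _ => ?_
          have h2 : ‖y‖ ≤ R := by simpa using hR hy
          exact sq_le_sq' (by linarith [neg_abs_le (y i), norm_le_pi_norm y i, Real.norm_eq_abs (y i)])
            ((le_abs_self _).trans ((norm_le_pi_norm y i).trans h2))
      _ = d * R ^ 2 := by simp
  · exact le_of_eq (by ring)

theorem measurable_heatIndicator {A : Set (Fin d → ℝ)} (hA : MeasurableSet A) (n : ℕ) :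
    Measurable (heatIndicator A n) := by
  unfold heatIndicator
  refine StronglyMeasurable.measurable ?_
  refine StronglyMeasurable.integral_prod_right (f := fun x w =>
    A.indicator (fun _ => (1 : ℝ)) (x + √(n : ℝ) • w)) ?_
  exact ((measurable_const.indicator hA).comp (by fun_prop)).stronglyMeasurable

theorem abs_heatIndicator_le (A : Set (Fin d → ℝ)) (n : ℕ) (x : Fin d → ℝ) :
    |heatIndicator A n x| ≤ 1 := by
  unfold heatIndicator
  rw [← Real.norm_eq_abs]
  refine (norm_integral_le_of_norm_le_const (C := 1) (Eventually.of_forall fun w => ?_)).trans (by simp)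
  by_cases h : x + √(n : ℝ) • w ∈ A <;> simp [h]

theorem heatIndicator_zero (A : Set (Fin d → ℝ)) (x : Fin d → ℝ) :
    heatIndicator A 0 x = A.indicator (fun _ => (1 : ℝ)) x := by
  simp [heatIndicator]

/-- The semigroup property: independent Gaussians of variances 1 and n add up to variance n + 1. -/
theorem integral_heatIndicator_add {A : Set (Fin d → ℝ)} (hA : MeasurableSet A) (n : ℕ)
    (x : Fin d → ℝ) : ∫ w, heatIndicator A n (x + w) ∂stdGauss d = heatIndicator A (n + 1) x := by
  have h := integral_stdGauss_add (d := d) (a := 1) (b := n) zero_le_one (Nat.cast_nonneg n)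
    (f := fun w => A.indicator (fun _ => (1 : ℝ)) (x + w))
    ((measurable_const.indicator hA).comp (by fun_prop)) (C := 1) (fun w => by
      by_cases h : x + w ∈ A <;> simp [h])
  simp only [Real.sqrt_one, one_smul] at h
  simp only [heatIndicator, add_assoc]
  rw [h, add_comm]
  norm_cast

end HeatExpansion

/-! ### Particle sums over the genealogical tree -/

section Tree

variable {Ω : Type*} {d : ℕ} {W : List ℕ → ℝ≥0 → Ω → (Fin d → ℝ)} {Y : List ℕ → Ω → ℕ}

/-- All the ancestors of `u` have had enough offspring for `u` to be born. -/
def IsAlive (Y : List ℕ → Ω → ℕ) (ω : Ω) : List ℕ → Prop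
  | [] => True
  | i :: u => i < Y u ω ∧ IsAlive Y ω u

/-- Turns membership in a random set into an event for each fixed label, determined by the offspring
numbers of its ancestors alone. -/
theorem mem_generation_iff {ω : Ω} {n : ℕ} {u : List ℕ} :
    u ∈ generation Y ω n ↔ u.length = n ∧ IsAlive Y ω u := by
  induction n generalizing u with
  | zero =>
    rw [generation, Finset.mem_singleton, List.length_eq_zero_iff]
    exact ⟨fun h => ⟨h, h ▸ trivial⟩, fun h => h.1⟩
  | succ n ih =>
    rw [generation, Finset.mem_biUnion]
    constructor
    · rintro ⟨v, hv, hu⟩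
      obtain ⟨i, hi, rfl⟩ := Finset.mem_image.1 hu
      obtain ⟨h1, h2⟩ := ih.1 hv
      exact ⟨by simp [h1], Finset.mem_range.1 hi, h2⟩
    · rintro ⟨hl, ha⟩
      cases u with
      | nil => simp at hl
      | cons i v =>
        exact ⟨v, ih.2 ⟨by simpa using hl, ha.2⟩,
          Finset.mem_image.2 ⟨i, Finset.mem_range.2 ha.1, rfl⟩⟩

/-- The tail of a label recovers the parent, so the families of distinct parents are disjoint. -/
theorem sum_generation_succ {M : Type*} [AddCommMonoid M] (ω : Ω) (n : ℕ) (φ : List ℕ → M) :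
    ∑ u ∈ generation Y ω (n + 1), φ u.tail = ∑ v ∈ generation Y ω n, Y v ω • φ v := by
  rw [generation, Finset.sum_biUnion]
  · refine Finset.sum_congr rfl fun v _ => ?_
    rw [Finset.sum_image (by intro a _ b _ h; exact (List.cons.inj h).1)]
    simp
  · intro v _ v' _ hne
    rw [Function.onFun, Finset.disjoint_left]
    intro w hw hw'
    obtain ⟨i, _, rfl⟩ := Finset.mem_image.1 hw
    obtain ⟨j, _, hj⟩ := Finset.mem_image.1 hw'
    exact hne (List.cons.inj hj).2.symm

/-- `∑ f` over the birth places of the particles of generation `t`. -/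
def sumAfter (W : List ℕ → ℝ≥0 → Ω → (Fin d → ℝ)) (Y : List ℕ → Ω → ℕ) (t : ℕ)
    (f : (Fin d → ℝ) → ℝ) (ω : Ω) : ℝ :=
  ∑ u ∈ generation Y ω t, f (birthPlace W ω u)

/-- `∑ f` over the places of death of the particles of generation `t`. -/
def sumBefore (W : List ℕ → ℝ≥0 → Ω → (Fin d → ℝ)) (Y : List ℕ → Ω → ℕ) (t : ℕ)
    (f : (Fin d → ℝ) → ℝ) (ω : Ω) : ℝ :=
  ∑ u ∈ generation Y ω t, f (deathPlace W ω u)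

theorem sum_birthPlace_succ {M : Type*} [AddCommMonoid M] (ω : Ω) (n : ℕ) (f : (Fin d → ℝ) → M) :
    ∑ u ∈ generation Y ω (n + 1), f (birthPlace W ω u) =
      ∑ v ∈ generation Y ω n, Y v ω • f (deathPlace W ω v) := by
  rw [← sum_generation_succ]
  refine Finset.sum_congr rfl fun u hu => ?_
  cases u with
  | nil => simp [mem_generation_iff] at hu
  | cons i v => rfl

/-- Group the particles by birth place: the multiplicity at a site is the size of its fibre. -/
theorem finsum_mul_occAfter (f : (Fin d → ℝ) → ℝ) (t : ℕ) (ω : Ω) :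
    ∑ᶠ y, f y * occAfter W Y t ω y = sumAfter W Y t f ω := by
  classical
  rw [finsum_eq_sum_of_support_subset (s := (generation Y ω t).image (birthPlace W ω)), sumAfter,
    ← Finset.sum_fiberwise_of_maps_to (g := birthPlace W ω)
      (fun u hu => Finset.mem_image_of_mem _ hu)]
  · refine Finset.sum_congr rfl fun y _ => ?_
    rw [Finset.sum_congr rfl (g := fun _ => f y) fun u hu => by rw [(Finset.mem_filter.1 hu).2]]
    rw [Finset.sum_const, nsmul_eq_mul, occAfter, mul_comm]
  · intro y hy
    rw [Function.mem_support] at hy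
    by_contra hne
    apply hy
    rw [occAfter, Finset.card_eq_zero.2, Nat.cast_zero, mul_zero]
    refine Finset.filter_eq_empty_iff.2 fun u hu h => hne ?_
    exact Finset.mem_coe.2 (Finset.mem_image.2 ⟨u, hu, h⟩)

theorem finsum_mul_occBefore_eq_sum_image [DecidableEq (Fin d → ℝ)] (f : (Fin d → ℝ) → ℝ) (t : ℕ)
    (ω : Ω) : ∑ᶠ y, f y * occBefore W Y (t + 1) ω y =
      ∑ y ∈ (generation Y ω t).image (deathPlace W ω), f y := by
  rw [finsum_eq_sum_of_support_subset (s := (generation Y ω t).image (deathPlace W ω))]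
  · refine Finset.sum_congr rfl fun y hy => ?_
    rw [occBefore, if_pos, mul_one]
    exact Finset.mem_image.1 hy
  · intro y hy
    rw [Function.mem_support] at hy
    by_contra hne
    apply hy
    rw [occBefore, if_neg, mul_zero]
    exact fun h => hne (Finset.mem_coe.2 (Finset.mem_image.2 h))

theorem finsum_mul_occBefore_of_injOn (f : (Fin d → ℝ) → ℝ) (t : ℕ) (ω : Ω)
    (hinj : Set.InjOn (deathPlace W ω) (generation Y ω t)) :
    ∑ᶠ y, f y * occBefore W Y (t + 1) ω y = sumBefore W Y t f ω := by
  classical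
  rw [finsum_mul_occBefore_eq_sum_image, Finset.sum_image hinj, sumBefore]

theorem particleCount_eq (occ : (Fin d → ℝ) → ℝ) (A : Set (Fin d → ℝ)) :
    particleCount occ A = ∑ᶠ y, A.indicator (fun _ => (1 : ℝ)) y * occ y := by
  rw [particleCount, finsum_mem_def]
  congr 1 with y
  by_cases h : y ∈ A <;> simp [h]

/-- Each occupied site shares its value equally among the particles on it. The sum over a random set
of sites becomes a sum over labels, whose terms are visibly measurable even where positions
coincide. -/
theorem sum_image_eq_sum_div_card [DecidableEq (Fin d → ℝ)] (F : Finset (List ℕ))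
    (D : List ℕ → (Fin d → ℝ)) (f : (Fin d → ℝ) → ℝ) :
    ∑ y ∈ F.image D, f y = ∑ u ∈ F, f (D u) / (∑ v ∈ F, if D v = D u then (1 : ℝ) else 0) := by
  rw [← Finset.sum_fiberwise_of_maps_to (g := D) (fun u hu => Finset.mem_image_of_mem _ hu)]
  refine Finset.sum_congr rfl fun y hy => ?_
  obtain ⟨u, hu, rfl⟩ := Finset.mem_image.1 hy
  have hcard : (0 : ℝ) < (F.filter fun v => D v = D u).card := by
    exact Nat.cast_pos.2 (Finset.card_pos.2 ⟨u, Finset.mem_filter.2 ⟨hu, rfl⟩⟩)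
  rw [Finset.sum_congr rfl (g := fun _ => f (D u) / (F.filter fun v => D v = D u).card) fun v hv => by
    rw [(Finset.mem_filter.1 hv).2, Finset.sum_boole]]
  rw [Finset.sum_const, nsmul_eq_mul]
  field_simp

end Tree

/-! ### Measurability with respect to a given σ-algebra -/

section Measurability

variable {Ω : Type*} {d : ℕ} {W : List ℕ → ℝ≥0 → Ω → (Fin d → ℝ)} {Y : List ℕ → Ω → ℕ}
  {𝒢 : MeasurableSpace Ω} {n : ℕ}

theorem measurable_birthPlace (hW : ∀ v, v.length < n → Measurable[𝒢] (W v 1)) {u : List ℕ}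
    (hu : u.length ≤ n) : Measurable[𝒢] fun ω => birthPlace W ω u := by
  induction u with
  | nil => exact measurable_const
  | cons i u ih =>
    have hu' : u.length < n := Nat.lt_of_succ_le hu
    exact (ih hu'.le).add (hW u hu')

theorem measurable_deathPlace (hW : ∀ v, v.length < n → Measurable[𝒢] (W v 1)) {u : List ℕ}
    (hu : u.length < n) : Measurable[𝒢] fun ω => deathPlace W ω u :=
  (measurable_birthPlace hW hu.le).add (hW u hu)

theorem measurableSet_isAlive (hY : ∀ v, v.length < n → Measurable[𝒢] (Y v)) {u : List ℕ}
    (hu : u.length ≤ n) : MeasurableSet[𝒢] {ω | IsAlive Y ω u} := by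
  induction u with
  | nil => simp [IsAlive]
  | cons i u ih =>
    have hu' : u.length < n := Nat.lt_of_succ_le hu
    exact (measurableSet_lt measurable_const (hY u hu')).inter (ih hu'.le)

theorem measurableSet_mem_generation (hY : ∀ v, v.length < n → Measurable[𝒢] (Y v)) (u : List ℕ) :
    MeasurableSet[𝒢] {ω | u ∈ generation Y ω n} := by
  by_cases hu : u.length = n
  · simpa only [mem_generation_iff, hu, true_and] using measurableSet_isAlive hY hu.le
  · simp [mem_generation_iff, hu]

theorem measurableSet_generation_eq (hY : ∀ v, v.length < n → Measurable[𝒢] (Y v))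
    (F : Finset (List ℕ)) : MeasurableSet[𝒢] {ω | generation Y ω n = F} := by
  have : {ω | generation Y ω n = F} =
      ⋂ u : List ℕ, {ω | u ∈ generation Y ω n ↔ u ∈ F} := by
    ext ω
    simp [Finset.ext_iff]
  rw [this]
  refine MeasurableSet.iInter fun u => ?_
  by_cases hu : u ∈ F
  · simpa [hu] using measurableSet_mem_generation hY u
  · simp only [hu, iff_false]
    exact (measurableSet_mem_generation hY u).compl

/-- A generation takes only countably many values, so it can be fixed on each piece of a countable
partition. -/
theorem measurable_generation_comp (hY : ∀ v, v.length < n → Measurable[𝒢] (Y v))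
    {g : Finset (List ℕ) → Ω → ℝ}
    (hg : ∀ F, (∀ u ∈ F, u.length = n) → Measurable[𝒢] (g F)) :
    Measurable[𝒢] fun ω => g (generation Y ω n) ω := by
  intro B hB
  have : (fun ω => g (generation Y ω n) ω) ⁻¹' B =
      ⋃ F : {F : Finset (List ℕ) // ∀ u ∈ F, u.length = n},
        {ω | generation Y ω n = F} ∩ (g F) ⁻¹' B := by
    ext ω
    simp only [Set.mem_preimage, Set.mem_iUnion, Set.mem_inter_iff, Set.mem_ofPred_eq]
    constructor
    · exact fun h => ⟨⟨generation Y ω n, fun u hu => (mem_generation_iff.1 hu).1⟩, rfl, h⟩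
    · rintro ⟨F, hF, h⟩
      rwa [hF]
  rw [this]
  exact MeasurableSet.iUnion fun F => (measurableSet_generation_eq hY F).inter (hg F F.2 hB)

theorem measurable_sumAfter (hW : ∀ v, v.length < n → Measurable[𝒢] (W v 1))
    (hY : ∀ v, v.length < n → Measurable[𝒢] (Y v)) {f : (Fin d → ℝ) → ℝ} (hf : Measurable f) :
    Measurable[𝒢] (sumAfter W Y n f) :=
  measurable_generation_comp hY (g := fun F ω => ∑ u ∈ F, f (birthPlace W ω u)) fun F hF =>
    Finset.measurable_sum F fun u hu => hf.comp (measurable_birthPlace hW (hF u hu).le)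

theorem measurable_sumBefore (hW : ∀ v, v.length < n + 1 → Measurable[𝒢] (W v 1))
    (hY : ∀ v, v.length < n → Measurable[𝒢] (Y v)) {f : (Fin d → ℝ) → ℝ} (hf : Measurable f) :
    Measurable[𝒢] (sumBefore W Y n f) :=
  measurable_generation_comp hY (g := fun F ω => ∑ u ∈ F, f (deathPlace W ω u)) fun F hF =>
    Finset.measurable_sum F fun u hu =>
      hf.comp (measurable_deathPlace hW (by rw [hF u hu]; exact n.lt_succ_self))

/-- Coincidences have probability zero, but the histories are not completed. Adaptedness must
therefore be shown at every ω, through the shared-value formula. -/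
theorem measurable_finsum_mul_occBefore (hW : ∀ v, v.length < n + 1 → Measurable[𝒢] (W v 1))
    (hY : ∀ v, v.length < n → Measurable[𝒢] (Y v)) {f : (Fin d → ℝ) → ℝ} (hf : Measurable f) :
    Measurable[𝒢] fun ω => ∑ᶠ y, f y * occBefore W Y (n + 1) ω y := by
  classical
  simp only [finsum_mul_occBefore_eq_sum_image, sum_image_eq_sum_div_card]
  refine measurable_generation_comp hY (g := fun F ω => ∑ u ∈ F, f (deathPlace W ω u) /
    (∑ v ∈ F, if deathPlace W ω v = deathPlace W ω u then (1 : ℝ) else 0)) fun F hF => ?_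
  have hD : ∀ u ∈ F, Measurable[𝒢] fun ω => deathPlace W ω u := fun u hu =>
    measurable_deathPlace hW (by rw [hF u hu]; exact n.lt_succ_self)
  refine Finset.measurable_sum F fun u hu => (hf.comp (hD u hu)).div ?_
  refine Finset.measurable_sum F fun v hv => ?_
  exact Measurable.ite (measurableSet_eq_fun (hD v hv) (hD u hu)) measurable_const measurable_const

theorem measurable_history_displacement {a b : ℕ} {v : List ℕ} (hv : v.length < a) :
    Measurable[history W Y a b] (W v 1) := by
  refine measurable_iff_comap_le.2 (le_trans ?_ le_sup_left)
  exact le_iSup_of_le v (le_iSup_of_le hv (le_iSup_of_le 1 (le_iSup_of_le le_rfl le_rfl)))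

theorem measurable_history_offspring {a b : ℕ} {v : List ℕ} (hv : v.length < b) :
    Measurable[history W Y a b] (Y v) := by
  refine measurable_iff_comap_le.2 (le_trans ?_ le_sup_right)
  exact le_iSup_of_le v (le_iSup_of_le hv le_rfl)

end Measurability

/-! ### Freezing one independent variable -/

section Freezing

variable {Ω α β : Type*} {𝒢 mΩ : MeasurableSpace Ω} {P : Measure Ω} [IsProbabilityMeasure P]
  [MeasurableSpace α] [MeasurableSpace β] {Z : Ω → α} {V : Ω → β}

theorem map_prodMk_of_indep (h𝒢 : 𝒢 ≤ mΩ) (hZ : Measurable[𝒢] Z) (hV : Measurable V)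
    (hind : Indep 𝒢 (MeasurableSpace.comap V inferInstance) P) :
    P.map (fun ω => (Z ω, V ω)) = (P.map Z).prod (P.map V) := by
  refine (indepFun_iff_map_prod_eq_prod_map_map (hZ.mono h𝒢 le_rfl).aemeasurable
    hV.aemeasurable).1 ?_
  exact indep_of_indep_of_le_left hind hZ.comap_le

/-- The joint law of Z and V is a product, so Tonelli integrates V out with Z held fixed. -/
theorem lintegral_of_indep (h𝒢 : 𝒢 ≤ mΩ) (hZ : Measurable[𝒢] Z) (hV : Measurable V)
    (hind : Indep 𝒢 (MeasurableSpace.comap V inferInstance) P) {F : α → β → ENNReal}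
    (hF : Measurable (Function.uncurry F)) :
    ∫⁻ ω, F (Z ω) (V ω) ∂P = ∫⁻ ω, ∫⁻ v, F (Z ω) v ∂(P.map V) ∂P := by
  have hZ' : Measurable Z := hZ.mono h𝒢 le_rfl
  have : IsProbabilityMeasure (P.map V) := Measure.isProbabilityMeasure_map hV.aemeasurable
  have h1 := lintegral_map (μ := P) hF (hZ'.prodMk hV)
  simp only [Function.uncurry_apply_pair] at h1
  rw [← h1, map_prodMk_of_indep h𝒢 hZ hV hind, lintegral_prod _ hF.aemeasurable,
    lintegral_map (by exact hF.lintegral_prod_right') hZ']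
  rfl

theorem integral_of_indep (h𝒢 : 𝒢 ≤ mΩ) (hZ : Measurable[𝒢] Z) (hV : Measurable V)
    (hind : Indep 𝒢 (MeasurableSpace.comap V inferInstance) P) {F : α → β → ℝ}
    (hF : Measurable (Function.uncurry F)) (hint : Integrable (fun ω => F (Z ω) (V ω)) P) :
    ∫ ω, F (Z ω) (V ω) ∂P = ∫ ω, ∫ v, F (Z ω) v ∂(P.map V) ∂P := by
  have hZ' : Measurable Z := hZ.mono h𝒢 le_rfl
  have : IsProbabilityMeasure (P.map V) := Measure.isProbabilityMeasure_map hV.aemeasurable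
  have : IsProbabilityMeasure (P.map Z) := Measure.isProbabilityMeasure_map hZ'.aemeasurable
  have h1 := integral_map (μ := P) (hZ'.prodMk hV).aemeasurable hF.aestronglyMeasurable
  simp only [Function.uncurry_apply_pair] at h1
  have h2 : Integrable (Function.uncurry F) ((P.map Z).prod (P.map V)) := by
    rw [← map_prodMk_of_indep h𝒢 hZ hV hind]
    exact (integrable_map_measure hF.aestronglyMeasurable (hZ'.prodMk hV).aemeasurable).2 hint
  rw [← h1, map_prodMk_of_indep h𝒢 hZ hV hind, integral_prod _ h2, integral_map hZ'.aemeasurable]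
  · rfl
  · exact hF.stronglyMeasurable.integral_prod_right'.aestronglyMeasurable

/-- Variance is at most the second moment; when g is not square integrable the right side is
infinite. Hence no integrability is required of g. -/
theorem lintegral_enorm_sub_integral_sq_le {μ : Measure β} [IsProbabilityMeasure μ] {g : β → ℝ}
    (hg : Measurable g) : ∫⁻ x, ‖g x - ∫ y, g y ∂μ‖ₑ ^ 2 ∂μ ≤ ∫⁻ x, ‖g x‖ₑ ^ 2 ∂μ := by
  by_cases hL : MemLp g 2 μ
  · have h1 : ∫⁻ x, ‖g x - ∫ y, g y ∂μ‖ₑ ^ 2 ∂μ = evariance g μ := rfl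
    have h2 : ∫⁻ x, ‖g x‖ₑ ^ 2 ∂μ = ENNReal.ofReal (∫ x, g x ^ 2 ∂μ) := by
      rw [ofReal_integral_eq_lintegral_ofReal hL.integrable_sq
        (Eventually.of_forall fun x => sq_nonneg _)]
      refine lintegral_congr fun x => ?_
      rw [← enorm_pow, Real.enorm_of_nonneg (sq_nonneg _)]
    rw [h1, h2, ← hL.ofReal_variance_eq]
    refine ENNReal.ofReal_le_ofReal ?_
    have := variance_le_expectation_sq (X := g) (μ := μ) hg.aestronglyMeasurable
    simpa using this
  · have : ∫⁻ x, ‖g x‖ₑ ^ 2 ∂μ = ⊤ := by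
      by_contra hne
      apply hL
      rw [memLp_two_iff_integrable_sq hg.aestronglyMeasurable]
      refine ⟨(hg.pow_const 2).aestronglyMeasurable, ?_⟩
      rw [HasFiniteIntegral]
      simpa [enorm_pow] using lt_top_iff_ne_top.2 hne
    rw [this]
    exact le_top

end Freezing

/-! ### Independence of the sources and the one-particle laws -/

section Model

variable {Ω : Type*} {mΩ : MeasurableSpace Ω} {P : Measure Ω} {d : ℕ}
  {W : List ℕ → ℝ≥0 → Ω → (Fin d → ℝ)} {Y : List ℕ → Ω → ℕ} {p : ℕ → ℝ} {m : ℝ}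

/-- The σ-algebras generated by the single sources of randomness of the model. -/
abbrev sourceSigma (W : List ℕ → ℝ≥0 → Ω → (Fin d → ℝ)) (Y : List ℕ → Ω → ℕ) :
    List ℕ ⊕ List ℕ → MeasurableSpace Ω :=
  Sum.elim
    (fun u : List ℕ => ⨆ s : ℝ≥0, MeasurableSpace.comap (W u s) inferInstance)
    (fun u : List ℕ => MeasurableSpace.comap (Y u) inferInstance)

/-- The information of all the sources other than `i`. -/
abbrev othersSigma (W : List ℕ → ℝ≥0 → Ω → (Fin d → ℝ)) (Y : List ℕ → Ω → ℕ)
    (i : List ℕ ⊕ List ℕ) : MeasurableSpace Ω :=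
  ⨆ j ∈ ({i}ᶜ : Set (List ℕ ⊕ List ℕ)), sourceSigma W Y j

theorem IsModel.nonneg (h : IsModel P W Y p) (l : ℕ) : 0 ≤ p l := by
  rw [← h.offspring_law [] l]
  exact measureReal_nonneg

theorem IsModel.sourceSigma_le (h : IsModel P W Y p) (i : List ℕ ⊕ List ℕ) :
    sourceSigma W Y i ≤ mΩ := by
  rcases i with u | u
  · exact iSup_le fun s => ((h.wiener u).measurable s).comap_le
  · exact (h.measurable_offspring u).comap_le

theorem IsModel.othersSigma_le (h : IsModel P W Y p) (i : List ℕ ⊕ List ℕ) :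
    othersSigma W Y i ≤ mΩ :=
  iSup_le fun j => iSup_le fun _ => h.sourceSigma_le j

theorem IsModel.indep_othersSigma (h : IsModel P W Y p) (i : List ℕ ⊕ List ℕ) :
    Indep (othersSigma W Y i) (sourceSigma W Y i) P := by
  have := indep_iSup_of_disjoint (m := sourceSigma W Y) h.sourceSigma_le h.indep
    (S := {i}ᶜ) (T := {i}) (by simp)
  simpa [othersSigma] using this

theorem sourceSigma_le_othersSigma {i j : List ℕ ⊕ List ℕ} (hij : j ≠ i) :
    sourceSigma W Y j ≤ othersSigma W Y i :=
  le_iSup₂_of_le (f := fun j (_ : j ∈ ({i}ᶜ : Set (List ℕ ⊕ List ℕ))) => sourceSigma W Y j) j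
    (by simpa using hij) le_rfl

theorem measurable_displacement_othersSigma {i : List ℕ ⊕ List ℕ} {v : List ℕ}
    (hv : Sum.inl v ≠ i) : Measurable[othersSigma W Y i] (W v 1) := by
  refine measurable_iff_comap_le.2 (le_trans ?_ (sourceSigma_le_othersSigma hv))
  exact le_iSup (fun s => MeasurableSpace.comap (W v s) inferInstance) 1

theorem measurable_offspring_othersSigma {i : List ℕ ⊕ List ℕ} {v : List ℕ}
    (hv : Sum.inr v ≠ i) : Measurable[othersSigma W Y i] (Y v) :=
  measurable_iff_comap_le.2 (sourceSigma_le_othersSigma (j := Sum.inr v) hv)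

/-- Paths of generations below a ≤ |u| do not include that of u, and offspring numbers are separate
sources. Hence b is arbitrary here; for the offspring number of u it is a that is arbitrary. -/
theorem history_le_othersSigma_inl {a b : ℕ} {u : List ℕ} (hu : a ≤ u.length) :
    history W Y a b ≤ othersSigma W Y (Sum.inl u) := by
  refine sup_le ?_ ?_
  · refine iSup_le fun v => iSup_le fun hv => iSup_le fun s => iSup_le fun _ => ?_
    refine le_trans ?_ (sourceSigma_le_othersSigma (j := Sum.inl v) ?_)
    · exact le_iSup (fun s => MeasurableSpace.comap (W v s) inferInstance) s
    · rintro h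
      rw [Sum.inl.inj h] at hv
      omega
  · exact iSup_le fun v => iSup_le fun _ => sourceSigma_le_othersSigma (j := Sum.inr v) (by simp)

theorem history_le_othersSigma_inr {a b : ℕ} {u : List ℕ} (hu : b ≤ u.length) :
    history W Y a b ≤ othersSigma W Y (Sum.inr u) := by
  refine sup_le ?_ ?_
  · refine iSup_le fun v => iSup_le fun hv => iSup_le fun s => iSup_le fun _ => ?_
    refine le_trans ?_ (sourceSigma_le_othersSigma (j := Sum.inl v) (by simp))
    exact le_iSup (fun s => MeasurableSpace.comap (W v s) inferInstance) s
  · refine iSup_le fun v => iSup_le fun hv => sourceSigma_le_othersSigma (j := Sum.inr v) ?_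
    rintro h
    rw [Sum.inr.inj h] at hv
    omega

theorem IsModel.indep_displacement (h : IsModel P W Y p) (u : List ℕ) :
    Indep (othersSigma W Y (Sum.inl u)) (MeasurableSpace.comap (W u 1) inferInstance) P :=
  indep_of_indep_of_le_right (h.indep_othersSigma (Sum.inl u))
    (le_iSup (fun s => MeasurableSpace.comap (W u s) inferInstance) 1)

theorem IsModel.indep_offspring (h : IsModel P W Y p) (u : List ℕ) :
    Indep (othersSigma W Y (Sum.inr u)) (MeasurableSpace.comap (Y u) inferInstance) P :=
  h.indep_othersSigma (Sum.inr u)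

variable [IsProbabilityMeasure P]

/-- Independent coordinates, each the value of a Brownian motion at time 1. -/
theorem IsModel.map_displacement (h : IsModel P W Y p) (u : List ℕ) :
    P.map (W u 1) = stdGauss d := by
  have hmeas : ∀ i, Measurable fun ω => W u 1 ω i := fun i =>
    (measurable_pi_apply i).comp ((h.wiener u).measurable 1)
  have hind : iIndepFun (fun (i : Fin d) ω => W u 1 ω i) P := by
    rw [iIndepFun_iff_iIndep]
    exact iIndep_of_iIndep_of_le (h.wiener u).indep fun i =>
      le_iSup (fun s : ℝ≥0 => MeasurableSpace.comap (fun ω => W u s ω i) inferInstance) 1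
  have hmap := (iIndepFun_iff_map_fun_eq_pi_map fun i => (hmeas i).aemeasurable).1 hind
  have hlaw : ∀ i, P.map (fun ω => W u 1 ω i) = gaussianReal 0 1 := fun i =>
    (((h.wiener u).brownian i).toIsPreBrownianReal.hasLaw_eval 1).map_eq
  simp only [hlaw] at hmap
  exact hmap

theorem IsModel.map_offspring_singleton (h : IsModel P W Y p) (u : List ℕ) (l : ℕ) :
    P.map (Y u) {l} = ENNReal.ofReal (p l) := by
  rw [Measure.map_apply (h.measurable_offspring u) (measurableSet_singleton l),
    ← h.offspring_law u l, ofReal_measureReal]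
  rfl

theorem IsModel.lintegral_offspring (h : IsModel P W Y p)
    (hm : HasSum (fun l : ℕ => (l : ℝ) * p l) m) (u : List ℕ) :
    ∫⁻ l, (l : ENNReal) ∂(P.map (Y u)) = ENNReal.ofReal m := by
  rw [lintegral_countable', ← hm.tsum_eq, ENNReal.ofReal_tsum_of_nonneg
    (fun l => mul_nonneg (Nat.cast_nonneg l) (h.nonneg l)) hm.summable]
  refine tsum_congr fun l => ?_
  rw [h.map_offspring_singleton, ENNReal.ofReal_mul (Nat.cast_nonneg l), ENNReal.ofReal_natCast]

theorem IsModel.integrable_offspring (h : IsModel P W Y p)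
    (hm : HasSum (fun l : ℕ => (l : ℝ) * p l) m) (u : List ℕ) :
    Integrable (fun l : ℕ => (l : ℝ)) (P.map (Y u)) := by
  refine ⟨measurable_from_top.aestronglyMeasurable, ?_⟩
  rw [HasFiniteIntegral]
  simp only [Real.enorm_natCast]
  rw [h.lintegral_offspring hm u]
  exact ENNReal.ofReal_lt_top

theorem IsModel.integral_offspring_sub (h : IsModel P W Y p)
    (hm : HasSum (fun l : ℕ => (l : ℝ) * p l) m) (u : List ℕ) :
    ∫ l, ((l : ℝ) - m) ∂(P.map (Y u)) = 0 := by
  have : IsProbabilityMeasure (P.map (Y u)) :=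
    Measure.isProbabilityMeasure_map (h.measurable_offspring u).aemeasurable
  have hm0 : 0 ≤ m := hm.nonneg fun l => mul_nonneg (Nat.cast_nonneg l) (h.nonneg l)
  rw [integral_sub (h.integrable_offspring hm u) (integrable_const _),
    integral_eq_lintegral_of_nonneg_ae (Eventually.of_forall fun l => Nat.cast_nonneg l)
      measurable_from_top.aestronglyMeasurable]
  simp only [ENNReal.ofReal_natCast]
  rw [h.lintegral_offspring hm u, ENNReal.toReal_ofReal hm0]
  simp

theorem IsModel.lintegral_offspring_sub_sq (h : IsModel P W Y p)
    (hvar : Summable (fun l : ℕ => ((l : ℝ) - m) ^ 2 * p l)) (u : List ℕ) :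
    ∫⁻ l, ‖(l : ℝ) - m‖ₑ ^ 2 ∂(P.map (Y u)) =
      ENNReal.ofReal (∑' l : ℕ, ((l : ℝ) - m) ^ 2 * p l) := by
  rw [lintegral_countable', ENNReal.ofReal_tsum_of_nonneg
    (fun l => mul_nonneg (sq_nonneg _) (h.nonneg l)) hvar]
  refine tsum_congr fun l => ?_
  rw [h.map_offspring_singleton, ENNReal.ofReal_mul (sq_nonneg _), ← enorm_pow,
    Real.enorm_of_nonneg (sq_nonneg _)]

end Model

/-! ### Sums over a random finite index set -/

section RandomFiniteSums

variable {Ω ι : Type*} {mΩ : MeasurableSpace Ω} {μ : Measure Ω} {gen : Ω → Finset ι}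

theorem lintegral_enorm_sq_sum_of_orthogonal (s : Finset ι) {η : ι → Ω → ℝ}
    (hη : ∀ u ∈ s, MemLp (η u) 2 μ)
    (horth : ∀ u ∈ s, ∀ v ∈ s, u ≠ v → ∫ ω, η u ω * η v ω ∂μ = 0) :
    ∫⁻ ω, ‖∑ u ∈ s, η u ω‖ₑ ^ 2 ∂μ = ∑ u ∈ s, ∫⁻ ω, ‖η u ω‖ₑ ^ 2 ∂μ := by
  have key : ∀ f : Ω → ℝ, MemLp f 2 μ → ∫⁻ ω, ‖f ω‖ₑ ^ 2 ∂μ = ENNReal.ofReal (∫ ω, f ω ^ 2 ∂μ) := by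
    intro f hf
    rw [ofReal_integral_eq_lintegral_ofReal hf.integrable_sq
      (Eventually.of_forall fun x => sq_nonneg _)]
    refine lintegral_congr fun x => ?_
    rw [← enorm_pow, Real.enorm_of_nonneg (sq_nonneg _)]
  rw [key _ (memLp_finsetSum s hη), Finset.sum_congr rfl fun u hu => key _ (hη u hu),
    ← ENNReal.ofReal_sum_of_nonneg fun u _ => integral_nonneg fun ω => sq_nonneg _]
  congr 1
  simp only [sq, Finset.sum_mul_sum]
  have hprod : ∀ u ∈ s, ∀ v ∈ s, Integrable (fun ω => η u ω * η v ω) μ :=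
    fun u hu v hv => (hη u hu).integrable_mul (hη v hv)
  rw [integral_finsetSum s fun u hu => integrable_finsetSum s fun v hv => hprod u hu v hv]
  refine Finset.sum_congr rfl fun u hu => ?_
  rw [integral_finsetSum s fun v hv => hprod u hu v hv]
  refine Finset.sum_eq_single_of_mem u hu fun v hv hne => horth u hu v hv hne.symm

variable [Countable ι]

theorem lintegral_sum_random (hgen : ∀ u, MeasurableSet {ω | u ∈ gen ω}) {g : ι → Ω → ENNReal}
    (hg : ∀ u, Measurable (g u)) : ∫⁻ ω, ∑ u ∈ gen ω, g u ω ∂μ =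
      ∑' u, ∫⁻ ω, {ω | u ∈ gen ω}.indicator (g u) ω ∂μ := by
  rw [← lintegral_tsum fun u => ((hg u).indicator (hgen u)).aemeasurable]
  refine lintegral_congr fun ω => ?_
  rw [tsum_eq_sum (s := gen ω)]
  · refine Finset.sum_congr rfl fun u hu => ?_
    rw [Set.indicator_of_mem (by exact hu)]
  · intro u hu
    rw [Set.indicator_of_notMem (by exact hu)]

/-- One deterministic exhaustion of the countable label set works for every ω: the partial sums
become constant once they contain the finite random set. -/
theorem exists_tendsto_sum_indicator : ∃ F : ℕ → Finset ι, ∀ (ω : Ω) (ξ : ι → Ω → ℝ),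
    ∀ᶠ n in atTop, ∑ u ∈ F n, {ω | u ∈ gen ω}.indicator (ξ u) ω = ∑ u ∈ gen ω, ξ u ω := by
  classical
  obtain ⟨F, hF⟩ := exists_seq_tendsto (atTop : Filter (Finset ι))
  refine ⟨F, fun ω ξ => ?_⟩
  filter_upwards [hF.eventually_ge_atTop (gen ω)] with n hn
  rw [← Finset.sum_subset hn]
  · refine Finset.sum_congr rfl fun u hu => ?_
    rw [Set.indicator_of_mem (by exact hu)]
  · intro u _ hu
    rw [Set.indicator_of_notMem (by exact hu)]

/-- Pythagoras on finite sets of labels, then Fatou along an exhaustion. If the right side is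
infinite nothing is to be shown; otherwise every term is in L², so orthogonality is required only of
such terms. -/
theorem lintegral_enorm_sq_sum_random_le (hgen : ∀ u, MeasurableSet {ω | u ∈ gen ω})
    {ξ : ι → Ω → ℝ} (hξ : ∀ u, Measurable (ξ u))
    (horth : ∀ u v, u ≠ v → MemLp ({ω | u ∈ gen ω}.indicator (ξ u)) 2 μ →
      MemLp ({ω | v ∈ gen ω}.indicator (ξ v)) 2 μ →
      ∫ ω, {ω | u ∈ gen ω}.indicator (ξ u) ω * {ω | v ∈ gen ω}.indicator (ξ v) ω ∂μ = 0) :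
    ∫⁻ ω, ‖∑ u ∈ gen ω, ξ u ω‖ₑ ^ 2 ∂μ ≤
      ∑' u, ∫⁻ ω, {ω | u ∈ gen ω}.indicator (fun ω => ‖ξ u ω‖ₑ ^ 2) ω ∂μ := by
  set η : ι → Ω → ℝ := fun u => {ω | u ∈ gen ω}.indicator (ξ u) with hη
  have hηm : ∀ u, Measurable (η u) := fun u => (hξ u).indicator (hgen u)
  have hsq : ∀ u ω, {ω | u ∈ gen ω}.indicator (fun ω => ‖ξ u ω‖ₑ ^ 2) ω = ‖η u ω‖ₑ ^ 2 := by
    intro u ω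
    by_cases hu : ω ∈ {ω | u ∈ gen ω}
    · simp [hη, Set.indicator_of_mem hu]
    · simp [hη, Set.indicator_of_notMem hu]
  simp only [hsq]
  by_cases htop : ∑' u, ∫⁻ ω, ‖η u ω‖ₑ ^ 2 ∂μ = ⊤
  · rw [htop]
    exact le_top
  have hL : ∀ u, MemLp (η u) 2 μ := by
    intro u
    rw [memLp_two_iff_integrable_sq (hηm u).aestronglyMeasurable]
    refine ⟨((hηm u).pow_const 2).aestronglyMeasurable, ?_⟩
    rw [HasFiniteIntegral]
    simpa [enorm_pow] using lt_top_iff_ne_top.2 (ENNReal.ne_top_of_tsum_ne_top htop u)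
  obtain ⟨F, hF⟩ := exists_tendsto_sum_indicator (gen := gen)
  calc ∫⁻ ω, ‖∑ u ∈ gen ω, ξ u ω‖ₑ ^ 2 ∂μ
      = ∫⁻ ω, liminf (fun n => ‖∑ u ∈ F n, η u ω‖ₑ ^ 2) atTop ∂μ := by
        refine lintegral_congr fun ω => ?_
        symm
        refine Tendsto.liminf_eq (tendsto_const_nhds.congr' ?_)
        filter_upwards [hF ω ξ] with n hn
        rw [← hn]
    _ ≤ liminf (fun n => ∫⁻ ω, ‖∑ u ∈ F n, η u ω‖ₑ ^ 2 ∂μ) atTop :=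
        lintegral_liminf_le fun n => by fun_prop
    _ ≤ ∑' u, ∫⁻ ω, ‖η u ω‖ₑ ^ 2 ∂μ := by
        refine liminf_le_of_frequently_le' (Frequently.of_forall fun n => ?_)
        rw [lintegral_enorm_sq_sum_of_orthogonal (F n) (fun u _ => hL u)
          fun u _ v _ hne => horth u v hne (hL u) (hL v)]
        exact ENNReal.sum_le_tsum (F n)

theorem integral_sum_random_eq_zero (hgen : ∀ u, MeasurableSet {ω | u ∈ gen ω})
    {ξ : ι → Ω → ℝ} (hξ : ∀ u, Measurable (ξ u))
    (hfin : ∑' u, ∫⁻ ω, {ω | u ∈ gen ω}.indicator (fun ω => ‖ξ u ω‖ₑ) ω ∂μ ≠ ⊤)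
    (hzero : ∀ u, Integrable ({ω | u ∈ gen ω}.indicator (ξ u)) μ →
      ∫ ω, {ω | u ∈ gen ω}.indicator (ξ u) ω ∂μ = 0) :
    ∫ ω, ∑ u ∈ gen ω, ξ u ω ∂μ = 0 := by
  set η : ι → Ω → ℝ := fun u => {ω | u ∈ gen ω}.indicator (ξ u) with hη
  have hηm : ∀ u, Measurable (η u) := fun u => (hξ u).indicator (hgen u)
  have hn : ∀ u ω, {ω | u ∈ gen ω}.indicator (fun ω => ‖ξ u ω‖ₑ) ω = ‖η u ω‖ₑ := by
    intro u ω
    by_cases hu : ω ∈ {ω | u ∈ gen ω}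
    · simp [hη, Set.indicator_of_mem hu]
    · simp [hη, Set.indicator_of_notMem hu]
  simp only [hn] at hfin
  have hint : ∀ u, Integrable (η u) μ := fun u =>
    ⟨(hηm u).aestronglyMeasurable, lt_top_iff_ne_top.2 (ENNReal.ne_top_of_tsum_ne_top hfin u)⟩
  have h1 := integral_tsum (μ := μ) (f := η) (fun u => (hηm u).aestronglyMeasurable) hfin
  rw [show (∫ ω, ∑ u ∈ gen ω, ξ u ω ∂μ) = ∫ ω, ∑' u, η u ω ∂μ from ?_, h1]
  · exact (tsum_congr fun u => hzero u (hint u)).trans tsum_zero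
  · congr 1 with ω
    rw [tsum_eq_sum (s := gen ω)]
    · refine Finset.sum_congr rfl fun u hu => ?_
      exact (Set.indicator_of_mem (s := {ω | u ∈ gen ω}) hu _).symm
    · intro u hu
      exact Set.indicator_of_notMem (s := {ω | u ∈ gen ω}) hu _

end RandomFiniteSums

/-! ### The many-to-one formula -/

section ManyToOne

variable {Ω : Type*} {mΩ : MeasurableSpace Ω} {P : Measure Ω} {d : ℕ}
  {W : List ℕ → ℝ≥0 → Ω → (Fin d → ℝ)} {Y : List ℕ → Ω → ℕ} {p : ℕ → ℝ} {m : ℝ}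

theorem IsModel.measurableSet_mem (h : IsModel P W Y p) (t : ℕ) (u : List ℕ) :
    MeasurableSet {ω | u ∈ generation Y ω t} :=
  measurableSet_mem_generation (fun v _ => h.measurable_offspring v) u

theorem IsModel.measurable_birthPlace (h : IsModel P W Y p) (u : List ℕ) :
    Measurable fun ω => birthPlace W ω u :=
  BranchingWiener.measurable_birthPlace (fun v _ => (h.wiener v).measurable 1) le_rfl

theorem IsModel.measurable_deathPlace (h : IsModel P W Y p) (u : List ℕ) :
    Measurable fun ω => deathPlace W ω u :=
  (h.measurable_birthPlace u).add ((h.wiener u).measurable 1)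

theorem measurableSet_mem_othersSigma_inl (t : ℕ) (u v : List ℕ) :
    MeasurableSet[othersSigma W Y (Sum.inl u)] {ω | v ∈ generation Y ω t} :=
  measurableSet_mem_generation (fun _ _ => measurable_offspring_othersSigma (by simp)) v

theorem measurableSet_mem_othersSigma_inr {t : ℕ} {u : List ℕ} (hu : t ≤ u.length) (v : List ℕ) :
    MeasurableSet[othersSigma W Y (Sum.inr u)] {ω | v ∈ generation Y ω t} :=
  measurableSet_mem_generation (fun w hw => measurable_offspring_othersSigma (by
    rintro h
    rw [Sum.inr.inj h] at hw
    omega)) v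

theorem measurable_birthPlace_othersSigma_inl {u v : List ℕ} (hv : v.length ≤ u.length) :
    Measurable[othersSigma W Y (Sum.inl u)] fun ω => birthPlace W ω v :=
  measurable_birthPlace (fun w hw => measurable_displacement_othersSigma (by
    rintro h
    rw [Sum.inl.inj h] at hw
    exact lt_irrefl _ hw)) hv

theorem measurable_deathPlace_othersSigma_inl {u v : List ℕ} (hv : v.length ≤ u.length)
    (hne : v ≠ u) : Measurable[othersSigma W Y (Sum.inl u)] fun ω => deathPlace W ω v :=
  (measurable_birthPlace_othersSigma_inl hv).add
    (measurable_displacement_othersSigma (by simpa using hne))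

theorem measurable_deathPlace_othersSigma_inr (u v : List ℕ) :
    Measurable[othersSigma W Y (Sum.inr u)] fun ω => deathPlace W ω v :=
  measurable_deathPlace (n := v.length + 1)
    (fun _ _ => measurable_displacement_othersSigma (by simp)) (Nat.lt_succ_self _)

variable [IsProbabilityMeasure P]

/-- Survival of u and its birth place do not involve the path of u, so they are frozen while its
displacement is integrated out. -/
theorem IsModel.lintegral_displacement (h : IsModel P W Y p) (t : ℕ) (u : List ℕ)
    {F : (Fin d → ℝ) → (Fin d → ℝ) → ENNReal} (hF : Measurable (Function.uncurry F)) :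
    ∫⁻ ω, {ω | u ∈ generation Y ω t}.indicator (fun ω => F (birthPlace W ω u) (W u 1 ω)) ω ∂P =
      ∫⁻ ω, {ω | u ∈ generation Y ω t}.indicator
        (fun ω => ∫⁻ w, F (birthPlace W ω u) w ∂stdGauss d) ω ∂P := by
  set c : Ω → ENNReal := {ω | u ∈ generation Y ω t}.indicator 1 with hc
  have h1 : ∀ (g : Ω → ENNReal) ω, {ω | u ∈ generation Y ω t}.indicator g ω = c ω * g ω := by
    intro g ω
    by_cases hu : ω ∈ {ω | u ∈ generation Y ω t}
    · simp [hc, Set.indicator_of_mem hu]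
    · simp [hc, Set.indicator_of_notMem hu]
  simp only [h1]
  have hcm : Measurable[othersSigma W Y (Sum.inl u)] c :=
    (measurable_const (a := (1 : ENNReal))).indicator (measurableSet_mem_othersSigma_inl t u u)
  have := lintegral_of_indep (Z := fun ω => (c ω, birthPlace W ω u))
    (F := fun (z : ENNReal × (Fin d → ℝ)) w => z.1 * F z.2 w)
    (h.othersSigma_le _) (hcm.prodMk (measurable_birthPlace_othersSigma_inl le_rfl))
    ((h.wiener u).measurable 1) (h.indep_displacement u)
    ((measurable_fst.comp measurable_fst).mul
      (hF.comp ((measurable_snd.comp measurable_fst).prodMk measurable_snd)))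
  rw [this, h.map_displacement]
  refine lintegral_congr fun ω => ?_
  rw [lintegral_const_mul _ (by exact hF.comp (measurable_const.prodMk measurable_id))]

theorem IsModel.lintegral_mul_offspring (h : IsModel P W Y p) (u : List ℕ) {c : Ω → ENNReal}
    (hc : Measurable[othersSigma W Y (Sum.inr u)] c) (φ : ℕ → ENNReal) :
    ∫⁻ ω, c ω * φ (Y u ω) ∂P = (∫⁻ ω, c ω ∂P) * ∫⁻ l, φ l ∂(P.map (Y u)) := by
  rw [lintegral_of_indep (Z := c) (F := fun z l => z * φ l) (h.othersSigma_le _) hc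
    (h.measurable_offspring u) (h.indep_offspring u)
    (measurable_fst.mul (measurable_from_top.comp measurable_snd))]
  simp only [lintegral_const_mul _ measurable_from_top]
  rw [lintegral_mul_const _ (hc.mono (h.othersSigma_le _) le_rfl)]

/-- Belonging to generation t depends on offspring numbers of shorter labels only, so `Y u` is
independent of the rest. A label of another length contributes zero on both sides. -/
theorem IsModel.lintegral_indicator_offspring (h : IsModel P W Y p) (t : ℕ) (u : List ℕ)
    {g : (Fin d → ℝ) → ENNReal} (hg : Measurable g) (φ : ℕ → ENNReal) :
    ∫⁻ ω, {ω | u ∈ generation Y ω t}.indicator (fun ω => φ (Y u ω) * g (deathPlace W ω u)) ω ∂P =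
      (∫⁻ l, φ l ∂(P.map (Y u))) *
        ∫⁻ ω, {ω | u ∈ generation Y ω t}.indicator (fun ω => g (deathPlace W ω u)) ω ∂P := by
  by_cases hu : u.length = t
  · rw [mul_comm, ← h.lintegral_mul_offspring]
    · refine lintegral_congr fun ω => ?_
      by_cases hω : ω ∈ {ω | u ∈ generation Y ω t}
      · rw [Set.indicator_of_mem hω, Set.indicator_of_mem hω, mul_comm]
      · rw [Set.indicator_of_notMem hω, Set.indicator_of_notMem hω, zero_mul]
    · exact (hg.comp (measurable_deathPlace_othersSigma_inr u u)).indicator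
        (measurableSet_mem_othersSigma_inr hu.ge u)
  · simp [mem_generation_iff, hu]

theorem IsModel.lintegral_sum_deathPlace (h : IsModel P W Y p) (t : ℕ)
    {g : (Fin d → ℝ) → ENNReal} (hg : Measurable g) :
    ∫⁻ ω, ∑ u ∈ generation Y ω t, g (deathPlace W ω u) ∂P =
      ∫⁻ ω, ∑ u ∈ generation Y ω t, ∫⁻ w, g (birthPlace W ω u + w) ∂stdGauss d ∂P := by
  have hg' : Measurable fun x => ∫⁻ w, g (x + w) ∂stdGauss d :=
    Measurable.lintegral_prod_right' (f := fun q : (Fin d → ℝ) × (Fin d → ℝ) => g (q.1 + q.2))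
      (hg.comp (by fun_prop))
  rw [lintegral_sum_random (g := fun u ω => g (deathPlace W ω u)) (h.measurableSet_mem t)
      fun u => hg.comp (h.measurable_deathPlace u),
    lintegral_sum_random (g := fun u ω => ∫⁻ w, g (birthPlace W ω u + w) ∂stdGauss d)
      (h.measurableSet_mem t) fun u => hg'.comp (h.measurable_birthPlace u)]
  refine tsum_congr fun u => ?_
  exact h.lintegral_displacement t u (F := fun x w => g (x + w)) (hg.comp (by fun_prop))

/-- Each generation multiplies the mean number by m and convolves the position with one more
standard Gaussian. -/
theorem IsModel.lintegral_sum_birthPlace (h : IsModel P W Y p)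
    (hm : HasSum (fun l : ℕ => (l : ℝ) * p l) m) (t : ℕ)
    {g : (Fin d → ℝ) → ENNReal} (hg : Measurable g) :
    ∫⁻ ω, ∑ u ∈ generation Y ω t, g (birthPlace W ω u) ∂P =
      ENNReal.ofReal m ^ t * ∫⁻ w, g (√(t : ℝ) • w) ∂stdGauss d := by
  induction t generalizing g with
  | zero => simp [generation, birthPlace]
  | succ t ih =>
    have hg' : Measurable fun x => ∫⁻ w, g (x + w) ∂stdGauss d :=
      Measurable.lintegral_prod_right' (f := fun q : (Fin d → ℝ) × (Fin d → ℝ) => g (q.1 + q.2))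
        (hg.comp (by fun_prop))
    simp only [sum_birthPlace_succ, nsmul_eq_mul]
    rw [lintegral_sum_random (h.measurableSet_mem t)]
    · simp only [h.lintegral_indicator_offspring t _ hg (fun l => (l : ENNReal)),
        h.lintegral_offspring hm, ENNReal.tsum_mul_left]
      rw [← lintegral_sum_random (g := fun u ω => g (deathPlace W ω u)) (h.measurableSet_mem t)
        fun u => hg.comp (h.measurable_deathPlace u), h.lintegral_sum_deathPlace t hg,
        ih hg', pow_succ, mul_comm _ (ENNReal.ofReal m), mul_assoc]
      have h2 := lintegral_stdGauss_add (d := d) (a := t) (b := 1) (Nat.cast_nonneg t) zero_le_one hg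
      simp only [Real.sqrt_one, one_smul] at h2
      rw [h2]
      push_cast
      rfl
    · exact fun u => (measurable_from_top.comp (h.measurable_offspring u)).mul
        (hg.comp (h.measurable_deathPlace u))

theorem IsModel.lintegral_sum_deathPlace_eq (h : IsModel P W Y p)
    (hm : HasSum (fun l : ℕ => (l : ℝ) * p l) m) (t : ℕ)
    {g : (Fin d → ℝ) → ENNReal} (hg : Measurable g) :
    ∫⁻ ω, ∑ u ∈ generation Y ω t, g (deathPlace W ω u) ∂P =
      ENNReal.ofReal m ^ t * ∫⁻ w, g (√((t + 1 : ℕ) : ℝ) • w) ∂stdGauss d := by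
  have hg' : Measurable fun x => ∫⁻ w, g (x + w) ∂stdGauss d :=
    Measurable.lintegral_prod_right' (f := fun q : (Fin d → ℝ) × (Fin d → ℝ) => g (q.1 + q.2))
      (hg.comp (by fun_prop))
  rw [h.lintegral_sum_deathPlace t hg, h.lintegral_sum_birthPlace hm t hg']
  have h2 := lintegral_stdGauss_add (d := d) (a := t) (b := 1) (Nat.cast_nonneg t) zero_le_one hg
  simp only [Real.sqrt_one, one_smul] at h2
  rw [h2]
  push_cast
  rfl

end ManyToOne

/-! ### Orthogonal noise in one step -/

section OneStep

variable {Ω : Type*} {mΩ : MeasurableSpace Ω} {P : Measure Ω} {d : ℕ}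
  {W : List ℕ → ℝ≥0 → Ω → (Fin d → ℝ)} {Y : List ℕ → Ω → ℕ} {p : ℕ → ℝ} {m : ℝ}

/-- For two particles u ≠ v of one generation, everything in the product except ξ_u is measurable
for 𝒢 u, so the hypothesis on means makes the pair orthogonal. -/
theorem IsModel.lintegral_sq_sum_noise_le (h : IsModel P W Y p) {t : ℕ} {ξ : List ℕ → Ω → ℝ}
    (hξ : ∀ u, Measurable (ξ u)) {𝒢 : List ℕ → MeasurableSpace Ω}
    (hzero : ∀ u, u.length = t → ∀ c : Ω → ℝ, Measurable[𝒢 u] c →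
      Integrable (fun ω => c ω * ξ u ω) P → ∫ ω, c ω * ξ u ω ∂P = 0)
    (hξ𝒢 : ∀ u v, u.length = t → v.length = t → u ≠ v → Measurable[𝒢 u] (ξ v))
    (hA : ∀ u v, u.length = t → MeasurableSet[𝒢 u] {ω | v ∈ generation Y ω t}) :
    ∫⁻ ω, ‖∑ u ∈ generation Y ω t, ξ u ω‖ₑ ^ 2 ∂P ≤
      ∑' u, ∫⁻ ω, {ω | u ∈ generation Y ω t}.indicator (fun ω => ‖ξ u ω‖ₑ ^ 2) ω ∂P := by
  refine lintegral_enorm_sq_sum_random_le (h.measurableSet_mem t) hξ fun u v hne hu hv => ?_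
  by_cases hut : u.length = t
  swap
  · simp [mem_generation_iff, hut]
  by_cases hvt : v.length = t
  swap
  · simp [mem_generation_iff, hvt]
  have heq : ∀ ω, {ω | u ∈ generation Y ω t}.indicator (ξ u) ω *
      {ω | v ∈ generation Y ω t}.indicator (ξ v) ω =
      ({ω | u ∈ generation Y ω t}.indicator 1 ω * {ω | v ∈ generation Y ω t}.indicator (ξ v) ω) *
        ξ u ω := by
    intro ω
    by_cases hω : ω ∈ {ω | u ∈ generation Y ω t}
    · rw [Set.indicator_of_mem hω, Set.indicator_of_mem hω, Pi.one_apply]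
      ring
    · rw [Set.indicator_of_notMem hω, Set.indicator_of_notMem hω]
      ring
  have hint := hu.integrable_mul hv
  simp only [Pi.mul_def, heq] at hint ⊢
  refine hzero u hut _ ?_ hint
  exact ((measurable_const (a := (1 : ℝ))).indicator (hA u u hut)).mul
    ((hξ𝒢 u v hut hvt hne).indicator (hA u v hut))

/-- `Pf(x) = E f(x + G)` for a standard Gaussian vector `G`. -/
def heatStep (f : (Fin d → ℝ) → ℝ) (x : Fin d → ℝ) : ℝ := ∫ w, f (x + w) ∂stdGauss d

theorem measurable_heatStep {f : (Fin d → ℝ) → ℝ} (hf : Measurable f) :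
    Measurable (heatStep f) := by
  refine StronglyMeasurable.measurable ?_
  refine StronglyMeasurable.integral_prod_right (f := fun x w => f (x + w)) ?_
  exact (hf.comp (by fun_prop)).stronglyMeasurable

theorem integral_sub_heatStep (f : (Fin d → ℝ) → ℝ) (x : Fin d → ℝ) :
    ∫ w, (f (x + w) - heatStep f x) ∂stdGauss d = 0 := by
  by_cases hint : Integrable (fun w => f (x + w)) (stdGauss d)
  · rw [integral_sub hint (integrable_const _)]
    simp [heatStep]
  -- Without integrability both integrals take the default value 0, so the identity persists.
  · refine integral_undef fun h => hint ?_
    refine (h.add (integrable_const (heatStep f x))).congr (Eventually.of_forall fun w => ?_)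
    simp

/-- The displacement noise of the particle `u` in the test function `f`. -/
def displacementNoise (W : List ℕ → ℝ≥0 → Ω → (Fin d → ℝ)) (f : (Fin d → ℝ) → ℝ) (u : List ℕ)
    (ω : Ω) : ℝ :=
  f (deathPlace W ω u) - heatStep f (birthPlace W ω u)

theorem sum_displacementNoise (t : ℕ) (f : (Fin d → ℝ) → ℝ) (ω : Ω) :
    ∑ u ∈ generation Y ω t, displacementNoise W f u ω =
      sumBefore W Y t f ω - sumAfter W Y t (heatStep f) ω :=
  Finset.sum_sub_distrib ..

theorem IsModel.measurable_displacementNoise (h : IsModel P W Y p) {f : (Fin d → ℝ) → ℝ}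
    (hf : Measurable f) (u : List ℕ) : Measurable (displacementNoise W f u) :=
  (hf.comp (h.measurable_deathPlace u)).sub
    ((measurable_heatStep hf).comp (h.measurable_birthPlace u))

/-- The branching noise of the particle `u` in the test function `f`. -/
def offspringNoise (W : List ℕ → ℝ≥0 → Ω → (Fin d → ℝ)) (Y : List ℕ → Ω → ℕ) (m : ℝ)
    (f : (Fin d → ℝ) → ℝ) (u : List ℕ) (ω : Ω) : ℝ :=
  ((Y u ω : ℝ) - m) * f (deathPlace W ω u)

theorem sum_offspringNoise (t : ℕ) (f : (Fin d → ℝ) → ℝ) (ω : Ω) :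
    ∑ u ∈ generation Y ω t, offspringNoise W Y m f u ω =
      sumAfter W Y (t + 1) f ω - m * sumBefore W Y t f ω := by
  rw [sumAfter, sum_birthPlace_succ, sumBefore, Finset.mul_sum, ← Finset.sum_sub_distrib]
  refine Finset.sum_congr rfl fun u _ => ?_
  rw [offspringNoise, nsmul_eq_mul]
  ring

theorem IsModel.measurable_offspringNoise (h : IsModel P W Y p) {f : (Fin d → ℝ) → ℝ}
    (hf : Measurable f) (u : List ℕ) : Measurable (offspringNoise W Y m f u) :=
  ((measurable_from_top.comp (h.measurable_offspring u)).sub_const m).mul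
    (hf.comp (h.measurable_deathPlace u))

variable [IsProbabilityMeasure P]

/-- Each term has mean zero on B. Exchanging sum and integral needs an L¹ bound: |ξ| ≤ 1 + ξ² for
every living particle, and the mean number of particles is m^t. -/
theorem IsModel.setIntegral_sum_noise_eq_zero (h : IsModel P W Y p)
    (hm : HasSum (fun l : ℕ => (l : ℝ) * p l) m) {t : ℕ} {ξ : List ℕ → Ω → ℝ}
    (hξ : ∀ u, Measurable (ξ u)) {𝒢 : List ℕ → MeasurableSpace Ω}
    (hzero : ∀ u, u.length = t → ∀ c : Ω → ℝ, Measurable[𝒢 u] c →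
      Integrable (fun ω => c ω * ξ u ω) P → ∫ ω, c ω * ξ u ω ∂P = 0)
    (hA : ∀ u v, u.length = t → MeasurableSet[𝒢 u] {ω | v ∈ generation Y ω t})
    (hfin : ∑' u, ∫⁻ ω, {ω | u ∈ generation Y ω t}.indicator (fun ω => ‖ξ u ω‖ₑ ^ 2) ω ∂P ≠ ⊤)
    {B : Set Ω} (hB : MeasurableSet B) (hB𝒢 : ∀ u, u.length = t → MeasurableSet[𝒢 u] B) :
    ∫ ω in B, ∑ u ∈ generation Y ω t, ξ u ω ∂P = 0 := by
  refine integral_sum_random_eq_zero (h.measurableSet_mem t) hξ ?_ fun u hu => ?_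
  · have hone : ∑' u, ∫⁻ ω, {ω | u ∈ generation Y ω t}.indicator (fun _ => (1 : ENNReal)) ω ∂P =
        ENNReal.ofReal m ^ t := by
      rw [← lintegral_sum_random (h.measurableSet_mem t) fun _ => measurable_const]
      simpa using h.lintegral_sum_birthPlace hm t (g := fun _ => 1) measurable_const
    have hle : ∑' u, ∫⁻ ω in B, {ω | u ∈ generation Y ω t}.indicator (fun ω => ‖ξ u ω‖ₑ) ω ∂P ≤
        ∑' u, (∫⁻ ω, {ω | u ∈ generation Y ω t}.indicator (fun _ => (1 : ENNReal)) ω ∂P +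
          ∫⁻ ω, {ω | u ∈ generation Y ω t}.indicator (fun ω => ‖ξ u ω‖ₑ ^ 2) ω ∂P) := by
      refine ENNReal.tsum_le_tsum fun u => (setLIntegral_le_lintegral _ _).trans ?_
      rw [← lintegral_add_left (measurable_const.indicator (h.measurableSet_mem t u))]
      refine lintegral_mono fun ω => ?_
      by_cases hω : ω ∈ {ω | u ∈ generation Y ω t}
      · simp only [Set.indicator_of_mem hω]
        rcases le_total ‖ξ u ω‖ₑ 1 with h1 | h1
        · exact h1.trans le_self_add
        · exact (le_self_pow₀ h1 two_ne_zero).trans le_add_self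
      · simp only [Set.indicator_of_notMem hω]
        exact zero_le
    refine ne_top_of_le_ne_top ?_ hle
    rw [ENNReal.tsum_add, hone]
    exact ENNReal.add_ne_top.2 ⟨ENNReal.pow_ne_top ENNReal.ofReal_ne_top, hfin⟩
  · by_cases hut : u.length = t
    swap
    · simp [mem_generation_iff, hut]
    have heq : ∀ ω, B.indicator ({ω | u ∈ generation Y ω t}.indicator (ξ u)) ω =
        (B ∩ {ω | u ∈ generation Y ω t}).indicator 1 ω * ξ u ω := by
      intro ω
      rw [Set.indicator_indicator]
      by_cases hω : ω ∈ B ∩ {ω | u ∈ generation Y ω t}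
      · simp only [Set.indicator_of_mem hω, Pi.one_apply, one_mul]
      · simp only [Set.indicator_of_notMem hω, zero_mul]
    rw [← integral_indicator hB]
    rw [← IntegrableOn, ← integrable_indicator_iff hB] at hu
    rw [show B.indicator ({ω | u ∈ generation Y ω t}.indicator (ξ u)) = fun ω =>
      (B ∩ {ω | u ∈ generation Y ω t}).indicator 1 ω * ξ u ω from funext heq] at hu ⊢
    exact hzero u hut _
      ((measurable_const (a := (1 : ℝ))).indicator ((hB𝒢 u hut).inter (hA u u hut))) hu

theorem IsModel.integral_mul_displacementNoise (h : IsModel P W Y p) {f : (Fin d → ℝ) → ℝ}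
    (hf : Measurable f) (u : List ℕ) {c : Ω → ℝ} (hc : Measurable[othersSigma W Y (Sum.inl u)] c)
    (hint : Integrable (fun ω => c ω * displacementNoise W f u ω) P) :
    ∫ ω, c ω * displacementNoise W f u ω ∂P = 0 := by
  have := integral_of_indep (Z := fun ω => (c ω, birthPlace W ω u)) (V := W u 1)
    (F := fun (z : ℝ × (Fin d → ℝ)) w => z.1 * (f (z.2 + w) - heatStep f z.2))
    (h.othersSigma_le _) (hc.prodMk (measurable_birthPlace_othersSigma_inl le_rfl))
    ((h.wiener u).measurable 1) (h.indep_displacement u)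
    ((measurable_fst.comp measurable_fst).mul ((hf.comp (by fun_prop)).sub
      ((measurable_heatStep hf).comp (by fun_prop)))) hint
  refine this.trans ?_
  rw [h.map_displacement]
  simp only [integral_const_mul, integral_sub_heatStep, mul_zero, integral_zero]

/-- Given the birth place, the noise contributes a variance, at most the second moment of f at the
place of death; many-to-one sums these. -/
theorem IsModel.tsum_displacementNoise_le (h : IsModel P W Y p)
    (hm : HasSum (fun l : ℕ => (l : ℝ) * p l) m) (t : ℕ) {f : (Fin d → ℝ) → ℝ} (hf : Measurable f) :
    ∑' u, ∫⁻ ω, {ω | u ∈ generation Y ω t}.indicator (fun ω => ‖displacementNoise W f u ω‖ₑ ^ 2) ω ∂P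
      ≤ ENNReal.ofReal m ^ t * ∫⁻ w, ‖f (√((t + 1 : ℕ) : ℝ) • w)‖ₑ ^ 2 ∂stdGauss d := by
  have hg : Measurable fun x => ‖f x‖ₑ ^ 2 := by fun_prop
  rw [← h.lintegral_sum_deathPlace_eq hm t hg, lintegral_sum_random
    (g := fun u ω => ‖f (deathPlace W ω u)‖ₑ ^ 2) (h.measurableSet_mem t)
    fun u => hg.comp (h.measurable_deathPlace u)]
  refine ENNReal.tsum_le_tsum fun u => ?_
  have h1 := h.lintegral_displacement t u (F := fun x w => ‖f (x + w) - heatStep f x‖ₑ ^ 2)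
    (by
      have := measurable_heatStep hf
      exact (((hf.comp (by fun_prop)).sub (this.comp measurable_fst)).enorm.pow_const 2))
  have h2 := h.lintegral_displacement t u (F := fun x w => ‖f (x + w)‖ₑ ^ 2)
    ((hf.comp (by fun_prop)).enorm.pow_const 2)
  refine (le_of_eq h1).trans (le_trans ?_ (le_of_eq h2.symm))
  refine lintegral_mono fun ω => Set.indicator_le_indicator ?_
  exact lintegral_enorm_sub_integral_sq_le (g := fun w => f (birthPlace W ω u + w))
    (hf.comp (by fun_prop))

theorem IsModel.lintegral_sumBefore_sub_le (h : IsModel P W Y p)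
    (hm : HasSum (fun l : ℕ => (l : ℝ) * p l) m) (t : ℕ) {f : (Fin d → ℝ) → ℝ} (hf : Measurable f) :
    ∫⁻ ω, ‖sumBefore W Y t f ω - sumAfter W Y t (heatStep f) ω‖ₑ ^ 2 ∂P ≤
      ENNReal.ofReal m ^ t * ∫⁻ w, ‖f (√((t + 1 : ℕ) : ℝ) • w)‖ₑ ^ 2 ∂stdGauss d := by
  simp only [← sum_displacementNoise]
  refine (h.lintegral_sq_sum_noise_le (h.measurable_displacementNoise hf)
    (𝒢 := fun u => othersSigma W Y (Sum.inl u))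
    (fun u _ c hc hint => h.integral_mul_displacementNoise hf u hc hint)
    (fun u v hu hv hne => ?_) (fun u v _ => measurableSet_mem_othersSigma_inl t u v)).trans
    (h.tsum_displacementNoise_le hm t hf)
  exact (hf.comp (measurable_deathPlace_othersSigma_inl (hv.trans hu.symm).le hne.symm)).sub
    ((measurable_heatStep hf).comp (measurable_birthPlace_othersSigma_inl (hv.trans hu.symm).le))

/-- The conditional mean of the displacement noise is zero given the earlier paths and any offspring
numbers; the freedom in b serves both filtrations. -/
theorem IsModel.setIntegral_sumBefore_sub (h : IsModel P W Y p)
    (hm : HasSum (fun l : ℕ => (l : ℝ) * p l) m) (t : ℕ) {f : (Fin d → ℝ) → ℝ} (hf : Measurable f)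
    (hfin : ∫⁻ w, ‖f (√((t + 1 : ℕ) : ℝ) • w)‖ₑ ^ 2 ∂stdGauss d ≠ ⊤) {b : ℕ} {B : Set Ω}
    (hB : MeasurableSet[history W Y t b] B) :
    ∫ ω in B, (sumBefore W Y t f ω - sumAfter W Y t (heatStep f) ω) ∂P = 0 := by
  simp only [← sum_displacementNoise]
  refine h.setIntegral_sum_noise_eq_zero hm (h.measurable_displacementNoise hf)
    (𝒢 := fun u => othersSigma W Y (Sum.inl u))
    (fun u _ c hc hint => h.integral_mul_displacementNoise hf u hc hint)
    (fun u v _ => measurableSet_mem_othersSigma_inl t u v)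
    (ne_top_of_le_ne_top ?_ (h.tsum_displacementNoise_le hm t hf)) (history_le h t b B hB)
    fun u hu => history_le_othersSigma_inl hu.ge B hB
  exact ENNReal.mul_ne_top (ENNReal.pow_ne_top ENNReal.ofReal_ne_top) hfin

theorem IsModel.integral_mul_offspringNoise (h : IsModel P W Y p)
    (hm : HasSum (fun l : ℕ => (l : ℝ) * p l) m) {f : (Fin d → ℝ) → ℝ}
    (hf : Measurable f) (u : List ℕ) {c : Ω → ℝ} (hc : Measurable[othersSigma W Y (Sum.inr u)] c)
    (hint : Integrable (fun ω => c ω * offspringNoise W Y m f u ω) P) :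
    ∫ ω, c ω * offspringNoise W Y m f u ω ∂P = 0 := by
  have heq : ∀ ω, c ω * offspringNoise W Y m f u ω =
      (c ω * f (deathPlace W ω u)) * ((Y u ω : ℝ) - m) := fun ω => by
    rw [offspringNoise]
    ring
  simp only [heq] at hint ⊢
  have := integral_of_indep (Z := fun ω => c ω * f (deathPlace W ω u)) (V := Y u)
    (F := fun (z : ℝ) l => z * ((l : ℝ) - m)) (h.othersSigma_le _)
    (hc.mul (hf.comp (measurable_deathPlace_othersSigma_inr u u)))
    (h.measurable_offspring u) (h.indep_offspring u)
    (measurable_fst.mul ((measurable_from_top (f := fun l : ℕ => (l : ℝ) - m)).comp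
      measurable_snd)) hint
  refine this.trans ?_
  simp only [integral_const_mul, h.integral_offspring_sub hm, mul_zero, integral_zero]

/-- The offspring number of u is independent of its place of death, so its variance factors out. -/
theorem IsModel.tsum_offspringNoise_eq (h : IsModel P W Y p)
    (hm : HasSum (fun l : ℕ => (l : ℝ) * p l) m)
    (hvar : Summable (fun l : ℕ => ((l : ℝ) - m) ^ 2 * p l)) (t : ℕ) {f : (Fin d → ℝ) → ℝ}
    (hf : Measurable f) :
    ∑' u, ∫⁻ ω, {ω | u ∈ generation Y ω t}.indicator (fun ω => ‖offspringNoise W Y m f u ω‖ₑ ^ 2) ω ∂P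
      = ENNReal.ofReal (∑' l : ℕ, ((l : ℝ) - m) ^ 2 * p l) *
        (ENNReal.ofReal m ^ t * ∫⁻ w, ‖f (√((t + 1 : ℕ) : ℝ) • w)‖ₑ ^ 2 ∂stdGauss d) := by
  have hg : Measurable fun x => ‖f x‖ₑ ^ 2 := by fun_prop
  rw [← h.lintegral_sum_deathPlace_eq hm t hg, lintegral_sum_random
    (g := fun u ω => ‖f (deathPlace W ω u)‖ₑ ^ 2) (h.measurableSet_mem t)
    fun u => hg.comp (h.measurable_deathPlace u), ← ENNReal.tsum_mul_left]
  refine tsum_congr fun u => ?_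
  have := h.lintegral_indicator_offspring t u hg fun l => ‖(l : ℝ) - m‖ₑ ^ 2
  rw [h.lintegral_offspring_sub_sq hvar] at this
  rw [← this]
  simp only [offspringNoise, enorm_mul, mul_pow]

theorem IsModel.lintegral_sumAfter_succ_sub_le (h : IsModel P W Y p)
    (hm : HasSum (fun l : ℕ => (l : ℝ) * p l) m)
    (hvar : Summable (fun l : ℕ => ((l : ℝ) - m) ^ 2 * p l)) (t : ℕ) {f : (Fin d → ℝ) → ℝ}
    (hf : Measurable f) :
    ∫⁻ ω, ‖sumAfter W Y (t + 1) f ω - m * sumBefore W Y t f ω‖ₑ ^ 2 ∂P ≤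
      ENNReal.ofReal (∑' l : ℕ, ((l : ℝ) - m) ^ 2 * p l) *
        (ENNReal.ofReal m ^ t * ∫⁻ w, ‖f (√((t + 1 : ℕ) : ℝ) • w)‖ₑ ^ 2 ∂stdGauss d) := by
  simp only [← sum_offspringNoise]
  rw [← h.tsum_offspringNoise_eq hm hvar t hf]
  refine h.lintegral_sq_sum_noise_le (h.measurable_offspringNoise hf)
    (𝒢 := fun u => othersSigma W Y (Sum.inr u))
    (fun u _ c hc hint => h.integral_mul_offspringNoise hm hf u hc hint)
    (fun u v hu hv hne => ?_) (fun u v hu => measurableSet_mem_othersSigma_inr hu.ge v)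
  exact ((measurable_from_top.comp (measurable_offspring_othersSigma
    (by simpa using hne.symm))).sub_const m).mul
    (hf.comp (measurable_deathPlace_othersSigma_inr u v))

theorem IsModel.setIntegral_sumAfter_succ_sub (h : IsModel P W Y p)
    (hm : HasSum (fun l : ℕ => (l : ℝ) * p l) m)
    (hvar : Summable (fun l : ℕ => ((l : ℝ) - m) ^ 2 * p l)) (t : ℕ) {f : (Fin d → ℝ) → ℝ}
    (hf : Measurable f) (hfin : ∫⁻ w, ‖f (√((t + 1 : ℕ) : ℝ) • w)‖ₑ ^ 2 ∂stdGauss d ≠ ⊤) {a : ℕ}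
    {B : Set Ω} (hB : MeasurableSet[history W Y a t] B) :
    ∫ ω in B, (sumAfter W Y (t + 1) f ω - m * sumBefore W Y t f ω) ∂P = 0 := by
  simp only [← sum_offspringNoise]
  refine h.setIntegral_sum_noise_eq_zero hm (h.measurable_offspringNoise hf)
    (𝒢 := fun u => othersSigma W Y (Sum.inr u))
    (fun u _ c hc hint => h.integral_mul_offspringNoise hm hf u hc hint)
    (fun u v hu => measurableSet_mem_othersSigma_inr hu.ge v) ?_ (history_le h a t B hB)
    fun u hu => history_le_othersSigma_inr hu.ge B hB
  rw [h.tsum_offspringNoise_eq hm hvar t hf]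
  exact ENNReal.mul_ne_top ENNReal.ofReal_ne_top
    (ENNReal.mul_ne_top (ENNReal.pow_ne_top ENNReal.ofReal_ne_top) hfin)

end OneStep

/-! ### From L¹ bounds to almost sure convergence -/

section AlmostSure

variable {Ω : Type*} {mΩ : MeasurableSpace Ω} {μ : Measure Ω}

theorem lintegral_enorm_le_of_sq_le [IsProbabilityMeasure μ] {g : Ω → ℝ} (hg : Measurable g) {c : ℝ}
    (hc : 0 ≤ c) (h : ∫⁻ ω, ‖g ω‖ₑ ^ 2 ∂μ ≤ ENNReal.ofReal (c ^ 2)) :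
    ∫⁻ ω, ‖g ω‖ₑ ∂μ ≤ ENNReal.ofReal c := by
  have h1 := eLpNorm_le_eLpNorm_of_exponent_le (μ := μ) (p := 1) (q := 2) (f := g)
    (by norm_num) hg.aestronglyMeasurable
  rw [eLpNorm_one_eq_lintegral_enorm] at h1
  refine h1.trans ?_
  rw [eLpNorm_eq_lintegral_rpow_enorm_toReal two_ne_zero ENNReal.ofNat_ne_top]
  simp only [ENNReal.toReal_ofNat, ENNReal.rpow_ofNat]
  calc _ ≤ (ENNReal.ofReal (c ^ 2)) ^ (1 / 2 : ℝ) := by gcongr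
    _ = ENNReal.ofReal c := by
      rw [ENNReal.ofReal_rpow_of_nonneg (sq_nonneg c) (by norm_num), ← Real.sqrt_eq_rpow,
        Real.sqrt_sq hc]

/-- The series has finite expectation, hence is finite almost surely; this plays the part of
Borel–Cantelli. -/
theorem ae_summable_abs_of_lintegral_le {g : ℕ → Ω → ℝ} (hg : ∀ n, Measurable (g n)) {b : ℕ → ℝ}
    (hb : Summable b) (hb0 : ∀ n, 0 ≤ b n) (h : ∀ n, ∫⁻ ω, ‖g n ω‖ₑ ∂μ ≤ ENNReal.ofReal (b n)) :
    ∀ᵐ ω ∂μ, Summable fun n => |g n ω| := by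
  have h1 : ∫⁻ ω, ∑' n, ‖g n ω‖ₑ ∂μ ≠ ⊤ := by
    rw [lintegral_tsum fun n => (hg n).enorm.aemeasurable]
    refine ne_top_of_le_ne_top ?_ (ENNReal.tsum_le_tsum h)
    rw [← ENNReal.ofReal_tsum_of_nonneg hb0 hb]
    exact ENNReal.ofReal_ne_top
  filter_upwards [ae_lt_top (Measurable.tsum fun n => (hg n).enorm) h1] with ω hω
  have := ENNReal.summable_toReal hω.ne
  simpa using this

theorem ae_tendsto_zero_of_lintegral_le {g : ℕ → Ω → ℝ} (hg : ∀ n, Measurable (g n)) {b : ℕ → ℝ}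
    (hb : Summable b) (hb0 : ∀ n, 0 ≤ b n)
    (h : ∀ᶠ n in atTop, ∫⁻ ω, ‖g n ω‖ₑ ∂μ ≤ ENNReal.ofReal (b n)) :
    ∀ᵐ ω ∂μ, Tendsto (fun n => g n ω) atTop (𝓝 0) := by
  obtain ⟨n₀, hn₀⟩ := eventually_atTop.1 h
  have := ae_summable_abs_of_lintegral_le (g := fun n => g (n + n₀)) (fun n => hg _)
    ((summable_nat_add_iff n₀).2 hb) (fun n => hb0 _) fun n => hn₀ _ (by omega)
  filter_upwards [this] with ω hω
  exact (tendsto_add_atTop_iff_nat n₀).1 ((tendsto_zero_iff_abs_tendsto_zero _).2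
    hω.tendsto_atTop_zero)

theorem summable_succ_pow_mul_geometric (q : ℕ) {r : ℝ} (hr0 : 0 < r) (hr1 : r < 1) :
    Summable fun t : ℕ => ((t + 1 : ℕ) : ℝ) ^ q * r ^ t := by
  have h := summable_pow_mul_geometric_of_norm_lt_one q
    (show ‖r‖ < 1 by rwa [Real.norm_of_nonneg hr0.le])
  refine (((summable_nat_add_iff 1).2 h).mul_right r⁻¹).congr fun t => ?_
  rw [pow_succ]
  field_simp

theorem exists_succ_pow_mul_geometric_le (q : ℕ) {r : ℝ} (hr0 : 0 < r) (hr1 : r < 1) :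
    ∃ C : ℝ, 0 ≤ C ∧ ∀ t : ℕ, ((t + 1 : ℕ) : ℝ) ^ q * r ^ t ≤ C := by
  have h := summable_succ_pow_mul_geometric q hr0 hr1
  have h0 : ∀ t : ℕ, 0 ≤ ((t + 1 : ℕ) : ℝ) ^ q * r ^ t := fun t => by positivity
  exact ⟨_, tsum_nonneg h0, fun t => h.le_tsum t fun i _ => h0 i⟩

theorem natCast_le_sqrt_succ_sq (T : ℕ) : (T : ℝ) ≤ ((Nat.sqrt T + 1 : ℕ) : ℝ) ^ 2 := by
  have := Nat.lt_succ_sqrt' T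
  exact_mod_cast this.le

theorem tendsto_natSqrt_atTop : Tendsto Nat.sqrt atTop atTop := by
  refine tendsto_atTop.2 fun b => ?_
  filter_upwards [eventually_ge_atTop (b * b)] with T hT
  exact Nat.le_sqrt.2 hT

theorem exists_limit_of_summable_increments {a : ℕ → ℝ}
    (h : ∀ j : ℕ, Summable fun t : ℕ => ((t + 1 : ℕ) : ℝ) ^ j * |a (t + 1) - a t|) :
    ∃ l, Tendsto a atTop (𝓝 l) := by
  refine cauchySeq_tendsto_of_complete (cauchySeq_of_summable_dist ((h 0).congr fun t => ?_))
  rw [pow_zero, one_mul, dist_comm, Real.dist_eq]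

/-- With s = `Nat.sqrt T`, T^k ≤ (s+1)^(2k), and this weight may be moved inside the sum of the
increments from s on. What remains is the tail of a convergent series. -/
theorem tendsto_pow_mul_sub_of_summable_increments {a : ℕ → ℝ}
    (h : ∀ j : ℕ, Summable fun t : ℕ => ((t + 1 : ℕ) : ℝ) ^ j * |a (t + 1) - a t|) {l : ℝ}
    (hl : Tendsto a atTop (𝓝 l)) (k : ℕ) :
    Tendsto (fun T : ℕ => (T : ℝ) ^ k * (a (Nat.sqrt T) - l)) atTop (𝓝 0) := by
  set b : ℕ → ℝ := fun t => ((t + 1 : ℕ) : ℝ) ^ (2 * k) * |a (t + 1) - a t| with hb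
  have hbs : Summable b := h (2 * k)
  have h0 : Summable fun t => |a (t + 1) - a t| := (h 0).congr fun t => by simp
  have htail : Tendsto (fun s => ∑' t, b (t + s)) atTop (𝓝 0) := tendsto_sum_nat_add b
  refine squeeze_zero_norm (fun T => ?_) (htail.comp tendsto_natSqrt_atTop)
  set s := Nat.sqrt T with hs
  have h1 : |a s - l| ≤ ∑' t, |a (s + t + 1) - a (s + t)| := by
    have := dist_le_tsum_of_dist_le_of_tendsto (fun t => |a (t + 1) - a t|)
      (fun n => by rw [dist_comm, Real.dist_eq]) h0 hl s
    rwa [Real.dist_eq] at this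
  have hsum0 : Summable fun t => |a (s + t + 1) - a (s + t)| :=
    ((summable_nat_add_iff s).2 h0).congr fun t => by rw [add_comm t s]
  rw [norm_mul, Real.norm_of_nonneg (by positivity), Real.norm_eq_abs, Function.comp_apply]
  calc (T : ℝ) ^ k * |a s - l|
      ≤ ((s + 1 : ℕ) : ℝ) ^ (2 * k) * ∑' t, |a (s + t + 1) - a (s + t)| := by
        rw [pow_mul]
        gcongr
        exact natCast_le_sqrt_succ_sq T
    _ = ∑' t, ((s + 1 : ℕ) : ℝ) ^ (2 * k) * |a (s + t + 1) - a (s + t)| := by rw [tsum_mul_left]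
    _ ≤ ∑' t, b (t + s) := by
        refine Summable.tsum_le_tsum (fun t => ?_) (hsum0.mul_left _) ((summable_nat_add_iff s).2 hbs)
        simp only [hb]
        rw [add_comm s t]
        refine mul_le_mul_of_nonneg_right (pow_le_pow_left₀ (by positivity) ?_ _) (abs_nonneg _)
        exact_mod_cast (by omega : s + 1 ≤ t + s + 1)

end AlmostSure

/-! ### Geometric step bounds and their consequences -/

section NormalizedEstimates

variable {Ω : Type*} {mΩ : MeasurableSpace Ω} {P : Measure Ω} {d : ℕ}
  {W : List ℕ → ℝ≥0 → Ω → (Fin d → ℝ)} {Y : List ℕ → Ω → ℕ} {p : ℕ → ℝ} {m κ r : ℝ}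

theorem IsModel.measurable_sumAfter (h : IsModel P W Y p) (t : ℕ) {f : (Fin d → ℝ) → ℝ}
    (hf : Measurable f) : Measurable (sumAfter W Y t f) :=
  BranchingWiener.measurable_sumAfter (fun v _ => (h.wiener v).measurable 1)
    (fun v _ => h.measurable_offspring v) hf

theorem IsModel.measurable_sumBefore (h : IsModel P W Y p) (t : ℕ) {f : (Fin d → ℝ) → ℝ}
    (hf : Measurable f) : Measurable (sumBefore W Y t f) :=
  BranchingWiener.measurable_sumBefore (fun v _ => (h.wiener v).measurable 1)
    (fun v _ => h.measurable_offspring v) hf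

/-- The normalized sums after and before branching move in one step, up to the heat flow of the test
function, by at most `κ C r^t` in `L¹`. -/
structure HasStepBound (P : Measure Ω) (W : List ℕ → ℝ≥0 → Ω → (Fin d → ℝ)) (Y : List ℕ → Ω → ℕ)
    (m κ r : ℝ) : Prop where
  nonneg : 0 ≤ κ
  pos : 0 < r
  lt_one : r < 1
  after : ∀ (t : ℕ) (f : (Fin d → ℝ) → ℝ), Measurable f → ∀ C : ℝ, 0 ≤ C →
    ∫⁻ w, ‖f (√((t + 1 : ℕ) : ℝ) • w)‖ₑ ^ 2 ∂stdGauss d ≤ ENNReal.ofReal (C ^ 2) →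
    ∫⁻ ω, ‖sumAfter W Y (t + 1) f ω / m ^ (t + 1) - sumAfter W Y t (heatStep f) ω / m ^ t‖ₑ ∂P ≤
      ENNReal.ofReal (κ * C * r ^ t)
  before : ∀ (t : ℕ) (f : (Fin d → ℝ) → ℝ), Measurable f → ∀ C : ℝ, 0 ≤ C →
    ∫⁻ w, ‖f (√((t + 1 : ℕ) : ℝ) • w)‖ₑ ^ 2 ∂stdGauss d ≤ ENNReal.ofReal (C ^ 2) →
    ∫⁻ ω, ‖sumBefore W Y t f ω / m ^ t - sumAfter W Y t (heatStep f) ω / m ^ t‖ₑ ∂P ≤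
      ENNReal.ofReal (κ * C * r ^ t)

/-- The two noises have L² norms at most √m^t C (displacement) and √v √m^t C (offspring, with v the
offspring variance). The displacement noise is multiplied by m in the branching; division by m^(t+1)
gives κ and r. -/
theorem IsModel.hasStepBound [IsProbabilityMeasure P] (h : IsModel P W Y p)
    (hm : HasSum (fun l : ℕ => (l : ℝ) * p l) m) (hm1 : 1 < m)
    (hvar : Summable (fun l : ℕ => ((l : ℝ) - m) ^ 2 * p l)) :
    HasStepBound P W Y m ((√(∑' l : ℕ, ((l : ℝ) - m) ^ 2 * p l) + m) / m) (√m)⁻¹ := by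
  have hm0 : 0 < m := zero_lt_one.trans hm1
  set v := ∑' l : ℕ, ((l : ℝ) - m) ^ 2 * p l with hv
  have hv0 : 0 ≤ v := tsum_nonneg fun l => mul_nonneg (sq_nonneg _) (h.nonneg l)
  have hsm : 0 < √m := Real.sqrt_pos.2 hm0
  have hr : ∀ t : ℕ, √m ^ t / m ^ t = (√m)⁻¹ ^ t := fun t => by
    rw [← div_pow]
    congr 1
    rw [Real.sqrt_div_self', one_div]
  have hB : ∀ (t : ℕ) (f : (Fin d → ℝ) → ℝ), Measurable f → ∀ C : ℝ, 0 ≤ C →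
      ∫⁻ w, ‖f (√((t + 1 : ℕ) : ℝ) • w)‖ₑ ^ 2 ∂stdGauss d ≤ ENNReal.ofReal (C ^ 2) →
      ∫⁻ ω, ‖sumBefore W Y t f ω - sumAfter W Y t (heatStep f) ω‖ₑ ∂P ≤
        ENNReal.ofReal (√m ^ t * C) := by
    intro t f hf C hC hle
    refine lintegral_enorm_le_of_sq_le
      ((h.measurable_sumBefore t hf).sub (h.measurable_sumAfter t (measurable_heatStep hf)))
      (by positivity) ((h.lintegral_sumBefore_sub_le hm t hf).trans ?_)
    calc _ ≤ ENNReal.ofReal m ^ t * ENNReal.ofReal (C ^ 2) := by gcongr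
      _ = ENNReal.ofReal ((√m ^ t * C) ^ 2) := by
        rw [← ENNReal.ofReal_pow hm0.le, ← ENNReal.ofReal_mul (by positivity), mul_pow,
          ← pow_mul, mul_comm t, pow_mul, Real.sq_sqrt hm0.le]
  have hA : ∀ (t : ℕ) (f : (Fin d → ℝ) → ℝ), Measurable f → ∀ C : ℝ, 0 ≤ C →
      ∫⁻ w, ‖f (√((t + 1 : ℕ) : ℝ) • w)‖ₑ ^ 2 ∂stdGauss d ≤ ENNReal.ofReal (C ^ 2) →
      ∫⁻ ω, ‖sumAfter W Y (t + 1) f ω - m * sumBefore W Y t f ω‖ₑ ∂P ≤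
        ENNReal.ofReal (√v * (√m ^ t * C)) := by
    intro t f hf C hC hle
    refine lintegral_enorm_le_of_sq_le
      ((h.measurable_sumAfter (t + 1) hf).sub ((h.measurable_sumBefore t hf).const_mul m))
      (by positivity) ((h.lintegral_sumAfter_succ_sub_le hm hvar t hf).trans ?_)
    calc _ ≤ ENNReal.ofReal v * (ENNReal.ofReal m ^ t * ENNReal.ofReal (C ^ 2)) := by gcongr
      _ = ENNReal.ofReal ((√v * (√m ^ t * C)) ^ 2) := by
        rw [← ENNReal.ofReal_pow hm0.le, ← ENNReal.ofReal_mul (by positivity),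
          ← ENNReal.ofReal_mul hv0, mul_pow, mul_pow,
          ← pow_mul, mul_comm t, pow_mul, Real.sq_sqrt hm0.le, Real.sq_sqrt hv0]
  refine ⟨by positivity, by positivity, ?_, ?_, ?_⟩
  · exact inv_lt_one_of_one_lt₀ (Real.lt_sqrt_of_sq_lt (by simpa using hm1))
  · intro t f hf C hC hle
    have heq : ∀ ω, sumAfter W Y (t + 1) f ω / m ^ (t + 1) - sumAfter W Y t (heatStep f) ω / m ^ t =
        (m ^ (t + 1))⁻¹ * ((sumAfter W Y (t + 1) f ω - m * sumBefore W Y t f ω) +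
          m * (sumBefore W Y t f ω - sumAfter W Y t (heatStep f) ω)) := by
      intro ω
      rw [pow_succ]
      field_simp
      ring
    simp only [heq, enorm_mul]
    rw [lintegral_const_mul' _ _ enorm_ne_top]
    calc _ ≤ ‖(m ^ (t + 1))⁻¹‖ₑ * ∫⁻ ω, (‖sumAfter W Y (t + 1) f ω - m * sumBefore W Y t f ω‖ₑ +
          ‖m‖ₑ * ‖sumBefore W Y t f ω - sumAfter W Y t (heatStep f) ω‖ₑ) ∂P := by
          gcongr with ω
          rw [← enorm_mul]
          exact enorm_add_le _ _
      _ ≤ ENNReal.ofReal (m ^ (t + 1))⁻¹ * (ENNReal.ofReal (√v * (√m ^ t * C)) +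
          ENNReal.ofReal m * ENNReal.ofReal (√m ^ t * C)) := by
          rw [lintegral_add_left (by
            exact ((h.measurable_sumAfter (t + 1) hf).sub
              ((h.measurable_sumBefore t hf).const_mul m)).enorm),
            lintegral_const_mul' _ _ enorm_ne_top, Real.enorm_of_nonneg hm0.le,
            Real.enorm_of_nonneg (by positivity : 0 ≤ (m ^ (t + 1))⁻¹)]
          gcongr
          · exact hA t f hf C hC hle
          · exact hB t f hf C hC hle
      _ = _ := by
          rw [← ENNReal.ofReal_mul hm0.le, ← ENNReal.ofReal_add (by positivity) (by positivity),
            ← ENNReal.ofReal_mul (by positivity), ← hr, pow_succ]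
          congr 1
          field_simp
  · intro t f hf C hC hle
    have heq : ∀ ω, sumBefore W Y t f ω / m ^ t - sumAfter W Y t (heatStep f) ω / m ^ t =
        (m ^ t)⁻¹ * (sumBefore W Y t f ω - sumAfter W Y t (heatStep f) ω) := by
      intro ω
      field_simp
    simp only [heq, enorm_mul]
    rw [lintegral_const_mul' _ _ enorm_ne_top, Real.enorm_of_nonneg (by positivity : 0 ≤ (m ^ t)⁻¹)]
    refine (mul_le_mul_right (hB t f hf C hC hle) _).trans ?_
    rw [← ENNReal.ofReal_mul (by positivity)]
    refine ENNReal.ofReal_le_ofReal ?_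
    rw [← hr]
    calc (m ^ t)⁻¹ * (√m ^ t * C) = 1 * C * (√m ^ t / m ^ t) := by field_simp
      -- Displacement alone would need only the constant 1 ≤ κ; a common κ is kept for both bounds.
      _ ≤ (√v + m) / m * C * (√m ^ t / m ^ t) := by
        gcongr
        rw [one_le_div hm0]
        linarith [Real.sqrt_nonneg v]

theorem lintegral_enorm_sub_le_add {g₁ g₂ g₃ : Ω → ℝ} (h₁ : Measurable g₁) (h₂ : Measurable g₂)
    {a b : ℝ} (ha : 0 ≤ a) (hb : 0 ≤ b) (h12 : ∫⁻ ω, ‖g₁ ω - g₂ ω‖ₑ ∂P ≤ ENNReal.ofReal a)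
    (h23 : ∫⁻ ω, ‖g₂ ω - g₃ ω‖ₑ ∂P ≤ ENNReal.ofReal b) :
    ∫⁻ ω, ‖g₁ ω - g₃ ω‖ₑ ∂P ≤ ENNReal.ofReal (a + b) := by
  rw [ENNReal.ofReal_add ha hb]
  calc _ ≤ ∫⁻ ω, (‖g₁ ω - g₂ ω‖ₑ + ‖g₂ ω - g₃ ω‖ₑ) ∂P := by
        refine lintegral_mono fun ω => ?_
        rw [show g₁ ω - g₃ ω = (g₁ ω - g₂ ω) + (g₂ ω - g₃ ω) by ring]
        exact enorm_add_le _ _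
    _ = ∫⁻ ω, ‖g₁ ω - g₂ ω‖ₑ ∂P + ∫⁻ ω, ‖g₂ ω - g₃ ω‖ₑ ∂P :=
        lintegral_add_left (h₁.sub h₂).enorm _
    _ ≤ _ := add_le_add h12 h23

theorem heatStep_heatIndicator {A : Set (Fin d → ℝ)} (hA : MeasurableSet A) (n : ℕ) :
    heatStep (heatIndicator A n) = heatIndicator A (n + 1) :=
  funext fun x => integral_heatIndicator_add hA n x

theorem lintegral_heatIndicator_sq_le (A : Set (Fin d → ℝ)) (n : ℕ) (c : ℝ) :
    ∫⁻ w, ‖heatIndicator A n (c • w)‖ₑ ^ 2 ∂stdGauss d ≤ ENNReal.ofReal (1 ^ 2) := by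
  calc _ ≤ ∫⁻ _w : Fin d → ℝ, 1 ∂stdGauss d := by
        refine lintegral_mono fun w => pow_le_one₀ zero_le ?_
        rw [← ofReal_norm, Real.norm_eq_abs]
        exact ENNReal.ofReal_le_one.2 (abs_heatIndicator_le A n _)
    _ = _ := by simp

/-- Going back one generation trades a unit of time for one heat step. The test functions stay
bounded by 1, so every step costs only κ r^(s+i). -/
theorem HasStepBound.lintegral_after_telescope (hb : HasStepBound P W Y m κ r) (h : IsModel P W Y p)
    {A : Set (Fin d → ℝ)} (hA : MeasurableSet A) (s n j : ℕ) :
    ∫⁻ ω, ‖sumAfter W Y (s + n) (heatIndicator A j) ω / m ^ (s + n) -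
        sumAfter W Y s (heatIndicator A (n + j)) ω / m ^ s‖ₑ ∂P ≤
      ENNReal.ofReal (∑ i ∈ Finset.range n, κ * r ^ (s + i)) := by
  have hk := hb.nonneg
  have hr := hb.pos.le
  induction n generalizing j with
  | zero => simp
  | succ n ih =>
    rw [Finset.sum_range_succ, add_comm (∑ i ∈ Finset.range n, κ * r ^ (s + i))]
    refine lintegral_enorm_sub_le_add
      (g₂ := fun ω => sumAfter W Y (s + n) (heatIndicator A (j + 1)) ω / m ^ (s + n))
      ((h.measurable_sumAfter _ (measurable_heatIndicator hA _)).div_const _)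
      ((h.measurable_sumAfter _ (measurable_heatIndicator hA _)).div_const _)
      (by positivity) (Finset.sum_nonneg fun i _ => by positivity) ?_ ?_
    · have := hb.after (s + n) _ (measurable_heatIndicator hA j) 1 zero_le_one
        (lintegral_heatIndicator_sq_le A j _)
      rw [heatStep_heatIndicator hA, mul_one] at this
      exact this
    · have := ih (j + 1)
      rw [show n + (j + 1) = n + 1 + j by ring] at this
      exact this

theorem HasStepBound.sum_le (hb : HasStepBound P W Y m κ r) (s n : ℕ) :
    ∑ i ∈ Finset.range n, κ * r ^ (s + i) ≤ κ * (1 - r)⁻¹ * r ^ s := by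
  have h1 : ∑ i ∈ Finset.range n, r ^ i ≤ (1 - r)⁻¹ := by
    rw [← tsum_geometric_of_lt_one hb.pos.le hb.lt_one]
    exact (summable_geometric_of_lt_one hb.pos.le hb.lt_one).sum_le_tsum _
      fun i _ => pow_nonneg hb.pos.le i
  calc _ = κ * r ^ s * ∑ i ∈ Finset.range n, r ^ i := by
        rw [Finset.mul_sum]
        exact Finset.sum_congr rfl fun i _ => by rw [pow_add]; ring
    _ ≤ κ * r ^ s * (1 - r)⁻¹ :=
        mul_le_mul_of_nonneg_left h1 (mul_nonneg hb.nonneg (pow_nonneg hb.pos.le s))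
    _ = _ := by ring

theorem HasStepBound.lintegral_after_indicator_sub_le (hb : HasStepBound P W Y m κ r)
    (h : IsModel P W Y p) {A : Set (Fin d → ℝ)} (hA : MeasurableSet A) (s n : ℕ) :
    ∫⁻ ω, ‖sumAfter W Y (s + n) (heatIndicator A 0) ω / m ^ (s + n) -
        sumAfter W Y s (heatIndicator A n) ω / m ^ s‖ₑ ∂P ≤
      ENNReal.ofReal (κ * (1 - r)⁻¹ * r ^ s) :=
  (hb.lintegral_after_telescope h hA s n 0).trans (ENNReal.ofReal_le_ofReal (hb.sum_le s n))

theorem HasStepBound.lintegral_before_indicator_sub_le (hb : HasStepBound P W Y m κ r)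
    (h : IsModel P W Y p) {A : Set (Fin d → ℝ)} (hA : MeasurableSet A) (s n : ℕ) :
    ∫⁻ ω, ‖sumBefore W Y (s + n) (heatIndicator A 0) ω / m ^ (s + n) -
        sumAfter W Y s (heatIndicator A (n + 1)) ω / m ^ s‖ₑ ∂P ≤
      ENNReal.ofReal (κ * (1 - r)⁻¹ * r ^ s) := by
  have hk := hb.nonneg
  have hr := hb.pos.le
  refine le_trans ?_ (ENNReal.ofReal_le_ofReal (hb.sum_le s (n + 1)))
  rw [Finset.sum_range_succ, add_comm (∑ i ∈ Finset.range n, κ * r ^ (s + i))]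
  refine lintegral_enorm_sub_le_add
    (g₂ := fun ω => sumAfter W Y (s + n) (heatIndicator A 1) ω / m ^ (s + n))
    ((h.measurable_sumBefore _ (measurable_heatIndicator hA _)).div_const _)
    ((h.measurable_sumAfter _ (measurable_heatIndicator hA _)).div_const _)
    (by positivity) (Finset.sum_nonneg fun i _ => by positivity) ?_
    (hb.lintegral_after_telescope h hA s n 1)
  have := hb.before (s + n) _ (measurable_heatIndicator hA 0) 1 zero_le_one
    (lintegral_heatIndicator_sq_le A 0 _)
  rw [heatStep_heatIndicator hA, mul_one] at this
  exact this

theorem heatStep_hermiteMulti (α : Fin d → ℕ) (t : ℕ) :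
    heatStep (fun x => hermiteMulti α x ((t + 1 : ℕ) : ℝ)) = fun x => hermiteMulti α x t := by
  funext x
  push_cast
  exact integral_hermiteMulti_add α x t

theorem measurable_hermiteMulti (α : Fin d → ℕ) (t : ℝ) : Measurable fun x => hermiteMulti α x t :=
  (continuous_hermiteMulti α t).measurable

/-- The true norm grows like (t+1)^(|α|/2); since t + 1 ≥ 1, the larger integer power |α| is used to
avoid half-integers. -/
theorem exists_lintegral_hermiteMulti_sq_le' (α : Fin d → ℕ) : ∃ C : ℝ, 0 ≤ C ∧ ∀ t : ℕ,
    ∫⁻ w, ‖hermiteMulti α (√((t + 1 : ℕ) : ℝ) • w) (t + 1 : ℕ)‖ₑ ^ 2 ∂stdGauss d ≤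
      ENNReal.ofReal ((C * ((t + 1 : ℕ) : ℝ) ^ (∑ i, α i)) ^ 2) := by
  obtain ⟨C, hC⟩ := exists_lintegral_hermiteMulti_sq_le α
  refine ⟨√C, Real.sqrt_nonneg _, fun t => (hC (t + 1)).trans ?_⟩
  rw [mul_pow, Real.sq_sqrt (NNReal.coe_nonneg C), ENNReal.ofReal_mul (NNReal.coe_nonneg C),
    ENNReal.ofReal_coe_nnreal,
    ← pow_mul, ENNReal.ofReal_pow (Nat.cast_nonneg _), ENNReal.ofReal_natCast]
  gcongr
  · exact_mod_cast Nat.le_add_left 1 t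
  · omega

/-- The L¹ norm of an increment is polynomial times r^t, so any further polynomial weight is
harmless. This yields both the limits N_α and the rate of convergence. -/
theorem HasStepBound.ae_summable_hermite_increments (hb : HasStepBound P W Y m κ r)
    (h : IsModel P W Y p) (α : Fin d → ℕ) : ∀ᵐ ω ∂P, ∀ j : ℕ, Summable fun t : ℕ =>
      ((t + 1 : ℕ) : ℝ) ^ j *
        |sumAfter W Y (t + 1) (fun x => hermiteMulti α x (t + 1 : ℕ)) ω / m ^ (t + 1) -
          sumAfter W Y t (fun x => hermiteMulti α x t) ω / m ^ t| := by
  rw [ae_all_iff]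
  intro j
  have hk := hb.nonneg
  have hr := hb.pos.le
  obtain ⟨C, hC0, hC⟩ := exists_lintegral_hermiteMulti_sq_le' α
  have := ae_summable_abs_of_lintegral_le (μ := P) (g := fun t ω => ((t + 1 : ℕ) : ℝ) ^ j *
    (sumAfter W Y (t + 1) (fun x => hermiteMulti α x (t + 1 : ℕ)) ω / m ^ (t + 1) -
          sumAfter W Y t (fun x => hermiteMulti α x t) ω / m ^ t))
    (b := fun t => κ * C * (((t + 1 : ℕ) : ℝ) ^ (j + ∑ i, α i) * r ^ t))
    (fun t => (((h.measurable_sumAfter _ (measurable_hermiteMulti α _)).div_const _).sub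
      ((h.measurable_sumAfter _ (measurable_hermiteMulti α _)).div_const _)).const_mul _)
    ((summable_succ_pow_mul_geometric _ hb.pos hb.lt_one).mul_left _)
    (fun t => by positivity) ?_
  · filter_upwards [this] with ω hω
    refine hω.congr fun t => ?_
    rw [abs_mul, abs_of_nonneg (by positivity : 0 ≤ ((t + 1 : ℕ) : ℝ) ^ j)]
  · intro t
    simp only [enorm_mul]
    rw [lintegral_const_mul' _ _ enorm_ne_top, Real.enorm_of_nonneg (by positivity)]
    have h1 := hb.after t _ (measurable_hermiteMulti α _) _ (by positivity) (hC t)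
    rw [heatStep_hermiteMulti] at h1
    refine (mul_le_mul_right h1 _).trans (le_of_eq ?_)
    rw [← ENNReal.ofReal_mul (by positivity)]
    congr 1
    ring

theorem HasStepBound.ae_tendsto_before_sub_after (hb : HasStepBound P W Y m κ r)
    (h : IsModel P W Y p) (α : Fin d → ℕ) : ∀ᵐ ω ∂P, Tendsto (fun t : ℕ =>
      sumBefore W Y t (fun x => hermiteMulti α x (t + 1 : ℕ)) ω / m ^ t -
        sumAfter W Y t (fun x => hermiteMulti α x t) ω / m ^ t) atTop (𝓝 0) := by
  have hk := hb.nonneg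
  have hr := hb.pos.le
  obtain ⟨C, hC0, hC⟩ := exists_lintegral_hermiteMulti_sq_le' α
  refine ae_tendsto_zero_of_lintegral_le
    (b := fun t => κ * C * (((t + 1 : ℕ) : ℝ) ^ (∑ i, α i) * r ^ t))
    (fun t => ((h.measurable_sumBefore _ (measurable_hermiteMulti α _)).div_const _).sub
      ((h.measurable_sumAfter _ (measurable_hermiteMulti α _)).div_const _))
    ((summable_succ_pow_mul_geometric _ hb.pos hb.lt_one).mul_left _)
    (fun t => by positivity) (Eventually.of_forall fun t => ?_)
  have h1 := hb.before t _ (measurable_hermiteMulti α _) _ (by positivity) (hC t)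
  rw [heatStep_hermiteMulti] at h1
  refine h1.trans (le_of_eq ?_)
  congr 1
  ring

end NormalizedEstimates

/-! ### Linearity and stability of the expansion -/

section Expansion

variable {d : ℕ}

/-- The coefficient of `(-T)^{-n}` in the expansion. -/
def expansionCoeff (N : (Fin d → ℕ) → ℝ) (A : Set (Fin d → ℝ)) (n : ℕ) : ℝ :=
  (1 / 2 ^ n) * ∑ α ∈ Finset.piAntidiag (Finset.univ : Finset (Fin d)) n,
    (1 / ∏ i, ((α i).factorial : ℝ)) * ∑ β ∈ Finset.Iic (2 • α),
      ((∏ i, ((2 * α i).choose (β i) : ℝ)) * (-1) ^ (∑ i, β i) * moment β A * N (2 • α - β))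

theorem expansion_eq_sum_coeff (N : (Fin d → ℕ) → ℝ) (A : Set (Fin d → ℝ)) (k : ℕ) (T : ℝ) :
    expansion N A k T = ∑ n ∈ Finset.range (k + 1), ((-T) ^ n)⁻¹ * expansionCoeff N A n := by
  refine Finset.sum_congr rfl fun n _ => ?_
  rw [expansionCoeff]
  ring

theorem expansionCoeff_add (N N' : (Fin d → ℕ) → ℝ) (A : Set (Fin d → ℝ)) (n : ℕ) :
    expansionCoeff (fun α => N α + N' α) A n = expansionCoeff N A n + expansionCoeff N' A n := by
  simp only [expansionCoeff, mul_add, Finset.sum_add_distrib]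

theorem expansionCoeff_const_mul (c : ℝ) (N : (Fin d → ℕ) → ℝ) (A : Set (Fin d → ℝ)) (n : ℕ) :
    expansionCoeff (fun α => c * N α) A n = c * expansionCoeff N A n := by
  simp only [expansionCoeff, Finset.mul_sum]
  exact Finset.sum_congr rfl fun α _ => Finset.sum_congr rfl fun β _ => by ring

theorem expansion_add (N N' : (Fin d → ℕ) → ℝ) (A : Set (Fin d → ℝ)) (k : ℕ) (T : ℝ) :
    expansion (fun α => N α + N' α) A k T = expansion N A k T + expansion N' A k T := by
  simp only [expansion_eq_sum_coeff, expansionCoeff_add, mul_add, Finset.sum_add_distrib]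

theorem expansion_const_mul (c : ℝ) (N : (Fin d → ℕ) → ℝ) (A : Set (Fin d → ℝ)) (k : ℕ) (T : ℝ) :
    expansion (fun α => c * N α) A k T = c * expansion N A k T := by
  simp only [expansion_eq_sum_coeff, expansionCoeff_const_mul, Finset.mul_sum]
  exact Finset.sum_congr rfl fun n _ => by ring

theorem expansion_sum {ι : Type*} (F : Finset ι) (N : ι → (Fin d → ℕ) → ℝ) (A : Set (Fin d → ℝ))
    (k : ℕ) (T : ℝ) :
    expansion (fun α => ∑ u ∈ F, N u α) A k T = ∑ u ∈ F, expansion (N u) A k T := by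
  classical
  induction F using Finset.induction_on with
  | empty => simpa using expansion_const_mul 0 (fun _ => 0) A k T
  | insert u F hu ih =>
    simp only [Finset.sum_insert hu]
    rw [expansion_add, ih]

theorem measurable_expansion {Ω : Type*} {mΩ : MeasurableSpace Ω} {N : (Fin d → ℕ) → Ω → ℝ}
    (hN : ∀ α, Measurable (N α)) (A : Set (Fin d → ℝ)) (k : ℕ) (T : ℝ) :
    Measurable fun ω => expansion (fun α => N α ω) A k T := by
  unfold expansion
  exact Finset.measurable_sum _ fun n _ => (Finset.measurable_sum _ fun α _ =>
    (Finset.measurable_sum _ fun β _ => (hN _).const_mul _).const_mul _).const_mul _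

theorem tendsto_expansionCoeff_zero {ι : Type*} {l : Filter ι} {N : ι → (Fin d → ℕ) → ℝ}
    (hN : ∀ α, Tendsto (fun i => N i α) l (𝓝 0)) (A : Set (Fin d → ℝ)) (n : ℕ) :
    Tendsto (fun i => expansionCoeff (N i) A n) l (𝓝 0) := by
  have h0 : expansionCoeff (fun _ => (0 : ℝ)) A n = 0 := by
    simpa using expansionCoeff_const_mul 0 (fun _ => 0) A n
  rw [← h0]
  unfold expansionCoeff
  exact (tendsto_finsetSum _ fun α _ => (tendsto_finsetSum _ fun β _ =>
    (hN _).const_mul _).const_mul _).const_mul _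

theorem tendsto_pow_mul_neg_pow_inv {k n : ℕ} (h : k < n) :
    Tendsto (fun T : ℕ => (T : ℝ) ^ k * ((-(T : ℝ)) ^ n)⁻¹) atTop (𝓝 0) := by
  rw [tendsto_zero_iff_abs_tendsto_zero]
  refine ((tendsto_pow_div_pow_atTop_zero h).comp tendsto_natCast_atTop_atTop).congr fun T => ?_
  simp only [Function.comp_apply]
  rw [abs_mul, abs_inv, abs_pow, abs_pow, abs_neg, Nat.abs_cast, div_eq_mul_inv]

theorem exists_tendsto_neg_pow_inv (n : ℕ) :
    ∃ l, Tendsto (fun T : ℕ => ((-(T : ℝ)) ^ n)⁻¹) atTop (𝓝 l) := by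
  rcases Nat.eq_zero_or_pos n with rfl | hn
  · exact ⟨1, by simp⟩
  · exact ⟨0, by simpa using tendsto_pow_mul_neg_pow_inv hn⟩

/-- Two errors: by linearity the factor T^k passes to the coefficients M - N, against bounded powers
of 1/T; the surplus terms with k < n ≤ K are O(T^(-n)). -/
theorem tendsto_pow_mul_expansion_sub {M : ℕ → (Fin d → ℕ) → ℝ} {N : (Fin d → ℕ) → ℝ} {k K : ℕ}
    (hkK : k ≤ K) (hM : ∀ α, Tendsto (fun T : ℕ => (T : ℝ) ^ k * (M T α - N α)) atTop (𝓝 0))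
    (A : Set (Fin d → ℝ)) :
    Tendsto (fun T : ℕ => (T : ℝ) ^ k * (expansion (M T) A K T - expansion N A k T)) atTop (𝓝 0) := by
  have h1 : Tendsto (fun T : ℕ => ∑ n ∈ Finset.range (K + 1), ((-(T : ℝ)) ^ n)⁻¹ *
      expansionCoeff (fun α => (T : ℝ) ^ k * (M T α - N α)) A n) atTop (𝓝 0) := by
    rw [← Finset.sum_const_zero (s := Finset.range (K + 1))]
    refine tendsto_finsetSum _ fun n _ => ?_
    obtain ⟨l, hl⟩ := exists_tendsto_neg_pow_inv n
    simpa using hl.mul (tendsto_expansionCoeff_zero hM A n)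
  have h2 : Tendsto (fun T : ℕ => ∑ n ∈ Finset.Ico (k + 1) (K + 1),
      (T : ℝ) ^ k * ((-(T : ℝ)) ^ n)⁻¹ * expansionCoeff N A n) atTop (𝓝 0) := by
    rw [← Finset.sum_const_zero (s := Finset.Ico (k + 1) (K + 1))]
    refine tendsto_finsetSum _ fun n hn => ?_
    simpa using (tendsto_pow_mul_neg_pow_inv (Finset.mem_Ico.1 hn).1).mul_const
      (expansionCoeff N A n)
  refine (by simpa using h1.add h2 : Tendsto _ _ (𝓝 (0 : ℝ))).congr fun T => ?_
  have h3 : ∀ n, expansionCoeff (fun α => (T : ℝ) ^ k * (M T α - N α)) A n =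
      (T : ℝ) ^ k * (expansionCoeff (M T) A n - expansionCoeff N A n) := by
    intro n
    rw [expansionCoeff_const_mul]
    have := expansionCoeff_add (fun α => M T α - N α) N A n
    simp only [sub_add_cancel] at this
    rw [this]
    ring
  simp only [h3]
  rw [expansion_eq_sum_coeff, expansion_eq_sum_coeff,
    Finset.sum_Ico_eq_sub _ (by omega : k + 1 ≤ K + 1)]
  simp only [mul_sub, Finset.mul_sum, Finset.sum_sub_distrib]
  have h4 : ∀ n (c : ℝ), ((-(T : ℝ)) ^ n)⁻¹ * ((T : ℝ) ^ k * c) =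
      (T : ℝ) ^ k * (((-(T : ℝ)) ^ n)⁻¹ * c) := fun n c => by ring
  simp only [h4, mul_assoc]
  ring

end Expansion

/-! ### Assembling the three errors along s = √T -/

section Asymptotics

variable {Ω : Type*} {mΩ : MeasurableSpace Ω} {P : Measure Ω} {d : ℕ}
  {W : List ℕ → ℝ≥0 → Ω → (Fin d → ℝ)} {Y : List ℕ → Ω → ℕ} {p : ℕ → ℝ} {m κ r : ℝ}

theorem expansion_sumAfter (A : Set (Fin d → ℝ)) (K : ℕ) (T : ℝ) (s : ℕ) (c : ℝ) (ω : Ω) :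
    expansion (fun α => sumAfter W Y s (fun x => hermiteMulti α x s) ω / c) A K T =
      sumAfter W Y s (fun x => expansion (fun α => hermiteMulti α x s) A K T) ω / c := by
  simp only [sumAfter, ← expansion_sum, div_eq_inv_mul, expansion_const_mul]

theorem rpow_half_le_pow {T : ℕ} (hT : 1 ≤ T) :
    (2 * Real.pi * T) ^ ((d : ℝ) / 2) ≤ (2 * Real.pi) ^ d * (T : ℝ) ^ d := by
  have hT' : (1 : ℝ) ≤ T := by exact_mod_cast hT
  have h1 : (1 : ℝ) ≤ 2 * Real.pi * T := by nlinarith [Real.pi_gt_three]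
  rw [← mul_pow, ← Real.rpow_natCast]
  refine Real.rpow_le_rpow_of_exponent_le h1 ?_
  have : (0 : ℝ) ≤ d := Nat.cast_nonneg d
  linarith

/-- As T ≤ (√T + 1)² with the integer root, a power of T is a power of √T + 1, which the geometric
factor dominates. -/
theorem exists_pow_mul_geometric_sqrt_le (q : ℕ) (hr0 : 0 < r) (hr1 : r < 1) : ∃ C : ℝ, 0 ≤ C ∧
    ∀ T : ℕ, 1 ≤ T → (T : ℝ) ^ q * r ^ Nat.sqrt T ≤ C * ((T : ℝ) ^ 2)⁻¹ := by
  obtain ⟨C, hC0, hC⟩ := exists_succ_pow_mul_geometric_le (2 * (q + 2)) hr0 hr1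
  refine ⟨C, hC0, fun T hT => ?_⟩
  have hT' : (0 : ℝ) < T := by exact_mod_cast hT
  rw [← div_eq_mul_inv, le_div_iff₀ (by positivity)]
  calc (T : ℝ) ^ q * r ^ Nat.sqrt T * (T : ℝ) ^ 2 = (T : ℝ) ^ (q + 2) * r ^ Nat.sqrt T := by ring
    _ ≤ (((Nat.sqrt T + 1 : ℕ) : ℝ) ^ 2) ^ (q + 2) * r ^ Nat.sqrt T := by
        gcongr
        exact natCast_le_sqrt_succ_sq T
    _ ≤ C := by
        rw [← pow_mul]
        exact hC _

/-- From s² ≤ T follows (s/T)² ≤ 1/T, and 2k + 4 = 2(k + 2). The order 2k + 3 of the Taylor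
polynomial is chosen so that two powers of 1/T remain for summability. -/
theorem pow_mul_sqrt_div_pow_le (k : ℕ) {T : ℕ} (hT : 1 ≤ T) :
    (T : ℝ) ^ k * ((Nat.sqrt T : ℝ) / T) ^ (2 * k + 3 + 1) ≤ ((T : ℝ) ^ 2)⁻¹ := by
  have hT' : (0 : ℝ) < T := by exact_mod_cast hT
  have hs : ((Nat.sqrt T : ℝ)) ^ 2 ≤ T := by exact_mod_cast Nat.sqrt_le' T
  have h1 : ((Nat.sqrt T : ℝ) / T) ^ 2 ≤ (T : ℝ)⁻¹ := by
    rw [div_pow, div_le_iff₀ (by positivity)]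
    calc _ ≤ (T : ℝ) := hs
      _ = _ := by field_simp
  calc (T : ℝ) ^ k * ((Nat.sqrt T : ℝ) / T) ^ (2 * k + 3 + 1)
      = (T : ℝ) ^ k * (((Nat.sqrt T : ℝ) / T) ^ 2) ^ (k + 2) := by
        rw [← pow_mul]
        ring_nf
    _ ≤ (T : ℝ) ^ k * ((T : ℝ)⁻¹) ^ (k + 2) := by gcongr
    _ = _ := by
        rw [pow_add, inv_pow, inv_pow]
        field_simp

/-- Provides the condition 8s ≤ s + n of the kernel estimate for n = T - s. -/
theorem eight_mul_sqrt_le {T : ℕ} (hT : 64 ≤ T) : 8 * Nat.sqrt T ≤ T :=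
  (Nat.mul_le_mul_right _ (Nat.le_sqrt.2 (by omega : 8 * 8 ≤ T))).trans (Nat.sqrt_le T)

theorem HasStepBound.ae_tendsto_count_sub_heat (hb : HasStepBound P W Y m κ r) (h : IsModel P W Y p)
    {A : Set (Fin d → ℝ)} (hA : MeasurableSet A) {U : ℕ → Ω → ℝ} (hU : ∀ T, Measurable (U T))
    {C₀ : ℝ} (hC₀ : 0 ≤ C₀) (hUb : ∀ s n : ℕ, ∫⁻ ω, ‖U (s + n + 1) ω -
      sumAfter W Y s (heatIndicator A (n + 1)) ω / m ^ s‖ₑ ∂P ≤ ENNReal.ofReal (C₀ * r ^ s)) (k : ℕ) :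
    ∀ᵐ ω ∂P, Tendsto (fun T : ℕ => (T : ℝ) ^ k * ((2 * Real.pi * T) ^ ((d : ℝ) / 2) *
    (U T ω - sumAfter W Y (Nat.sqrt T) (heatIndicator A (T - Nat.sqrt T)) ω / m ^ Nat.sqrt T)))
    atTop (𝓝 0) := by
  have hr := hb.pos.le
  have hsq : Summable fun T : ℕ => ((T : ℝ) ^ 2)⁻¹ := Real.summable_nat_pow_inv.2 one_lt_two
  have hmeasA : ∀ s n, Measurable fun ω => sumAfter W Y s (heatIndicator A n) ω / m ^ s := fun s n =>
    (h.measurable_sumAfter s (measurable_heatIndicator hA n)).div_const _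
  obtain ⟨C, hC0, hC⟩ := exists_pow_mul_geometric_sqrt_le (k + d) hb.pos hb.lt_one
  refine ae_tendsto_zero_of_lintegral_le (b := fun T => (2 * Real.pi) ^ d * C₀ * C * ((T : ℝ) ^ 2)⁻¹)
    (fun T => (((hU T).sub (hmeasA _ _)).const_mul _).const_mul _) (hsq.mul_left _)
    (fun T => by positivity) ?_
  filter_upwards [eventually_ge_atTop 64] with T hT
  have hs := eight_mul_sqrt_le hT
  have hT1 : 1 ≤ T := by omega
  have hs1 : 1 ≤ Nat.sqrt T := Nat.le_sqrt.2 (by omega)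
  simp only [enorm_mul]
  rw [lintegral_const_mul' _ _ enorm_ne_top, lintegral_const_mul' _ _ enorm_ne_top,
    Real.enorm_of_nonneg (by positivity : (0 : ℝ) ≤ (T : ℝ) ^ k),
    Real.enorm_of_nonneg (by positivity : (0 : ℝ) ≤ (2 * Real.pi * T) ^ ((d : ℝ) / 2))]
  have h1 := hUb (Nat.sqrt T) (T - Nat.sqrt T - 1)
  rw [show Nat.sqrt T + (T - Nat.sqrt T - 1) + 1 = T by omega,
    show T - Nat.sqrt T - 1 + 1 = T - Nat.sqrt T by omega] at h1
  calc _ ≤ ENNReal.ofReal ((T : ℝ) ^ k) * (ENNReal.ofReal ((2 * Real.pi * T) ^ ((d : ℝ) / 2)) *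
        ENNReal.ofReal (C₀ * r ^ Nat.sqrt T)) := by gcongr
    _ = ENNReal.ofReal ((T : ℝ) ^ k * ((2 * Real.pi * T) ^ ((d : ℝ) / 2) *
        (C₀ * r ^ Nat.sqrt T))) := by
      rw [← ENNReal.ofReal_mul (by positivity), ← ENNReal.ofReal_mul (by positivity)]
    _ ≤ _ := by
      refine ENNReal.ofReal_le_ofReal ?_
      calc _ ≤ (T : ℝ) ^ k * (((2 * Real.pi) ^ d * (T : ℝ) ^ d) * (C₀ * r ^ Nat.sqrt T)) := by
            gcongr
            exact rpow_half_le_pow hT1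
        _ = (2 * Real.pi) ^ d * C₀ * ((T : ℝ) ^ (k + d) * r ^ Nat.sqrt T) := by ring
        _ ≤ (2 * Real.pi) ^ d * C₀ * (C * ((T : ℝ) ^ 2)⁻¹) :=
            mul_le_mul_of_nonneg_left (hC T hT1) (by positivity)
        _ = _ := by ring

variable [IsProbabilityMeasure P]

theorem IsModel.lintegral_enorm_sumAfter_le (h : IsModel P W Y p)
    (hm : HasSum (fun l : ℕ => (l : ℝ) * p l) m) (t : ℕ) {f : (Fin d → ℝ) → ℝ} (hf : Measurable f) :
    ∫⁻ ω, ‖sumAfter W Y t f ω‖ₑ ∂P ≤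
      ENNReal.ofReal m ^ t * ∫⁻ w, ‖f (√(t : ℝ) • w)‖ₑ ∂stdGauss d := by
  rw [← h.lintegral_sum_birthPlace hm t hf.enorm]
  exact lintegral_mono fun ω => enorm_sum_le _ _

theorem IsModel.lintegral_enorm_sumBefore_le (h : IsModel P W Y p)
    (hm : HasSum (fun l : ℕ => (l : ℝ) * p l) m) (t : ℕ) {f : (Fin d → ℝ) → ℝ} (hf : Measurable f) :
    ∫⁻ ω, ‖sumBefore W Y t f ω‖ₑ ∂P ≤
      ENNReal.ofReal m ^ t * ∫⁻ w, ‖f (√((t + 1 : ℕ) : ℝ) • w)‖ₑ ∂stdGauss d := by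
  rw [← h.lintegral_sum_deathPlace_eq hm t hf.enorm]
  exact lintegral_mono fun ω => enorm_sum_le _ _

/-- Many-to-one puts the particle at √s G, where the weight exp(|x|²/(4s)) becomes exp(|G|²/4): its
mean does not depend on s. -/
theorem IsModel.exists_lintegral_heat_sub_expansion_le (h : IsModel P W Y p)
    (hm : HasSum (fun l : ℕ => (l : ℝ) * p l) m) (hm1 : 1 < m) {A : Set (Fin d → ℝ)}
    (hA : MeasurableSet A) (hb : Bornology.IsBounded A) (K : ℕ) : ∃ C : ℝ, 0 ≤ C ∧
    ∀ s n : ℕ, 1 ≤ s → 8 * s ≤ s + n →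
    ∫⁻ ω, ‖(2 * Real.pi * (s + n : ℕ)) ^ ((d : ℝ) / 2) * (sumAfter W Y s (heatIndicator A n) ω / m ^ s) -
      expansion (fun α => sumAfter W Y s (fun x => hermiteMulti α x s) ω / m ^ s) A K (s + n : ℕ)‖ₑ ∂P ≤
      ENNReal.ofReal (C * ((s : ℝ) / (s + n : ℕ)) ^ (K + 1)) := by
  have hm0 : 0 < m := zero_lt_one.trans hm1
  obtain ⟨C, hC, hbound⟩ := exists_heatIndicator_sub_expansion_le hA hb K
  have hG : 0 ≤ ∫ g, Real.exp ((∑ i, g i ^ 2) / 4) ∂stdGauss d :=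
    integral_nonneg fun g => (Real.exp_pos _).le
  refine ⟨C * ∫ g, Real.exp ((∑ i, g i ^ 2) / 4) ∂stdGauss d, by positivity, fun s n hs hsn => ?_⟩
  have hs0 : (0 : ℝ) < s := by exact_mod_cast hs
  set c := (2 * Real.pi * (s + n : ℕ)) ^ ((d : ℝ) / 2) with hc
  set f : (Fin d → ℝ) → ℝ := fun x => c * heatIndicator A n x -
    expansion (fun α => hermiteMulti α x s) A K (s + n : ℕ) with hf
  have hfm : Measurable f := ((measurable_heatIndicator hA n).const_mul c).sub
    (measurable_expansion (fun α => measurable_hermiteMulti α s) A K _)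
  have heq : ∀ ω, c * (sumAfter W Y s (heatIndicator A n) ω / m ^ s) -
      expansion (fun α => sumAfter W Y s (fun x => hermiteMulti α x s) ω / m ^ s) A K (s + n : ℕ) =
      (m ^ s)⁻¹ * sumAfter W Y s f ω := by
    intro ω
    rw [expansion_sumAfter]
    simp only [sumAfter, hf, Finset.sum_sub_distrib, ← Finset.mul_sum]
    ring
  simp only [heq, enorm_mul]
  rw [lintegral_const_mul' _ _ enorm_ne_top, Real.enorm_of_nonneg (by positivity)]
  have hpt : ∀ w : Fin d → ℝ, ‖f (√(s : ℝ) • w)‖ₑ ≤ ENNReal.ofReal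
      (C * ((s : ℝ) / (s + n : ℕ)) ^ (K + 1) * Real.exp ((∑ i, w i ^ 2) / 4)) := by
    intro w
    rw [← ofReal_norm, Real.norm_eq_abs]
    refine ENNReal.ofReal_le_ofReal ((hbound s n hs hsn _).trans (le_of_eq ?_))
    congr 2
    simp only [Pi.smul_apply, smul_eq_mul, mul_pow, Real.sq_sqrt hs0.le, ← Finset.mul_sum]
    field_simp
  calc _ ≤ ENNReal.ofReal (m ^ s)⁻¹ * (ENNReal.ofReal m ^ s * ∫⁻ w, ENNReal.ofReal
        (C * ((s : ℝ) / (s + n : ℕ)) ^ (K + 1) * Real.exp ((∑ i, w i ^ 2) / 4)) ∂stdGauss d) := by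
        gcongr
        exact (h.lintegral_enorm_sumAfter_le hm s hfm).trans
          (mul_le_mul_right (lintegral_mono hpt) _)
    _ = _ := by
        rw [← ofReal_integral_eq_lintegral_ofReal (integrable_exp_sum_sq_div_four.const_mul _)
          (Eventually.of_forall fun w => by positivity), integral_const_mul,
          ← ENNReal.ofReal_pow hm0.le, ← ENNReal.ofReal_mul (by positivity),
          ← ENNReal.ofReal_mul (by positivity)]
        congr 1
        field_simp

theorem IsModel.ae_tendsto_heat_sub_expansion (h : IsModel P W Y p)
    (hm : HasSum (fun l : ℕ => (l : ℝ) * p l) m) (hm1 : 1 < m) {A : Set (Fin d → ℝ)}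
    (hA : MeasurableSet A) (hbd : Bornology.IsBounded A) (k : ℕ) :
    ∀ᵐ ω ∂P, Tendsto (fun T : ℕ => (T : ℝ) ^ k * ((2 * Real.pi * T) ^ ((d : ℝ) / 2) *
    (sumAfter W Y (Nat.sqrt T) (heatIndicator A (T - Nat.sqrt T)) ω / m ^ Nat.sqrt T) -
    expansion (fun α => sumAfter W Y (Nat.sqrt T) (fun x => hermiteMulti α x (Nat.sqrt T)) ω /
      m ^ Nat.sqrt T) A (2 * k + 3) T)) atTop (𝓝 0) := by
  have hsq : Summable fun T : ℕ => ((T : ℝ) ^ 2)⁻¹ := Real.summable_nat_pow_inv.2 one_lt_two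
  have hmeasA : ∀ s n, Measurable fun ω => sumAfter W Y s (heatIndicator A n) ω / m ^ s := fun s n =>
    (h.measurable_sumAfter s (measurable_heatIndicator hA n)).div_const _
  obtain ⟨C, hC0, hC⟩ := h.exists_lintegral_heat_sub_expansion_le hm hm1 hA hbd (2 * k + 3)
  refine ae_tendsto_zero_of_lintegral_le (b := fun T => C * ((T : ℝ) ^ 2)⁻¹)
    (fun T => (((hmeasA _ _).const_mul _).sub (measurable_expansion (fun α =>
      (h.measurable_sumAfter _ (measurable_hermiteMulti α _)).div_const _) A (2 * k + 3) _)).const_mul _)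
    (hsq.mul_left _) (fun T => by positivity) ?_
  filter_upwards [eventually_ge_atTop 64] with T hT
  have hs := eight_mul_sqrt_le hT
  have hT1 : 1 ≤ T := by omega
  have hs1 : 1 ≤ Nat.sqrt T := Nat.le_sqrt.2 (by omega)
  simp only [enorm_mul (_ ^ k)]
  rw [lintegral_const_mul' _ _ enorm_ne_top,
    Real.enorm_of_nonneg (by positivity : (0 : ℝ) ≤ (T : ℝ) ^ k)]
  have h1 := hC (Nat.sqrt T) (T - Nat.sqrt T) hs1 (by omega)
  rw [show Nat.sqrt T + (T - Nat.sqrt T) = T by omega] at h1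
  refine (mul_le_mul_right h1 _).trans ?_
  rw [← ENNReal.ofReal_mul (by positivity)]
  refine ENNReal.ofReal_le_ofReal ?_
  calc _ = C * ((T : ℝ) ^ k * ((Nat.sqrt T : ℝ) / T) ^ (2 * k + 3 + 1)) := by ring
    _ ≤ _ := by
      gcongr
      exact pow_mul_sqrt_div_pow_le k hT1

/-- Adds three errors: count against heat flow from time s, heat flow against its expansion with the
martingales at time s, and these martingales against their limits. `U` stands for either way of
counting. -/
theorem HasStepBound.ae_isLittleO (hb : HasStepBound P W Y m κ r) (h : IsModel P W Y p)
    (hm : HasSum (fun l : ℕ => (l : ℝ) * p l) m) (hm1 : 1 < m) {A : Set (Fin d → ℝ)}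
    (hA : MeasurableSet A) (hbd : Bornology.IsBounded A) {U : ℕ → Ω → ℝ} (hU : ∀ T, Measurable (U T))
    {C₀ : ℝ} (hC₀ : 0 ≤ C₀) (hUb : ∀ s n : ℕ, ∫⁻ ω, ‖U (s + n + 1) ω -
      sumAfter W Y s (heatIndicator A (n + 1)) ω / m ^ s‖ₑ ∂P ≤ ENNReal.ofReal (C₀ * r ^ s))
    {N : (Fin d → ℕ) → Ω → ℝ} (hN : ∀ α, ∀ᵐ ω ∂P, Tendsto
      (fun t : ℕ => sumAfter W Y t (fun x => hermiteMulti α x t) ω / m ^ t) atTop (𝓝 (N α ω)))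
    (k : ℕ) :
    ∀ᵐ ω ∂P, (fun T : ℕ => (2 * Real.pi * T) ^ ((d : ℝ) / 2) * U T ω -
      expansion (fun α => N α ω) A k T) =o[atTop] (fun T : ℕ => ((T : ℝ) ^ k)⁻¹) := by
  filter_upwards [hb.ae_tendsto_count_sub_heat h hA hU hC₀ hUb k,
    h.ae_tendsto_heat_sub_expansion hm hm1 hA hbd k, ae_all_iff.2 hN,
    ae_all_iff.2 fun α => hb.ae_summable_hermite_increments h α]
    with ω h1 h2 hNω hinc
  have h3 := tendsto_pow_mul_expansion_sub (k := k) (K := 2 * k + 3) (by omega)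
    (M := fun T α => sumAfter W Y (Nat.sqrt T) (fun x => hermiteMulti α x (Nat.sqrt T)) ω /
        m ^ Nat.sqrt T) (N := fun α => N α ω)
    (fun α => tendsto_pow_mul_sub_of_summable_increments
      (a := fun t => sumAfter W Y t (fun x => hermiteMulti α x t) ω / m ^ t) (hinc α) (hNω α) k) A
  refine isLittleO_of_tendsto' ?_ ?_
  · filter_upwards [eventually_ge_atTop 1] with T hT h0
    have : (0 : ℝ) < T := by exact_mod_cast hT
    exact absurd h0 (by positivity)
  · have h4 := (h1.add h2).add h3
    rw [add_zero, add_zero] at h4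
    refine h4.congr fun T => ?_
    rw [div_inv_eq_mul]
    ring

end Asymptotics

/-! ### No two particles at the same place before branching -/

section Injectivity

variable {Ω : Type*} {mΩ : MeasurableSpace Ω} {P : Measure Ω} [IsProbabilityMeasure P] {d : ℕ}
  {W : List ℕ → ℝ≥0 → Ω → (Fin d → ℝ)} {Y : List ℕ → Ω → ℕ} {p : ℕ → ℝ}

theorem stdGauss_singleton (hd : 1 ≤ d) (x : Fin d → ℝ) : stdGauss d {x} = 0 := by
  rw [stdGauss, ← Set.univ_pi_singleton, Measure.pi_pi]
  refine Finset.prod_eq_zero (i := ⟨0, hd⟩) (Finset.mem_univ _) ?_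
  have := nullSingletonClass_gaussianReal (μ := 0) (v := 1) one_ne_zero
  exact measure_singleton _

/-- Given everything else, the last displacement of u would have to hit one prescribed point, which
is null for the Gaussian law when d ≥ 1. -/
theorem IsModel.ae_deathPlace_ne (h : IsModel P W Y p) (hd : 1 ≤ d) {u v : List ℕ}
    (hlen : v.length = u.length) (hne : v ≠ u) : ∀ᵐ ω ∂P, deathPlace W ω u ≠ deathPlace W ω v := by
  have hS : MeasurableSet {q : ((Fin d → ℝ) × (Fin d → ℝ)) × (Fin d → ℝ) | q.1.1 + q.2 = q.1.2} :=
    measurableSet_eq_fun (by fun_prop) (by fun_prop)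
  have key := lintegral_of_indep (Z := fun ω => (birthPlace W ω u, deathPlace W ω v)) (V := W u 1)
    (F := fun z w => {q : ((Fin d → ℝ) × (Fin d → ℝ)) × (Fin d → ℝ) |
      q.1.1 + q.2 = q.1.2}.indicator (fun _ => (1 : ENNReal)) (z, w))
    (h.othersSigma_le (Sum.inl u))
    ((measurable_birthPlace_othersSigma_inl le_rfl).prodMk
      (measurable_deathPlace_othersSigma_inl hlen.le hne))
    ((h.wiener u).measurable 1) (h.indep_displacement u) (measurable_const.indicator hS)
  have hzero : ∀ z : (Fin d → ℝ) × (Fin d → ℝ), ∫⁻ w, {q : ((Fin d → ℝ) × (Fin d → ℝ)) × (Fin d → ℝ) |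
      q.1.1 + q.2 = q.1.2}.indicator (fun _ => (1 : ENNReal)) (z, w) ∂stdGauss d = 0 := by
    intro z
    have heq : ∀ w, {q : ((Fin d → ℝ) × (Fin d → ℝ)) × (Fin d → ℝ) |
        q.1.1 + q.2 = q.1.2}.indicator (fun _ => (1 : ENNReal)) (z, w) =
        ({z.2 - z.1} : Set (Fin d → ℝ)).indicator (fun _ => (1 : ENNReal)) w := by
      intro w
      have : z.1 + w = z.2 ↔ w = z.2 - z.1 := by rw [eq_sub_iff_add_eq, add_comm]
      by_cases hw : w = z.2 - z.1
      · rw [Set.indicator_of_mem (by exact this.2 hw), Set.indicator_of_mem (by exact hw)]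
      · rw [Set.indicator_of_notMem (by exact fun h' => hw (this.1 h')),
          Set.indicator_of_notMem (by exact hw)]
    simp only [heq]
    rw [lintegral_indicator_const (measurableSet_singleton _), stdGauss_singleton hd, mul_zero]
  rw [h.map_displacement] at key
  simp only [hzero, lintegral_zero] at key
  rw [lintegral_eq_zero_iff (by
    exact (measurable_const.indicator hS).comp (((h.measurable_birthPlace u).prodMk
      (h.measurable_deathPlace v)).prodMk ((h.wiener u).measurable 1)))] at key
  filter_upwards [key] with ω hω heq
  rw [Set.indicator_of_mem (by exact heq)] at hω
  exact one_ne_zero hω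

theorem IsModel.ae_injOn_deathPlace (h : IsModel P W Y p) (hd : 1 ≤ d) :
    ∀ᵐ ω ∂P, ∀ t, Set.InjOn (deathPlace W ω) (generation Y ω t) := by
  have : ∀ᵐ ω ∂P, ∀ u v : List ℕ, v.length = u.length → v ≠ u →
      deathPlace W ω u ≠ deathPlace W ω v := by
    rw [ae_all_iff]
    intro u
    rw [ae_all_iff]
    intro v
    by_cases hlen : v.length = u.length
    swap
    · simp [hlen]
    by_cases hne : v = u
    · simp [hne]
    filter_upwards [h.ae_deathPlace_ne hd hlen hne] with ω hω _ _
    exact hω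
  filter_upwards [this] with ω hω t u hu v hv huv
  by_contra hne
  exact hω u v ((mem_generation_iff.1 (Finset.mem_coe.1 hv)).1.trans
    (mem_generation_iff.1 (Finset.mem_coe.1 hu)).1.symm) (Ne.symm hne) huv

end Injectivity

/-! ### Martingales, limits and translation to occupation numbers -/

section Martingales

variable {Ω : Type*} {mΩ : MeasurableSpace Ω} {P : Measure Ω} [IsProbabilityMeasure P] {d : ℕ}
  {W : List ℕ → ℝ≥0 → Ω → (Fin d → ℝ)} {Y : List ℕ → Ω → ℕ} {p : ℕ → ℝ} {m : ℝ}

theorem lintegral_hermiteMulti_sq_ne_top (α : Fin d → ℕ) (t : ℕ) :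
    ∫⁻ w, ‖hermiteMulti α (√(t : ℝ) • w) t‖ₑ ^ 2 ∂stdGauss d ≠ ⊤ := by
  obtain ⟨C, hC⟩ := exists_lintegral_hermiteMulti_sq_le α
  exact ne_top_of_le_ne_top (ENNReal.mul_ne_top ENNReal.coe_ne_top
    (ENNReal.pow_ne_top (ENNReal.natCast_ne_top t))) (hC t)

theorem lintegral_hermiteMulti_ne_top (α : Fin d → ℕ) (t : ℕ) :
    ∫⁻ w, ‖hermiteMulti α (√(t : ℝ) • w) t‖ₑ ∂stdGauss d ≠ ⊤ := by
  refine ne_top_of_le_ne_top (b := ∫⁻ w, (1 + ‖hermiteMulti α (√(t : ℝ) • w) t‖ₑ ^ 2) ∂stdGauss d)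
    ?_ (lintegral_mono fun w => ?_)
  · rw [lintegral_add_left measurable_const, lintegral_one, measure_univ]
    exact ENNReal.add_ne_top.2 ⟨ENNReal.one_ne_top, lintegral_hermiteMulti_sq_ne_top α t⟩
  · rcases le_total ‖hermiteMulti α (√(t : ℝ) • w) t‖ₑ 1 with h1 | h1
    · exact h1.trans le_self_add
    · exact (le_self_pow₀ h1 two_ne_zero).trans le_add_self

theorem IsModel.integrable_sumAfter_hermite (h : IsModel P W Y p)
    (hm : HasSum (fun l : ℕ => (l : ℝ) * p l) m) (α : Fin d → ℕ) (t : ℕ) :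
    Integrable (sumAfter W Y t fun x => hermiteMulti α x t) P := by
  refine ⟨(h.measurable_sumAfter t (measurable_hermiteMulti α _)).aestronglyMeasurable, ?_⟩
  refine (h.lintegral_enorm_sumAfter_le hm t (measurable_hermiteMulti α _)).trans_lt ?_
  exact ENNReal.mul_lt_top (ENNReal.pow_lt_top ENNReal.ofReal_lt_top)
    (lintegral_hermiteMulti_ne_top α t).lt_top

theorem IsModel.integrable_sumBefore_hermite (h : IsModel P W Y p)
    (hm : HasSum (fun l : ℕ => (l : ℝ) * p l) m) (α : Fin d → ℕ) (t : ℕ) :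
    Integrable (sumBefore W Y t fun x => hermiteMulti α x (t + 1 : ℕ)) P := by
  refine ⟨(h.measurable_sumBefore t (measurable_hermiteMulti α _)).aestronglyMeasurable, ?_⟩
  refine (h.lintegral_enorm_sumBefore_le hm t (measurable_hermiteMulti α _)).trans_lt ?_
  exact ENNReal.mul_lt_top (ENNReal.pow_lt_top ENNReal.ofReal_lt_top)
    (lintegral_hermiteMulti_ne_top α (t + 1)).lt_top

theorem IsModel.setIntegral_sumBefore_hermite (h : IsModel P W Y p)
    (hm : HasSum (fun l : ℕ => (l : ℝ) * p l) m) (α : Fin d → ℕ) (t : ℕ) {b : ℕ} {B : Set Ω}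
    (hB : MeasurableSet[history W Y t b] B) :
    ∫ ω in B, sumBefore W Y t (fun x => hermiteMulti α x (t + 1 : ℕ)) ω ∂P =
      ∫ ω in B, sumAfter W Y t (fun x => hermiteMulti α x t) ω ∂P := by
  have := h.setIntegral_sumBefore_sub hm t (measurable_hermiteMulti α _)
    (lintegral_hermiteMulti_sq_ne_top α (t + 1)) hB
  rw [heatStep_hermiteMulti, integral_sub (h.integrable_sumBefore_hermite hm α t).integrableOn
    (h.integrable_sumAfter_hermite hm α t).integrableOn] at this
  exact sub_eq_zero.1 this

theorem IsModel.setIntegral_sumAfter_succ_hermite (h : IsModel P W Y p)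
    (hm : HasSum (fun l : ℕ => (l : ℝ) * p l) m)
    (hvar : Summable (fun l : ℕ => ((l : ℝ) - m) ^ 2 * p l)) (α : Fin d → ℕ) (t : ℕ) {a : ℕ}
    {B : Set Ω} (hB : MeasurableSet[history W Y a t] B) :
    ∫ ω in B, sumAfter W Y (t + 1) (fun x => hermiteMulti α x (t + 1 : ℕ)) ω ∂P =
      m * ∫ ω in B, sumBefore W Y t (fun x => hermiteMulti α x (t + 1 : ℕ)) ω ∂P := by
  have := h.setIntegral_sumAfter_succ_sub hm hvar t (measurable_hermiteMulti α _)
    (lintegral_hermiteMulti_sq_ne_top α (t + 1)) hB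
  rw [integral_sub (h.integrable_sumAfter_hermite hm α (t + 1)).integrableOn
    ((h.integrable_sumBefore_hermite hm α t).const_mul m).integrableOn, integral_const_mul] at this
  exact sub_eq_zero.1 this

theorem normalizedSum_occAfter (α : Fin d → ℕ) (t : ℕ) (ω : Ω) :
    normalizedSum m α t (occAfter W Y t ω) =
      sumAfter W Y t (fun x => hermiteMulti α x t) ω / m ^ t := by
  rw [normalizedSum, finsum_mul_occAfter (fun x => hermiteMulti α x t)]

theorem normalizedSum_occBefore (α : Fin d → ℕ) (t : ℕ) (ω : Ω)
    (hinj : Set.InjOn (deathPlace W ω) (generation Y ω t)) :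
    normalizedSum m α (t + 1) (occBefore W Y (t + 1) ω) =
      sumBefore W Y t (fun x => hermiteMulti α x (t + 1 : ℕ)) ω / m ^ (t + 1) := by
  rw [normalizedSum, finsum_mul_occBefore_of_injOn (fun x => hermiteMulti α x (t + 1 : ℕ)) t ω hinj]

theorem IsModel.martingale_after (h : IsModel P W Y p)
    (hm : HasSum (fun l : ℕ => (l : ℝ) * p l) m) (hm1 : 1 < m)
    (hvar : Summable (fun l : ℕ => ((l : ℝ) - m) ^ 2 * p l)) (α : Fin d → ℕ) :
    Martingale (fun (t : ℕ) ω => normalizedSum m α t (occAfter W Y t ω)) (historyAfter h) P := by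
  have hm0 : m ≠ 0 := (zero_lt_one.trans hm1).ne'
  simp only [normalizedSum_occAfter]
  refine martingale_of_setIntegral_eq_succ (fun t => ?_)
    (fun t => (h.integrable_sumAfter_hermite hm α t).div_const _) fun t B hB => ?_
  · refine Measurable.stronglyMeasurable (Measurable.div_const ?_ _)
    exact BranchingWiener.measurable_sumAfter (𝒢 := history W Y t t)
      (fun v hv => measurable_history_displacement hv)
      (fun v hv => measurable_history_offspring hv) (measurable_hermiteMulti α t)
  · simp only [integral_div]
    rw [h.setIntegral_sumAfter_succ_hermite hm hvar α t (a := t) hB,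
      h.setIntegral_sumBefore_hermite hm α t (b := t) hB, pow_succ]
    field_simp

theorem IsModel.martingale_before (h : IsModel P W Y p) (hd : 1 ≤ d)
    (hm : HasSum (fun l : ℕ => (l : ℝ) * p l) m) (hm1 : 1 < m)
    (hvar : Summable (fun l : ℕ => ((l : ℝ) - m) ^ 2 * p l)) (α : Fin d → ℕ) :
    Martingale (fun (t : ℕ) ω => normalizedSum m α (t + 1) (occBefore W Y (t + 1) ω))
      (historyBefore h) P := by
  have hm0 : m ≠ 0 := (zero_lt_one.trans hm1).ne'
  -- Almost sure injectivity suffices for integrals; adaptedness is proved separately at every ω.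
  have hae : ∀ t : ℕ, (fun ω => normalizedSum m α (t + 1) (occBefore W Y (t + 1) ω)) =ᵐ[P]
      fun ω => sumBefore W Y t (fun x => hermiteMulti α x (t + 1 : ℕ)) ω / m ^ (t + 1) := by
    intro t
    filter_upwards [h.ae_injOn_deathPlace hd] with ω hω
    exact normalizedSum_occBefore α t ω (hω t)
  refine martingale_of_setIntegral_eq_succ (fun t => ?_)
    (fun t => ((h.integrable_sumBefore_hermite hm α t).div_const _).congr (hae t).symm)
    fun t B hB => ?_
  · refine Measurable.stronglyMeasurable (Measurable.div_const ?_ _)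
    exact measurable_finsum_mul_occBefore (𝒢 := history W Y (t + 1) t)
      (fun v hv => measurable_history_displacement hv)
      (fun v hv => measurable_history_offspring hv) (measurable_hermiteMulti α _)
  · rw [integral_congr_ae (ae_restrict_of_ae (hae t)),
      integral_congr_ae (ae_restrict_of_ae (hae (t + 1)))]
    simp only [integral_div]
    rw [h.setIntegral_sumBefore_hermite hm α (t + 1) (b := t) hB,
      h.setIntegral_sumAfter_succ_hermite hm hvar α t (a := t + 1) hB, pow_succ m (t + 1)]
    field_simp

theorem heatIndicator_zero_eq (A : Set (Fin d → ℝ)) :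
    heatIndicator A 0 = A.indicator (fun _ => (1 : ℝ)) :=
  funext fun x => heatIndicator_zero A x

theorem particleCount_occAfter (A : Set (Fin d → ℝ)) (t : ℕ) (ω : Ω) :
    particleCount (occAfter W Y t ω) A = sumAfter W Y t (heatIndicator A 0) ω := by
  rw [particleCount_eq, finsum_mul_occAfter, heatIndicator_zero_eq]

theorem particleCount_occBefore (A : Set (Fin d → ℝ)) (t : ℕ) (ω : Ω)
    (hinj : Set.InjOn (deathPlace W ω) (generation Y ω t)) :
    particleCount (occBefore W Y (t + 1) ω) A = sumBefore W Y t (heatIndicator A 0) ω := by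
  rw [particleCount_eq, finsum_mul_occBefore_of_injOn _ _ _ hinj, heatIndicator_zero_eq]

/-- Absolutely summable increments give the limit directly, without a martingale convergence
theorem; a measurable version is then selected. -/
theorem IsModel.exists_hermite_limits (h : IsModel P W Y p)
    (hm : HasSum (fun l : ℕ => (l : ℝ) * p l) m) (hm1 : 1 < m)
    (hvar : Summable (fun l : ℕ => ((l : ℝ) - m) ^ 2 * p l)) :
    ∃ N : (Fin d → ℕ) → Ω → ℝ, (∀ α, Measurable (N α)) ∧ ∀ α, ∀ᵐ ω ∂P, Tendsto
      (fun t : ℕ => sumAfter W Y t (fun x => hermiteMulti α x t) ω / m ^ t) atTop (𝓝 (N α ω)) := by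
  have hb := h.hasStepBound hm hm1 hvar
  have key : ∀ α : Fin d → ℕ, ∃ N : Ω → ℝ, Measurable N ∧ ∀ᵐ ω ∂P, Tendsto
      (fun t : ℕ => sumAfter W Y t (fun x => hermiteMulti α x t) ω / m ^ t) atTop (𝓝 (N ω)) := by
    intro α
    refine measurable_limit_of_tendsto_metrizable_ae
      (fun t => ((h.measurable_sumAfter t (measurable_hermiteMulti α t)).div_const _).aemeasurable) ?_
    filter_upwards [hb.ae_summable_hermite_increments h α] with ω hω
    exact exists_limit_of_summable_increments hω
  choose N hN using key
  exact ⟨N, fun α => (hN α).1, fun α => (hN α).2⟩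

end Martingales

end

end BranchingWiener

/-- The same assertion is made for the particles counted just before they branch (first conjunct,
where `m⁻ᵗ V_α(t)` is a martingale for `t ≥ 1`) and just after (second conjunct, `t ≥ 0`). -/
theorem theorem1p1 {Ω : Type*} [MeasurableSpace Ω] (P : Measure Ω) [IsProbabilityMeasure P]
    (d : ℕ) (hd : 1 ≤ d)
    (W : List ℕ → ℝ≥0 → Ω → (Fin d → ℝ)) (Y : List ℕ → Ω → ℕ) (p : ℕ → ℝ) (m : ℝ)
    (h : BranchingWiener.IsModel P W Y p)
    (hm : HasSum (fun l : ℕ => (l : ℝ) * p l) m) (hm1 : 1 < m)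
    (hvar : Summable (fun l : ℕ => ((l : ℝ) - m) ^ 2 * p l)) :
    (∃ N : (Fin d → ℕ) → Ω → ℝ,
      (∀ α, Measurable (N α)) ∧
      (∀ α, Martingale
        (fun (t : ℕ) ω => BranchingWiener.normalizedSum m α (t + 1)
          (BranchingWiener.occBefore W Y (t + 1) ω))
        (BranchingWiener.historyBefore h) P) ∧
      (∀ α, ∀ᵐ ω ∂P, Tendsto
        (fun t : ℕ => BranchingWiener.normalizedSum m α t (BranchingWiener.occBefore W Y t ω))
        atTop (𝓝 (N α ω))) ∧
      ∀ k : ℕ, 1 ≤ k → ∀ A : Set (Fin d → ℝ), MeasurableSet A → Bornology.IsBounded A →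
        ∀ᵐ ω ∂P,
          (fun T : ℕ => (2 * Real.pi * T) ^ ((d : ℝ) / 2) *
              (BranchingWiener.particleCount (BranchingWiener.occBefore W Y T ω) A / m ^ T) -
            BranchingWiener.expansion (fun α => N α ω) A k T)
          =o[atTop] (fun T : ℕ => ((T : ℝ) ^ k)⁻¹)) ∧
    (∃ N : (Fin d → ℕ) → Ω → ℝ,
      (∀ α, Measurable (N α)) ∧
      (∀ α, Martingale
        (fun (t : ℕ) ω => BranchingWiener.normalizedSum m α t
          (BranchingWiener.occAfter W Y t ω))
        (BranchingWiener.historyAfter h) P) ∧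
      (∀ α, ∀ᵐ ω ∂P, Tendsto
        (fun t : ℕ => BranchingWiener.normalizedSum m α t (BranchingWiener.occAfter W Y t ω))
        atTop (𝓝 (N α ω))) ∧
      ∀ k : ℕ, 1 ≤ k → ∀ A : Set (Fin d → ℝ), MeasurableSet A → Bornology.IsBounded A →
        ∀ᵐ ω ∂P,
          (fun T : ℕ => (2 * Real.pi * T) ^ ((d : ℝ) / 2) *
              (BranchingWiener.particleCount (BranchingWiener.occAfter W Y T ω) A / m ^ T) -
            BranchingWiener.expansion (fun α => N α ω) A k T)
          =o[atTop] (fun T : ℕ => ((T : ℝ) ^ k)⁻¹)) := by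
  have hb := h.hasStepBound hm hm1 hvar
  have hm0 : 0 < m := zero_lt_one.trans hm1
  have hC₀ := mul_nonneg hb.nonneg (inv_nonneg.2 (sub_nonneg.2 hb.lt_one.le))
  obtain ⟨N, hNm, hN⟩ := h.exists_hermite_limits hm hm1 hvar
  constructor
  -- Before branching at time T the particles are those of generation T - 1, while the count is
  -- divided by m^T: all limits acquire the factor 1/m.
  · refine ⟨fun α ω => m⁻¹ * N α ω, fun α => (hNm α).const_mul _,
      h.martingale_before hd hm hm1 hvar, fun α => ?_, fun k _ A hA hbd => ?_⟩
    · filter_upwards [h.ae_injOn_deathPlace hd, hN α, hb.ae_tendsto_before_sub_after h α]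
        with ω hinj hlim hsub
      refine (tendsto_add_atTop_iff_nat 1).1 ?_
      have h1 := (hsub.add hlim).const_mul m⁻¹
      rw [zero_add] at h1
      refine h1.congr fun t => ?_
      rw [BranchingWiener.normalizedSum_occBefore α t ω (hinj t), pow_succ]
      field_simp
      ring
    -- The truncated T - 1 at T = 0 is harmless: the bound required of `U` concerns times s + n + 1
    -- only.
    · have h1 := hb.ae_isLittleO h hm hm1 hA hbd
        (U := fun T ω => BranchingWiener.sumBefore W Y (T - 1)
          (BranchingWiener.heatIndicator A 0) ω / m ^ (T - 1))
        (fun T => (h.measurable_sumBefore _ (BranchingWiener.measurable_heatIndicator hA 0)).div_const _)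
        hC₀ (fun s n => hb.lintegral_before_indicator_sub_le h hA s n) hN k
      filter_upwards [h1, h.ae_injOn_deathPlace hd] with ω hω hinj
      refine (hω.const_mul_left m⁻¹).congr' ?_ EventuallyEq.rfl
      filter_upwards [eventually_ge_atTop 1] with T hT
      obtain ⟨t, rfl⟩ : ∃ t, T = t + 1 := ⟨T - 1, by omega⟩
      rw [BranchingWiener.particleCount_occBefore A t ω (hinj t),
        BranchingWiener.expansion_const_mul, Nat.add_sub_cancel, pow_succ]
      field_simp
  · refine ⟨N, hNm, h.martingale_after hm hm1 hvar, fun α => ?_, fun k _ A hA hbd => ?_⟩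
    · simp only [BranchingWiener.normalizedSum_occAfter]
      exact hN α
    · simp only [BranchingWiener.particleCount_occAfter]
      exact hb.ae_isLittleO h hm hm1 hA hbd
        (U := fun T ω => BranchingWiener.sumAfter W Y T (BranchingWiener.heatIndicator A 0) ω / m ^ T)
        (fun T => (h.measurable_sumAfter _ (BranchingWiener.measurable_heatIndicator hA 0)).div_const _)
        -- After branching, generation s + n + 1 lies n + 1 heat steps beyond s, hence the argument
        -- n + 1.
        hC₀ (fun s n => hb.lintegral_after_indicator_sub_le h hA s (n + 1)) hN k
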